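/- For points $p\in\mathbb{R}^d$, a finite set $P\subset\mathbb{R}^d$ and a $k$-tuple $S$ of centers in $\mathbb{R}^d$ let $\mathrm{cost}(p,S)=\min_{s\in S}\|p-s\|^2$ and $\mathrm{cost}(P,S)=\sum_{p\in P}\mathrm{cost}(p,S)$, and let $\mathrm{OPT}_k=\inf_S\mathrm{cost}(P,S)$ over all $k$-tuples $S$ (with $\mathrm{OPT}_0=\infty$ for nonempty $P$). $P$ is called $\beta$-stable if $(1+\beta)\,\mathrm{OPT}_k\le\mathrm{OPT}_{k-1}$. Sensitivity Sampling with sample size $m$: let $A=(a_1,\dots,a_k)$ be a $\gamma$-approximate solution, $\mathrm{cost}(P,A)\le\gamma\,\mathrm{OPT}_k$, let $C_j\subseteq P$ be the cluster of the points assigned to their nearest center $a_j$ (ties broken arbitrarily), and for $p\in C_j$ let $\Delta_p=\mathrm{cost}(C_j,A)/|C_j|$. Let $\mu$ be the probability distribution on $P$ with $$\mu(p)=\frac14\left(\frac1{k|C_j|}+\frac{\mathrm{cost}(p,A)}{k\,\mathrm{cost}(C_j,A)}+\frac{\mathrm{cost}(p,A)}{\mathrm{cost}(P,A)}+\frac{\Delta_p}{\mathrm{cost}(P,A)}\right)\qquad(p\in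 C_j);$$ if some cluster is empty or has cost $0$, terms $0/0$ are read as $0$ and $\mu$ is normalized to total mass $1$. Draw $q_1,\dots,q_m$ independently from $\mu$ and give $q_i$ the weight $w_i=1/(m\,\mu(q_i))$. Theorem. There is an absolute constant $a\in\mathbb{N}$ such that for every $\gamma\ge1$ there is a constant $C=C(\gamma)>0$ with the following property. Let $d\ge 0$, $k\ge1$, $\beta>0$, $\varepsilon\in(0,1)$, let $P\subset\mathbb{R}^d$ be a nonempty finite $\beta$-stable set, and let $A$ be any $\gamma$-approximate $k$-means solution for $P$. If $$m\ \ge\ C\cdot\frac{k}{\varepsilon^{2}}\cdot\max(1,\beta^{-1})\cdot\log^{a}\!\left(\frac{2k}{\varepsilon}\right),$$ then with probability at least $2/3$ the weighted sample of $m$ points produced by Sensitivity Sampling is an $\varepsilon$-coreset of $P$, i.e. for all $k$-tuples $S$ of centers in $\mathbb{R}^d$ simultaneously $$(1-\varepsilon)\,\mathrm{cost}(P,S)\ \le\ \sum_{i=1}^m w_i\,\mathrm{cost}(q_i,S)\ \le\ (1+\varepsilon)\,\mathrm{cost}(P,S).$$ In particular, for $\beta=\Omega(1)$, coresets of size $\tilde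 O(k/\varepsilon^2)$ are obtained. The sampling distribution does not depend on $\beta$. -/

import Mathlib

open scoped ENNReal

noncomputable section

namespace KMeans

/-- Points of `d`-dimensional Euclidean space. -/
abbrev Pt (d : ℕ) := EuclideanSpace ℝ (Fin d)

/-- `cost(p, S)`: squared distance of `p` to the nearest of the (at least one) centers `S`. -/
def ptCost {d k : ℕ} (p : Pt d) (S : Fin k → Pt d) : ℝ :=
  ⨅ i, ‖p - S i‖ ^ 2

/-- `cost(P, S)`: the `k`-means cost of `P` with respect to the (at least one) centers `S`. -/
def cost {d k : ℕ} (P : Finset (Pt d)) (S : Fin k → Pt d) : ℝ :=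
  ∑ p ∈ P, ptCost p S

/-- `OPT_k`: the optimal `k`-means cost of `P`. It is extended-valued only so that a nonempty
set has infinite cost when there is no center at all (`k = 0`). -/
def optCost {d : ℕ} (P : Finset (Pt d)) (k : ℕ) : ℝ≥0∞ :=
  ⨅ S : Fin k → Pt d, ∑ p ∈ P, ⨅ i, ENNReal.ofReal (‖p - S i‖ ^ 2)

/-- With at least one center, `OPT_k` is the infimum of the real-valued costs. -/
theorem optCost_eq {d k : ℕ} (P : Finset (Pt d)) (hk : 1 ≤ k) :
    optCost P k = ⨅ S : Fin k → Pt d, ENNReal.ofReal (cost P S) := by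
  have : Nonempty (Fin k) := ⟨⟨0, hk⟩⟩
  refine iInf_congr fun S => ?_
  rw [cost, ENNReal.ofReal_sum_of_nonneg fun p _ => show 0 ≤ ptCost p S from
    Real.iInf_nonneg fun i => sq_nonneg _]
  refine Finset.sum_congr rfl fun p _ => ?_
  rw [ptCost, ENNReal.ofReal_iInf]

/-- `P` is `β`-stable for `k`-means: `(1 + β) OPT_k ≤ OPT_{k-1}` (used with `1 ≤ k`). -/
def IsStable {d : ℕ} (β : ℝ) (k : ℕ) (P : Finset (Pt d)) : Prop :=
  ENNReal.ofReal (1 + β) * optCost P k ≤ optCost P (k - 1)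

/-- `A` is a `γ`-approximate `k`-means solution for `P`. -/
def IsApprox {d k : ℕ} (γ : ℝ) (P : Finset (Pt d)) (A : Fin k → Pt d) : Prop :=
  ENNReal.ofReal (cost P A) ≤ ENNReal.ofReal γ * optCost P k

/-- `c` assigns each point of `P` to (the index of) a nearest center of `A`. -/
def IsNearest {d k : ℕ} (P : Finset (Pt d)) (A : Fin k → Pt d) (c : Pt d → Fin k) : Prop :=
  ∀ p ∈ P, ∀ i, ‖p - A (c p)‖ ≤ ‖p - A i‖

/-- The cluster `C_j` of the points assigned to center `j`. -/
def cluster {d k : ℕ} (P : Finset (Pt d)) (c : Pt d → Fin k) (j : Fin k) : Finset (Pt d) :=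
  P.filter fun p => c p = j

/-- `Δ_p`: the average cost of the cluster containing `p`. -/
def avgCost {d k : ℕ} (P : Finset (Pt d)) (A : Fin k → Pt d) (c : Pt d → Fin k)
    (p : Pt d) : ℝ :=
  cost (cluster P c (c p)) A / (cluster P c (c p)).card

/-- The four-term sensitivity score of a point `p`; terms of the form `0 / 0` count as `0`. -/
def score {d k : ℕ} (P : Finset (Pt d)) (A : Fin k → Pt d) (c : Pt d → Fin k)
    (p : Pt d) : ℝ :=
  1 / 4 * (1 / (k * (cluster P c (c p)).card)
    + ptCost p A / (k * cost (cluster P c (c p)) A)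
    + ptCost p A / cost P A
    + avgCost P A c p / cost P A)

/-- The sampling probability `μ(p)`: the score, normalized. The scores of `P` already add up
to `1` (see `sum_score`) if no cluster is empty or has cost zero; the normalization gives the
distribution a meaning in the remaining cases. -/
def prob {d k : ℕ} (P : Finset (Pt d)) (A : Fin k → Pt d) (c : Pt d → Fin k)
    (p : Pt d) : ℝ :=
  score P A c p / ∑ p' ∈ P, score P A c p'

theorem ptCost_nonneg {d k : ℕ} (p : Pt d) (S : Fin k → Pt d) : 0 ≤ ptCost p S :=
  Real.iInf_nonneg fun _ => sq_nonneg _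

theorem cost_nonneg {d k : ℕ} (P : Finset (Pt d)) (S : Fin k → Pt d) : 0 ≤ cost P S :=
  Finset.sum_nonneg fun p _ => ptCost_nonneg p S

theorem score_pos {d k : ℕ} (P : Finset (Pt d)) (A : Fin k → Pt d) (c : Pt d → Fin k)
    {p : Pt d} (hp : p ∈ P) : 0 < score P A c p := by
  have hk : (0 : ℝ) < k := by exact_mod_cast (c p).pos
  have hc : (0 : ℝ) < (cluster P c (c p)).card := by
    exact_mod_cast Finset.card_pos.2 ⟨p, by simp [cluster, hp]⟩
  have h1 := ptCost_nonneg p A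
  have h2 := cost_nonneg P A
  have h3 := cost_nonneg (cluster P c (c p)) A
  unfold score avgCost
  positivity

theorem sum_score {d k : ℕ} (P : Finset (Pt d)) (A : Fin k → Pt d) (c : Pt d → Fin k)
    (hk : 1 ≤ k) (hc : ∀ j, 0 < cost (cluster P c j) A) :
    ∑ p ∈ P, score P A c p = 1 := by
  have hk' : (k : ℝ) ≠ 0 := by positivity
  have hcard : ∀ j, ((cluster P c j).card : ℝ) ≠ 0 := fun j h => by
    have h0 : cluster P c j = ∅ := by simpa using h
    have := hc j
    simp [h0, cost] at this
  have fib : ∀ f : Pt d → ℝ, ∑ p ∈ P, f p = ∑ j, ∑ p ∈ cluster P c j, f p := fun f =>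
    (Finset.sum_fiberwise P c f).symm
  have hP : cost P A = ∑ j, cost (cluster P c j) A := fib _
  have hP0 : cost P A ≠ 0 := by
    rw [hP]
    exact (Finset.sum_pos (fun j _ => hc j) ⟨⟨0, hk⟩, Finset.mem_univ _⟩).ne'
  have key : ∀ j, ∑ p ∈ cluster P c j, score P A c p
      = 1 / 4 * (2 / k + 2 * (cost (cluster P c j) A / cost P A)) := by
    intro j
    have e : ∀ p ∈ cluster P c j, score P A c p
        = 1 / 4 * (1 / (k * (cluster P c j).card) + ptCost p A / (k * cost (cluster P c j) A)
          + ptCost p A / cost P A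
          + cost (cluster P c j) A / (cluster P c j).card / cost P A) := by
      intro p hp
      have : c p = j := (Finset.mem_filter.1 hp).2
      simp [score, avgCost, this]
    rw [Finset.sum_congr rfl e, ← Finset.mul_sum]
    simp only [Finset.sum_add_distrib, ← Finset.sum_div, Finset.sum_const, nsmul_eq_mul]
    have : ∑ p ∈ cluster P c j, ptCost p A = cost (cluster P c j) A := rfl
    rw [this]
    have h1 := hcard j
    have h2 := (hc j).ne'
    field_simp
    ring
  rw [fib, Finset.sum_congr rfl fun j _ => key j, ← Finset.mul_sum, Finset.sum_add_distrib,
    ← Finset.mul_sum, ← Finset.sum_div Finset.univ (fun j => cost (cluster P c j) A), ← hP,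
    div_self hP0, Finset.sum_const, Finset.card_univ, Fintype.card_fin, nsmul_eq_mul]
  field_simp
  norm_num

theorem prob_nonneg {d k : ℕ} (P : Finset (Pt d)) (A : Fin k → Pt d) (c : Pt d → Fin k)
    {p : Pt d} (hp : p ∈ P) : 0 ≤ prob P A c p :=
  div_nonneg (score_pos P A c hp).le (Finset.sum_nonneg fun _ h => (score_pos P A c h).le)

theorem sum_prob {d k : ℕ} (P : Finset (Pt d)) (A : Fin k → Pt d) (c : Pt d → Fin k)
    (hP : P.Nonempty) : ∑ p ∈ P, prob P A c p = 1 := by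
  unfold prob
  rw [← Finset.sum_div]
  exact div_self (Finset.sum_pos (fun _ h => score_pos P A c h) hP).ne'

/-- The sampling distribution `μ` on the points of `P`. -/
def samplingPMF {d k : ℕ} (P : Finset (Pt d)) (hP : P.Nonempty) (A : Fin k → Pt d)
    (c : Pt d → Fin k) : PMF P :=
  PMF.ofFintype (fun p => ENNReal.ofReal (prob P A c p)) (by
    rw [← ENNReal.ofReal_sum_of_nonneg fun p _ => prob_nonneg P A c p.2,
      Finset.sum_coe_sort P fun p => prob P A c p, sum_prob P A c hP, ENNReal.ofReal_one])

/-- The law of the `m` samples drawn by Sensitivity Sampling: independent, each with law `μ`. -/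
def sampleLaw {d k : ℕ} (P : Finset (Pt d)) (hP : P.Nonempty) (A : Fin k → Pt d)
    (c : Pt d → Fin k) (m : ℕ) : MeasureTheory.Measure (Fin m → P) :=
  MeasureTheory.Measure.pi fun _ => (samplingPMF P hP A c).toMeasure

/-- The weight `1 / (m μ(q))` of a sampled point `q`. -/
def weight {d k : ℕ} (P : Finset (Pt d)) (A : Fin k → Pt d) (c : Pt d → Fin k) (m : ℕ)
    (q : Pt d) : ℝ :=
  1 / (m * prob P A c q)

/-- The points `q 0, …, q (m - 1)` with weights `w 0, …, w (m - 1)` form an `ε`-coreset of `P`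
for `k`-means. -/
def IsCoreset {d m : ℕ} (k : ℕ) (ε : ℝ) (P : Finset (Pt d)) (q : Fin m → Pt d)
    (w : Fin m → ℝ) : Prop :=
  ∀ S : Fin k → Pt d,
    (1 - ε) * cost P S ≤ ∑ i, w i * ptCost (q i) S ∧
      ∑ i, w i * ptCost (q i) S ≤ (1 + ε) * cost P S

end KMeans

end

/-!
A weighted sample estimates `cost P S` for one solution `S` without bias. To control all solutions
at once, the cost of a point `q` assigned to the center `a` of `A` is split into `cost(a, S)` and
the excess `cost(q, S) - cost(a, S)`. The first part is constant on each cluster of `A`, so it is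
estimated well as soon as the sizes of all clusters are, which follows from a Chernoff bound
(`wProb_not_goodSamples_le`, `abs_estimate_sub_cost_le`). Of the sampling probabilities, only the
lower bounds `1 / (4 k |C_j|)` and `cost(q, A) / (4 cost(P, A))` are used.

For a single `S` of total cost `M = cost P A + cost P S` the weighted excesses have a sum of squares
of at most a constant times `cost(P, A) M / m` (`Balanced.sum_weight_envelope_sq_le`). After
symmetrization with a second sample (`wProb_deviation_le`), the excesses for all `S` are compared
by chaining along finite codes for the solutions (`wProb_chaining_le`). The number of codes does
not depend on the dimension: a vector of the unit ball is known up to `η` in finitely many given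
directions from `1 / η ^ 2` of these directions with signs (`exists_code_unit`). Coding every
center at a suitable scale (`exists_centerCode`), with accuracy `2 ^ (-h)`, takes about `4 ^ h`
symbols for each of the `k` centers (`card_solCode_le`).

These codes determine the excess up to an error proportional to `‖q - a‖` (`abs_excess_sub_le`),
except on ambiguous clusters, those that see two centers of `S` at comparable distances. For an
ambiguous cluster the distances of `a` to the centers of `S` are recorded as well, at the price of
`k` more symbols. Stability enters only here: if there were many ambiguous clusters, the centers of
`A` or `S` could be merged or dropped at a small cost (`IsStable.card_ambiguous_le`), and a set of
`k - e` centers costs at least a constant times `e β OPT_k` (`IsStable.saved_centers_le`). So the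
number of ambiguous clusters is at most a constant times `γ max(1, 1/β) M / cost(P, A)`; its growth
with `M` is matched by the growth of `M ^ 2` relative to the variance `cost(P, A) M / m`. Solutions
with `M` larger than `cost P A` by a constant times `1 / η ^ 2` need no chaining
(`abs_excess_sub_le_of_large`), and the others are treated separately for each dyadic value of `M`
(`wProb_not_uniform_le`). Since `cost P A ≤ γ cost P S`, an error relative to `M` is an error
relative to `cost P S`.
-/

namespace KMeans

/-! ### Finite probability spaces -/

/-- The total weight of an event in a finite space with weights `w`. -/
noncomputable def wProb {α : Type*} [Fintype α] (w : α → ℝ) (s : Set α) : ℝ :=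
  ∑ x, w x * s.indicator 1 x

/-- The product weight on sequences of length `m`. -/
noncomputable def pw {Ω : Type*} {m : ℕ} (μ : Ω → ℝ) (q : Fin m → Ω) : ℝ :=
  ∏ i, μ (q i)

section wProb

variable {α : Type*} [Fintype α] {w : α → ℝ}

theorem wProb_mono (hw : ∀ x, 0 ≤ w x) {s t : Set α} (h : s ⊆ t) : wProb w s ≤ wProb w t :=
  Finset.sum_le_sum fun x _ => mul_le_mul_of_nonneg_left
    (Set.indicator_le_indicator_of_subset h (fun _ => zero_le_one) x) (hw x)

theorem wProb_union_le (hw : ∀ x, 0 ≤ w x) (s t : Set α) :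
    wProb w (s ∪ t) ≤ wProb w s + wProb w t := by
  unfold wProb
  rw [← Finset.sum_add_distrib]
  refine Finset.sum_le_sum fun x _ => ?_
  rw [← mul_add]
  refine mul_le_mul_of_nonneg_left ?_ (hw x)
  by_cases hs : x ∈ s <;> by_cases ht : x ∈ t <;> simp [hs, ht]

theorem wProb_iUnion_le (hw : ∀ x, 0 ≤ w x) {ι : Type*} [Fintype ι] (s : ι → Set α) :
    wProb w (⋃ i, s i) ≤ ∑ i, wProb w (s i) := by
  unfold wProb
  rw [Finset.sum_comm]
  refine Finset.sum_le_sum fun x _ => ?_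
  rw [← Finset.mul_sum]
  refine mul_le_mul_of_nonneg_left ?_ (hw x)
  have h0 : ∀ i, 0 ≤ (s i).indicator (1 : α → ℝ) x := fun i =>
    Set.indicator_nonneg (fun _ _ => zero_le_one) x
  by_cases hx : x ∈ ⋃ i, s i
  · obtain ⟨i, hi⟩ := Set.mem_iUnion.1 hx
    rw [Set.indicator_of_mem hx]
    calc (1 : α → ℝ) x = (s i).indicator 1 x := by rw [Set.indicator_of_mem hi]
      _ ≤ _ := Finset.single_le_sum (f := fun i => (s i).indicator (1 : α → ℝ) x)
        (fun i _ => h0 i) (Finset.mem_univ i)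
  · rw [Set.indicator_of_notMem hx]
    exact Finset.sum_nonneg fun i _ => h0 i

theorem wProb_compl (hw1 : ∑ x, w x = 1) (s : Set α) : wProb w sᶜ = 1 - wProb w s := by
  unfold wProb
  rw [← hw1, ← Finset.sum_sub_distrib]
  refine Finset.sum_congr rfl fun x _ => ?_
  by_cases hs : x ∈ s <;> simp [hs]

/-- Markov's inequality. -/
theorem mul_wProb_le (hw : ∀ x, 0 ≤ w x) {F : α → ℝ} (hF : ∀ x, 0 ≤ F x) (t : ℝ) :
    t * wProb w {x | t ≤ F x} ≤ ∑ x, w x * F x := by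
  unfold wProb
  rw [Finset.mul_sum]
  refine Finset.sum_le_sum fun x _ => ?_
  by_cases hx : t ≤ F x
  · rw [Set.indicator_of_mem (by exact hx)]
    have := mul_le_mul_of_nonneg_left hx (hw x)
    simp only [Pi.one_apply]
    linarith
  · rw [Set.indicator_of_notMem (by exact hx)]
    have := mul_nonneg (hw x) (hF x)
    linarith

end wProb

section pw

variable {Ω : Type*} [Fintype Ω] {μ : Ω → ℝ} {m : ℕ}

omit [Fintype Ω] in
theorem pw_nonneg (hμ : ∀ x, 0 ≤ μ x) (q : Fin m → Ω) : 0 ≤ pw μ q :=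
  Finset.prod_nonneg fun _ _ => hμ _

/-- Independence: the expectation of a product over the draws is the product of expectations. -/
theorem sum_pw_mul_prod (g : Fin m → Ω → ℝ) :
    ∑ q, pw μ q * ∏ i, g i (q i) = ∏ i, ∑ x, μ x * g i x := by
  classical
  unfold pw
  rw [Finset.prod_univ_sum, Fintype.piFinset_univ]
  exact Finset.sum_congr rfl fun q _ => Finset.prod_mul_distrib.symm

theorem sum_pw (hμ1 : ∑ x, μ x = 1) : ∑ q : Fin m → Ω, pw μ q = 1 := by
  have := sum_pw_mul_prod (μ := μ) (m := m) fun _ _ => 1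
  simpa [hμ1] using this

theorem sum_pw_mul_apply (hμ1 : ∑ x, μ x = 1) (f : Ω → ℝ) (i : Fin m) :
    ∑ q, pw μ q * f (q i) = ∑ x, μ x * f x := by
  classical
  have := sum_pw_mul_prod (μ := μ) (m := m) fun j x => if j = i then f x else 1
  rw [Finset.prod_eq_single i] at this
  · simpa [Finset.prod_ite_eq'] using this
  · intro j _ hj
    simp [hj, hμ1]
  · simp

theorem sum_pw_mul_sum (hμ1 : ∑ x, μ x = 1) (f : Ω → ℝ) :
    ∑ q : Fin m → Ω, pw μ q * ∑ i, f (q i) = m * ∑ x, μ x * f x := by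
  simp_rw [Finset.mul_sum]
  rw [Finset.sum_comm]
  simp_rw [sum_pw_mul_apply hμ1]
  simp [Finset.mul_sum]

/-- The variance of a sum of independent centered variables. -/
theorem sum_pw_mul_sq (hμ1 : ∑ x, μ x = 1) (f : Ω → ℝ) (hf : ∑ x, μ x * f x = 0) :
    ∑ q : Fin m → Ω, pw μ q * (∑ i, f (q i)) ^ 2 = m * ∑ x, μ x * f x ^ 2 := by
  classical
  have key : ∀ i j : Fin m, ∑ q : Fin m → Ω, pw μ q * (f (q i) * f (q j))
      = if i = j then ∑ x, μ x * f x ^ 2 else 0 := by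
    intro i j
    split_ifs with h
    · subst h
      rw [← sum_pw_mul_apply hμ1 (fun x => f x ^ 2) i]
      exact Finset.sum_congr rfl fun q _ => by ring
    · have := sum_pw_mul_prod (μ := μ) (m := m)
        fun l x => (if l = i then f x else 1) * (if l = j then f x else 1)
      rw [Finset.prod_eq_zero (Finset.mem_univ i)] at this
      · rw [← this]
        refine Finset.sum_congr rfl fun q _ => ?_
        rw [Finset.prod_mul_distrib]
        simp [Finset.prod_ite_eq']
      · simp [h, hf]
  simp_rw [sq (∑ i, f _), Finset.sum_mul_sum, Finset.mul_sum]
  rw [Finset.sum_comm]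
  simp_rw [Finset.sum_comm (s := (Finset.univ : Finset (Fin m → Ω))), key]
  simp [Finset.mul_sum]

/-- Chebyshev's inequality for a sum of independent draws. -/
theorem wProb_abs_sub_ge_le (hμ : ∀ x, 0 ≤ μ x) (hμ1 : ∑ x, μ x = 1) (f : Ω → ℝ) {t : ℝ}
    (ht : 0 < t) :
    wProb (pw μ) {q : Fin m → Ω | t ≤ |∑ i, f (q i) - m * ∑ x, μ x * f x|}
      ≤ m * (∑ x, μ x * f x ^ 2) / t ^ 2 := by
  set e := ∑ x, μ x * f x with he
  have h0 : ∑ x, μ x * (f x - e) = 0 := by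
    simp_rw [mul_sub]
    rw [Finset.sum_sub_distrib, ← Finset.sum_mul, hμ1, ← he]; ring
  have h1 := sum_pw_mul_sq (m := m) hμ1 (fun x => f x - e) h0
  have h2 : ∑ x, μ x * (f x - e) ^ 2 ≤ ∑ x, μ x * f x ^ 2 := by
    have : ∑ x, μ x * (f x - e) ^ 2 = ∑ x, μ x * f x ^ 2 - e ^ 2 := by
      have h : ∀ x, μ x * (f x - e) ^ 2 = μ x * f x ^ 2 - 2 * e * (μ x * f x) + e ^ 2 * μ x :=
        fun x => by ring
      simp_rw [h]
      rw [Finset.sum_add_distrib, Finset.sum_sub_distrib, ← Finset.mul_sum, ← Finset.mul_sum,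
        hμ1, ← he]
      ring
    rw [this]
    linarith [sq_nonneg e]
  have h3 := mul_wProb_le (w := pw μ) (fun q : Fin m → Ω => pw_nonneg hμ q)
    (F := fun q => (∑ i, (f (q i) - e)) ^ 2) (fun q => sq_nonneg _) (t ^ 2)
  rw [h1] at h3
  have hset : {q : Fin m → Ω | t ≤ |∑ i, f (q i) - m * e|}
      ⊆ {q | t ^ 2 ≤ (∑ i, (f (q i) - e)) ^ 2} := by
    intro q hq
    simp only [Set.mem_ofPred_eq] at hq ⊢
    rw [Finset.sum_sub_distrib]
    simp only [Finset.sum_const, Finset.card_univ, Fintype.card_fin, nsmul_eq_mul]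
    rw [← sq_abs (_ - _)]
    gcongr
  rw [le_div_iff₀ (by positivity), mul_comm]
  calc t ^ 2 * _ ≤ t ^ 2 * wProb (pw μ) {q : Fin m → Ω | t ^ 2 ≤ (∑ i, (f (q i) - e)) ^ 2} := by
        gcongr
        exact wProb_mono (fun q => pw_nonneg hμ q) hset
    _ ≤ _ := h3
    _ ≤ _ := by gcongr

theorem wProb_exp_ge_le (hμ : ∀ x, 0 ≤ μ x) (hμ1 : ∑ x, μ x = 1) {Y : Ω → ℝ}
    {b e θ : ℝ} (hY0 : ∀ x, 0 ≤ Y x) (hYb : ∀ x, Y x ≤ b) (hθ : |θ| * b ≤ 1)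
    (hmean : m * ∑ x, μ x * Y x = 1) :
    wProb (pw μ) {q : Fin m → Ω | e ≤ θ * (∑ i, Y (q i) - 1)} ≤ Real.exp (θ ^ 2 * b - e) := by
  set s := ∑ x, μ x * Y x with hs
  have h1 : ∑ x, μ x * Real.exp (θ * Y x) ≤ Real.exp (θ * s + θ ^ 2 * b * s) := by
    have h : ∀ x, μ x * Real.exp (θ * Y x) ≤ μ x + (θ + θ ^ 2 * b) * (μ x * Y x) := by
      intro x
      have ha : |θ * Y x| ≤ 1 := by
        rw [abs_mul, abs_of_nonneg (hY0 x)]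
        exact (mul_le_mul_of_nonneg_left (hYb x) (abs_nonneg _)).trans hθ
      have hb := (abs_le.1 (Real.abs_exp_sub_one_sub_id_le ha)).2
      have hc : (θ * Y x) ^ 2 ≤ θ ^ 2 * b * Y x := by
        have := mul_le_mul_of_nonneg_left (hYb x) (mul_nonneg (sq_nonneg θ) (hY0 x))
        nlinarith
      have hd : Real.exp (θ * Y x) ≤ 1 + (θ + θ ^ 2 * b) * Y x := by linarith
      have := mul_le_mul_of_nonneg_left hd (hμ x)
      linarith
    calc _ ≤ ∑ x, (μ x + (θ + θ ^ 2 * b) * (μ x * Y x)) := Finset.sum_le_sum fun x _ => h x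
      _ = (θ * s + θ ^ 2 * b * s) + 1 := by
        rw [Finset.sum_add_distrib, ← Finset.mul_sum, hμ1, ← hs]; ring
      _ ≤ _ := Real.add_one_le_exp _
  have h2 := sum_pw_mul_prod (μ := μ) (m := m) fun _ x => Real.exp (θ * Y x)
  simp only [Finset.prod_const, Finset.card_univ, Fintype.card_fin, ← Real.exp_sum,
    ← Finset.mul_sum] at h2
  have h3 : ∑ q : Fin m → Ω, pw μ q * Real.exp (θ * ∑ i, Y (q i))
      ≤ Real.exp (θ + θ ^ 2 * b) := by
    rw [h2]
    calc _ ≤ Real.exp (θ * s + θ ^ 2 * b * s) ^ m := by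
          gcongr
          exact Finset.sum_nonneg fun x _ => mul_nonneg (hμ x) (Real.exp_pos _).le
      _ = Real.exp ((θ + θ ^ 2 * b) * (m * s)) := by
          rw [← Real.exp_nat_mul]; congr 1; ring
      _ = _ := by rw [hmean, mul_one]
  have h4 := mul_wProb_le (w := pw μ) (fun q : Fin m → Ω => pw_nonneg hμ q)
    (F := fun q => Real.exp (θ * ∑ i, Y (q i))) (fun q => (Real.exp_pos _).le) (Real.exp (θ + e))
  have hset : {q : Fin m → Ω | e ≤ θ * (∑ i, Y (q i) - 1)}
      ⊆ {q | Real.exp (θ + e) ≤ Real.exp (θ * ∑ i, Y (q i))} := by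
    intro q hq
    simp only [Set.mem_ofPred_eq] at hq ⊢
    rw [Real.exp_le_exp]
    linarith
  have h5 := wProb_mono (w := pw μ) (fun q : Fin m → Ω => pw_nonneg hμ q) hset
  refine h5.trans ?_
  have : θ ^ 2 * b - e = (θ + θ ^ 2 * b) - (θ + e) := by ring
  rw [this, Real.exp_sub, le_div_iff₀ (Real.exp_pos _), mul_comm]
  exact h4.trans h3

/-- Chernoff bound for sums of independent draws of a bounded nonnegative variable, normalized
to have expectation `1`. -/
theorem wProb_abs_sub_one_ge_le (hμ : ∀ x, 0 ≤ μ x) (hμ1 : ∑ x, μ x = 1) {Y : Ω → ℝ}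
    {b e : ℝ} (hb : 0 < b) (he : 0 < e) (he2 : e ≤ 2) (hY0 : ∀ x, 0 ≤ Y x) (hYb : ∀ x, Y x ≤ b)
    (hmean : m * ∑ x, μ x * Y x = 1) :
    wProb (pw μ) {q : Fin m → Ω | e ≤ |∑ i, Y (q i) - 1|} ≤ 2 * Real.exp (-(e ^ 2 / (4 * b))) := by
  have hθ : |e / (2 * b)| * b ≤ 1 := by
    rw [abs_of_pos (by positivity)]
    field_simp
    linarith
  have hθ' : |-(e / (2 * b))| * b ≤ 1 := by rwa [abs_neg]
  have h1 := wProb_exp_ge_le (m := m) (e := e ^ 2 / (2 * b)) hμ hμ1 hY0 hYb hθ hmean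
  have h2 := wProb_exp_ge_le (m := m) (e := e ^ 2 / (2 * b)) hμ hμ1 hY0 hYb hθ' hmean
  have e1 : (e / (2 * b)) ^ 2 * b - e ^ 2 / (2 * b) = -(e ^ 2 / (4 * b)) := by
    field_simp; ring
  have e2 : (-(e / (2 * b))) ^ 2 * b - e ^ 2 / (2 * b) = -(e ^ 2 / (4 * b)) := by
    rw [neg_sq, e1]
  rw [e1] at h1
  rw [e2] at h2
  have hset : {q : Fin m → Ω | e ≤ |∑ i, Y (q i) - 1|}
      ⊆ {q | e ^ 2 / (2 * b) ≤ e / (2 * b) * (∑ i, Y (q i) - 1)}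
        ∪ {q | e ^ 2 / (2 * b) ≤ -(e / (2 * b)) * (∑ i, Y (q i) - 1)} := by
    intro q hq
    simp only [Set.mem_ofPred_eq, Set.mem_union] at hq ⊢
    have hp : 0 ≤ e / (2 * b) := by positivity
    have e3 : e ^ 2 / (2 * b) = e / (2 * b) * e := by ring
    rw [e3]
    rcases le_abs.1 hq with h | h
    · left; exact mul_le_mul_of_nonneg_left h hp
    · right
      have := mul_le_mul_of_nonneg_left h hp
      linarith
  have h3 := (wProb_mono (w := pw μ) (fun q : Fin m → Ω => pw_nonneg hμ q) hset).trans
    (wProb_union_le (fun q => pw_nonneg hμ q) _ _)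
  linarith

end pw

/-! ### Random signs and symmetrization -/

/-- The sign `±1` encoded by a Boolean. -/
def sgn (b : Bool) : ℝ := if b then 1 else -1

/-- Hoeffding's inequality for random signs. -/
theorem sum_sgn_gt_le {m : ℕ} (y : Fin m → ℝ) {v t : ℝ} (hv : 0 < v) (ht : 0 ≤ t)
    (hy : ∑ i, y i ^ 2 ≤ v) :
    wProb (pw fun _ : Bool => (1 / 2 : ℝ)) {σ : Fin m → Bool | t < |∑ i, sgn (σ i) * y i|}
      ≤ 2 * Real.exp (-(t ^ 2 / (2 * v))) := by
  have hpos : ∀ x : Bool, (0 : ℝ) ≤ (fun _ : Bool => (1 / 2 : ℝ)) x := fun _ => by norm_num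
  have main : ∀ θ : ℝ, wProb (pw fun _ : Bool => (1 / 2 : ℝ))
      {σ : Fin m → Bool | t ^ 2 / v ≤ θ * ∑ i, sgn (σ i) * y i}
        ≤ Real.exp (θ ^ 2 * v / 2 - t ^ 2 / v) := by
    intro θ
    have h2 := sum_pw_mul_prod (μ := fun _ : Bool => (1 / 2 : ℝ)) (m := m)
      fun i x => Real.exp (θ * (sgn x * y i))
    simp only [← Real.exp_sum, ← Finset.mul_sum] at h2
    have h3 : ∀ i : Fin m, ∑ x : Bool, Real.exp (θ * (sgn x * y i))
        = 2 * Real.cosh (θ * y i) := by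
      intro i
      rw [Fintype.sum_bool, Real.cosh_eq]
      simp [sgn]
      ring
    simp only [h3] at h2
    have h4 : ∏ i : Fin m, (1 / 2 * (2 * Real.cosh (θ * y i))) ≤ Real.exp (θ ^ 2 * v / 2) := by
      calc _ ≤ ∏ i : Fin m, Real.exp ((θ * y i) ^ 2 / 2) := by
            refine Finset.prod_le_prod (fun i _ => ?_) fun i _ => ?_
            · have := Real.cosh_pos (θ * y i); positivity
            · have := Real.cosh_le_exp_half_sq (θ * y i); linarith
        _ = Real.exp (θ ^ 2 * (∑ i, y i ^ 2) / 2) := by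
            rw [← Real.exp_sum]
            congr 1
            rw [Finset.mul_sum, Finset.sum_div]
            exact Finset.sum_congr rfl fun i _ => by ring
        _ ≤ _ := by gcongr
    rw [← h2] at h4
    have h5 := mul_wProb_le (w := pw fun _ : Bool => (1 / 2 : ℝ))
      (fun σ : Fin m → Bool => pw_nonneg hpos σ)
      (F := fun σ => Real.exp (θ * ∑ i, sgn (σ i) * y i)) (fun q => (Real.exp_pos _).le)
      (Real.exp (t ^ 2 / v))
    simp only [Real.exp_le_exp] at h5
    rw [Real.exp_sub, le_div_iff₀ (Real.exp_pos _), mul_comm]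
    exact h5.trans h4
  have h1 := main (t / v)
  have h2 := main (-(t / v))
  have e1 : (t / v) ^ 2 * v / 2 - t ^ 2 / v = -(t ^ 2 / (2 * v)) := by
    field_simp; ring
  rw [neg_sq] at h2
  rw [e1] at h1 h2
  have hset : {σ : Fin m → Bool | t < |∑ i, sgn (σ i) * y i|}
      ⊆ {σ | t ^ 2 / v ≤ t / v * ∑ i, sgn (σ i) * y i}
        ∪ {σ | t ^ 2 / v ≤ -(t / v) * ∑ i, sgn (σ i) * y i} := by
    intro q hq
    simp only [Set.mem_ofPred_eq, Set.mem_union] at hq ⊢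
    have hp : 0 ≤ t / v := by positivity
    have e3 : t ^ 2 / v = t / v * t := by ring
    rw [e3]
    rcases lt_abs.1 hq with h | h
    · left; exact mul_le_mul_of_nonneg_left h.le hp
    · right
      have := mul_le_mul_of_nonneg_left h.le hp
      linarith
  have h3 := (wProb_mono (w := pw fun _ : Bool => (1 / 2 : ℝ))
    (fun q : Fin m → Bool => pw_nonneg hpos q) hset).trans
    (wProb_union_le (fun q => pw_nonneg hpos q) _ _)
  linarith

/-- Exchanging the `i`-th entries of two sequences wherever `σ i` is false. -/
def swapEquiv {Ω : Type*} {m : ℕ} (σ : Fin m → Bool) :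
    ((Fin m → Ω) × (Fin m → Ω)) ≃ ((Fin m → Ω) × (Fin m → Ω)) :=
  Function.Involutive.toPerm
    (fun z => (fun i => if σ i then z.1 i else z.2 i, fun i => if σ i then z.2 i else z.1 i))
    (by
      intro z
      ext i <;> dsimp <;> split_ifs <;> rfl)

theorem swapEquiv_fst {Ω : Type*} {m : ℕ} (σ : Fin m → Bool) (z : (Fin m → Ω) × (Fin m → Ω))
    (i : Fin m) : (swapEquiv σ z).1 i = if σ i then z.1 i else z.2 i := rfl

theorem swapEquiv_snd {Ω : Type*} {m : ℕ} (σ : Fin m → Bool) (z : (Fin m → Ω) × (Fin m → Ω))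
    (i : Fin m) : (swapEquiv σ z).2 i = if σ i then z.2 i else z.1 i := rfl

/-- Symmetrization with a ghost sample, as a bound on probabilities: if a second sample is
accurate with probability at least one half, then a uniform deviation of one sample forces a
uniform deviation between two samples, and the difference between two samples has the same law
as its randomly signed version. The set `GG` of admissible pairs has to be stable under
exchanging entries, so that it can be conditioned upon. -/
theorem wProb_deviation_le {Ω : Type*} [Fintype Ω] {μ : Ω → ℝ} {m : ℕ} (hμ : ∀ x, 0 ≤ μ x)
    (hμ1 : ∑ x, μ x = 1) {𝒮 : Type*} (g : 𝒮 → Ω → ℝ) (e τ : 𝒮 → ℝ) (G : Set (Fin m → Ω))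
    (GG : Set ((Fin m → Ω) × (Fin m → Ω))) (hGG : ∀ σ, ∀ z ∈ GG, swapEquiv σ z ∈ GG)
    (hG : ∀ q ∈ G, ∀ q' ∈ G, (q, q') ∈ GG)
    (hhalf : ∀ S, 1 / 2 ≤ wProb (pw μ) {q : Fin m → Ω | q ∈ G ∧ |∑ i, g S (q i) - e S| ≤ τ S})
    {δ : ℝ} (hδ : 0 ≤ δ)
    (hσ : ∀ z ∈ GG, wProb (pw fun _ : Bool => (1 / 2 : ℝ)) {σ : Fin m → Bool |
      ∃ S, τ S < |∑ i, sgn (σ i) * (g S (z.1 i) - g S (z.2 i))|} ≤ δ) :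
    wProb (pw μ) {q : Fin m → Ω | q ∈ G ∧ ∃ S, 2 * τ S < |∑ i, g S (q i) - e S|} ≤ 2 * δ := by
  set Bad := {q : Fin m → Ω | q ∈ G ∧ ∃ S, 2 * τ S < |∑ i, g S (q i) - e S|} with hBad
  set W : (Fin m → Ω) × (Fin m → Ω) → ℝ := fun z => pw μ z.1 * pw μ z.2 with hW
  set Ev : Set ((Fin m → Ω) × (Fin m → Ω)) :=
    {z | z ∈ GG ∧ ∃ S, τ S < |∑ i, (g S (z.1 i) - g S (z.2 i))|} with hEv
  have hW0 : ∀ z, 0 ≤ W z := fun z => mul_nonneg (pw_nonneg hμ _) (pw_nonneg hμ _)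
  have hW1 : ∑ z, W z = 1 := by
    rw [hW, Fintype.sum_prod_type]
    simp [← Finset.mul_sum, sum_pw hμ1]
  have hhpos : ∀ x : Bool, (0 : ℝ) ≤ (fun _ : Bool => (1 / 2 : ℝ)) x := fun _ => by norm_num
  have hh1 : ∑ x : Bool, (fun _ : Bool => (1 / 2 : ℝ)) x = 1 := by simp
  -- a bad first sample and an accurate second one differ
  have hBadEv : 1 / 2 * wProb (pw μ) Bad ≤ wProb W Ev := by
    unfold wProb
    rw [Fintype.sum_prod_type, Finset.mul_sum]
    refine Finset.sum_le_sum fun q _ => ?_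
    by_cases hq : q ∈ Bad
    · obtain ⟨hqG, S, hS⟩ := hq
      have h := hhalf S
      unfold wProb at h
      rw [Set.indicator_of_mem (show q ∈ Bad from ⟨hqG, S, hS⟩)]
      calc 1 / 2 * (pw μ q * (1 : (Fin m → Ω) → ℝ) q) = pw μ q * (1 / 2) := by simp [mul_comm]
        _ ≤ pw μ q * ∑ q', pw μ q' * Set.indicator
            {q : Fin m → Ω | q ∈ G ∧ |∑ i, g S (q i) - e S| ≤ τ S} 1 q' := by
          gcongr
          exact pw_nonneg hμ q
        _ ≤ _ := by
          rw [Finset.mul_sum]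
          refine Finset.sum_le_sum fun q' _ => ?_
          rw [← mul_assoc]
          refine mul_le_mul_of_nonneg_left ?_ (hW0 (q, q'))
          by_cases hq' : q' ∈ {q : Fin m → Ω | q ∈ G ∧ |∑ i, g S (q i) - e S| ≤ τ S}
          · rw [Set.indicator_of_mem hq', Set.indicator_of_mem]
            · simp
            refine ⟨hG q hqG q' hq'.1, S, ?_⟩
            have h1 := hq'.2
            simp only [Finset.sum_sub_distrib]
            have h2 := abs_sub_abs_le_abs_sub (∑ i, g S (q i) - e S) (∑ i, g S (q' i) - e S)
            rw [sub_sub_sub_cancel_right] at h2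
            linarith
          · rw [Set.indicator_of_notMem hq']
            exact Set.indicator_nonneg (fun _ _ => zero_le_one) _
    · rw [Set.indicator_of_notMem hq, mul_zero, mul_zero]
      exact Finset.sum_nonneg fun q' _ => mul_nonneg (hW0 (q, q'))
        (Set.indicator_nonneg (fun _ _ => zero_le_one) _)
  have hinv : ∀ σ z, W (swapEquiv σ z) = W z := by
    intro σ z
    simp only [hW, pw, ← Finset.prod_mul_distrib]
    refine Finset.prod_congr rfl fun i _ => ?_
    simp only [swapEquiv_fst, swapEquiv_snd]
    split_ifs
    · rfl
    · exact mul_comm _ _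
  have hEvSwap : ∀ σ : Fin m → Bool, wProb W Ev = ∑ z, W z * Ev.indicator 1 (swapEquiv σ z) := by
    intro σ
    unfold wProb
    rw [← Equiv.sum_comp (swapEquiv σ)]
    simp_rw [hinv]
  have hEvδ : wProb W Ev ≤ δ := by
    calc wProb W Ev = ∑ σ : Fin m → Bool, pw (fun _ : Bool => (1 / 2 : ℝ)) σ * wProb W Ev := by
          rw [← Finset.sum_mul, sum_pw hh1, one_mul]
      _ = ∑ σ : Fin m → Bool, pw (fun _ : Bool => (1 / 2 : ℝ)) σ *
            ∑ z, W z * Ev.indicator 1 (swapEquiv σ z) :=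
          Finset.sum_congr rfl fun σ _ => by rw [← hEvSwap σ]
      _ = ∑ z, W z * ∑ σ : Fin m → Bool, pw (fun _ : Bool => (1 / 2 : ℝ)) σ *
            Ev.indicator 1 (swapEquiv σ z) := by
          simp_rw [Finset.mul_sum]
          rw [Finset.sum_comm]
          exact Finset.sum_congr rfl fun _ _ => Finset.sum_congr rfl fun _ _ => by ring
      _ ≤ ∑ z, W z * δ := by
          refine Finset.sum_le_sum fun z _ => mul_le_mul_of_nonneg_left ?_ (hW0 z)
          by_cases hz : z ∈ GG
          · refine le_trans (Finset.sum_le_sum fun σ _ => mul_le_mul_of_nonneg_left ?_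
              (pw_nonneg hhpos σ)) (hσ z hz)
            by_cases hs : swapEquiv σ z ∈ Ev
            · rw [Set.indicator_of_mem hs, Set.indicator_of_mem]
              · simp
              obtain ⟨_, S, hS⟩ := hs
              refine ⟨S, hS.trans_le (le_of_eq ?_)⟩
              congr 1
              refine Finset.sum_congr rfl fun i _ => ?_
              simp only [swapEquiv_fst, swapEquiv_snd, sgn]
              split_ifs <;> ring
            · rw [Set.indicator_of_notMem hs]
              exact Set.indicator_nonneg (fun _ _ => zero_le_one) _
          · refine le_trans (le_of_eq ?_) hδ
            refine Finset.sum_eq_zero fun σ _ => ?_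
            rw [Set.indicator_of_notMem, mul_zero]
            intro hs
            apply hz
            have h1 := hGG σ _ hs.1
            have h2 : swapEquiv σ (swapEquiv σ z) = z :=
              Function.Involutive.toPerm_involutive _ z
            rwa [h2] at h1
      _ = δ := by rw [← Finset.sum_mul, hW1, one_mul]
  linarith

/-! ### Chaining for random signs -/

/-- A union bound for the signed sums of at most `N` vectors `D x`. -/
theorem wProb_exists_code_le {m : ℕ} {Code : Type*} [Fintype Code] (D : Code → Fin m → ℝ)
    {v t N : ℝ} (hv : 0 < v) (ht : 0 ≤ t) (hD : ∀ x, ∑ i, D x i ^ 2 ≤ v)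
    (hN : (Fintype.card Code : ℝ) ≤ N) :
    wProb (pw fun _ : Bool => (1 / 2 : ℝ)) {σ : Fin m → Bool | ∃ x, t < |∑ i, sgn (σ i) * D x i|}
      ≤ N * (2 * Real.exp (-(t ^ 2 / (2 * v)))) := by
  have hpos : ∀ x : Bool, (0 : ℝ) ≤ (fun _ : Bool => (1 / 2 : ℝ)) x := fun _ => by norm_num
  have h1 : {σ : Fin m → Bool | ∃ x, t < |∑ i, sgn (σ i) * D x i|}
      = ⋃ x, {σ : Fin m → Bool | t < |∑ i, sgn (σ i) * D x i|} := by
    ext σ; simp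
  rw [h1]
  refine (wProb_iUnion_le (fun σ => pw_nonneg hpos σ) _).trans ?_
  refine (Finset.sum_le_sum fun x _ => sum_sgn_gt_le (D x) hv ht (hD x)).trans ?_
  rw [Finset.sum_const, Finset.card_univ, nsmul_eq_mul]
  gcongr

/-- Chaining over finitely many scales. At scale `h`, the vector `F S` is determined by a code
up to an error of `ℓ²`-size `√v / 2 ^ h` and `ℓ¹`-size `u / 2 ^ h`. When there are at most
`exp (θ 4 ^ h)` codes, the number of pairs of codes of consecutive scales grows exactly as fast
as the concentration of the corresponding differences improves, so each scale contributes the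
same deviation `t`. -/
theorem wProb_chaining_le {m : ℕ} {𝒮 : Type*} (F : 𝒮 → Fin m → ℝ) (H : ℕ)
    (Code : ℕ → Type) [∀ h, Fintype (Code h)] (sig : ∀ h, 𝒮 → Code h) {v u θ t Λ : ℝ}
    (hv : 0 < v) (ht : 0 ≤ t) (hθ : 0 ≤ θ)
    (hcard : ∀ h ≤ H, (Fintype.card (Code h) : ℝ) ≤ Real.exp (θ * 4 ^ h))
    (hF : ∀ S, ∑ i, F S i ^ 2 ≤ v)
    (hl2 : ∀ h ≤ H, ∀ S S', sig h S = sig h S' → ∑ i, (F S i - F S' i) ^ 2 ≤ v / 4 ^ h)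
    (hl1 : ∀ S S', sig H S = sig H S' → ∑ i, |F S i - F S' i| ≤ u)
    (hΛ : 2 * θ + Λ ≤ t ^ 2 / (20 * v)) (hΛ0 : 0 ≤ Λ) :
    wProb (pw fun _ : Bool => (1 / 2 : ℝ)) {σ : Fin m → Bool |
      ∃ S, (H + 1) * t + u < |∑ i, sgn (σ i) * F S i|} ≤ 2 * (H + 1) * Real.exp (-Λ) := by
  classical
  have hpos : ∀ x : Bool, (0 : ℝ) ≤ (fun _ : Bool => (1 / 2 : ℝ)) x := fun _ => by norm_num
  -- `rep h S` is a fixed representative of all solutions with the code of `S`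
  have hrep : ∀ h, ∃ r : 𝒮 → 𝒮, (∀ S, sig h (r S) = sig h S) ∧
      ∀ S S', sig h S = sig h S' → r S = r S' := by
    intro h
    refine ⟨fun S => Classical.choose (⟨S, rfl⟩ : ∃ S', sig h S' = sig h S), fun S =>
      Classical.choose_spec (⟨S, rfl⟩ : ∃ S', sig h S' = sig h S), fun S S' e => ?_⟩
    simp only [e]
  choose rep hrep1 hrep2 using hrep
  -- `B h` is the event that some link of the chain at scale `h` has a large signed sum
  let B : ℕ → Set (Fin m → Bool) := fun h =>
    match h with
    | 0 => {σ | ∃ S, t < |∑ i, sgn (σ i) * F (rep 0 S) i|}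
    | h + 1 => {σ | ∃ S, t < |∑ i, sgn (σ i) * (F (rep (h + 1) S) i - F (rep h S) i)|}
  have hB0 : wProb (pw fun _ : Bool => (1 / 2 : ℝ)) (B 0) ≤ 2 * Real.exp (-Λ) := by
    let D : Set.range (sig 0) → Fin m → ℝ := fun x => F (rep 0 x.2.choose)
    have hsub : B 0 ⊆ {σ | ∃ x, t < |∑ i, sgn (σ i) * D x i|} := by
      rintro σ ⟨S, hS⟩
      refine ⟨⟨sig 0 S, S, rfl⟩, ?_⟩
      have : rep 0 S = rep 0 (⟨S, rfl⟩ : ∃ y, sig 0 y = sig 0 S).choose :=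
        hrep2 0 _ _ (⟨S, rfl⟩ : ∃ y, sig 0 y = sig 0 S).choose_spec.symm
      simp only [D]
      rw [← this]
      exact hS
    have hc : (Fintype.card (Set.range (sig 0)) : ℝ) ≤ Real.exp θ := by
      have h1 := hcard 0 (Nat.zero_le _)
      rw [pow_zero, mul_one] at h1
      refine le_trans ?_ h1
      exact_mod_cast Fintype.card_subtype_le (fun y => y ∈ Set.range (sig 0))
    refine (wProb_mono (fun σ => pw_nonneg hpos σ) hsub).trans
      ((wProb_exists_code_le D hv ht (fun x => hF _) hc).trans ?_)
    rw [mul_left_comm, ← Real.exp_add]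
    gcongr
    have : t ^ 2 / (20 * v) ≤ t ^ 2 / (2 * v) := by
      gcongr; norm_num
    linarith
  have hBs : ∀ h < H, wProb (pw fun _ : Bool => (1 / 2 : ℝ)) (B (h + 1)) ≤ 2 * Real.exp (-Λ) := by
    intro h hh
    let sg : 𝒮 → Code (h + 1) × Code h := fun S => (sig (h + 1) S, sig h S)
    -- a link is determined by the codes at the two scales it connects
    let D : Set.range sg → Fin m → ℝ := fun x i =>
      F (rep (h + 1) x.2.choose) i - F (rep h x.2.choose) i
    have hsub : B (h + 1) ⊆ {σ | ∃ x, t < |∑ i, sgn (σ i) * D x i|} := by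
      rintro σ ⟨S, hS⟩
      refine ⟨⟨sg S, S, rfl⟩, ?_⟩
      have h0 := (⟨S, rfl⟩ : ∃ y, sg y = sg S).choose_spec
      have h1 : rep (h + 1) S = rep (h + 1) (⟨S, rfl⟩ : ∃ y, sg y = sg S).choose :=
        hrep2 (h + 1) _ _ (Prod.ext_iff.1 h0).1.symm
      have h2 : rep h S = rep h (⟨S, rfl⟩ : ∃ y, sg y = sg S).choose :=
        hrep2 h _ _ (Prod.ext_iff.1 h0).2.symm
      simp only [D]
      rw [← h1, ← h2]
      exact hS
    have hp : (0 : ℝ) < 4 ^ (h + 1) := by positivity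
    have hc : (Fintype.card (Set.range sg) : ℝ) ≤ Real.exp (2 * θ * 4 ^ (h + 1)) := by
      have h1 := hcard (h + 1) hh
      have h2 := hcard h hh.le
      have h3 : (Fintype.card (Set.range sg) : ℝ)
          ≤ Fintype.card (Code (h + 1)) * Fintype.card (Code h) := by
        have h4 := Fintype.card_subtype_le (fun y => y ∈ Set.range sg)
        rw [Fintype.card_prod] at h4
        exact_mod_cast h4
      calc _ ≤ _ := h3
        _ ≤ Real.exp (θ * 4 ^ (h + 1)) * Real.exp (θ * 4 ^ h) := by gcongr
        _ = Real.exp (θ * 4 ^ (h + 1) + θ * 4 ^ h) := (Real.exp_add _ _).symm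
        _ ≤ _ := by
          rw [Real.exp_le_exp]
          have : θ * (4 : ℝ) ^ h ≤ θ * 4 ^ (h + 1) := by gcongr <;> simp
          linarith
    have hD : ∀ x, ∑ i, D x i ^ 2 ≤ 10 * v / 4 ^ (h + 1) := by
      intro x
      set S := x.2.choose
      have h1 := hl2 (h + 1) hh (rep (h + 1) S) S (hrep1 _ _)
      have h2 := hl2 h hh.le (rep h S) S (hrep1 _ _)
      calc ∑ i, D x i ^ 2 ≤ ∑ i, (2 * (F (rep (h + 1) S) i - F S i) ^ 2
            + 2 * (F (rep h S) i - F S i) ^ 2) := by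
            refine Finset.sum_le_sum fun i _ => ?_
            change (F (rep (h + 1) S) i - F (rep h S) i) ^ 2 ≤ _
            nlinarith [sq_nonneg ((F (rep (h + 1) S) i - F S i) + (F (rep h S) i - F S i))]
        _ ≤ 2 * (v / 4 ^ (h + 1)) + 2 * (v / 4 ^ h) := by
            rw [Finset.sum_add_distrib, ← Finset.mul_sum, ← Finset.mul_sum]
            linarith
        _ = _ := by rw [pow_succ]; field_simp; ring
    refine (wProb_mono (fun σ => pw_nonneg hpos σ) hsub).trans
      ((wProb_exists_code_le D (by positivity) ht hD hc).trans ?_)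
    rw [mul_left_comm, ← Real.exp_add]
    gcongr
    have e1 : t ^ 2 / (2 * (10 * v / 4 ^ (h + 1))) = t ^ 2 / (20 * v) * 4 ^ (h + 1) := by
      field_simp; ring
    rw [e1]
    have h4 : (1 : ℝ) ≤ 4 ^ (h + 1) := one_le_pow₀ (by norm_num)
    have h5 := mul_le_mul_of_nonneg_right hΛ hp.le
    nlinarith
  have hall : {σ : Fin m → Bool | ∃ S, (H + 1) * t + u < |∑ i, sgn (σ i) * F S i|}
      ⊆ ⋃ h : Fin (H + 1), B h := by
    rintro σ ⟨S, hS⟩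
    by_contra hn
    simp only [Set.mem_iUnion, not_exists] at hn
    have b0 : |∑ i, sgn (σ i) * F (rep 0 S) i| ≤ t := by
      by_contra hc
      exact hn ⟨0, by omega⟩ ⟨S, not_le.1 hc⟩
    have bs : ∀ h < H, |∑ i, sgn (σ i) * (F (rep (h + 1) S) i - F (rep h S) i)| ≤ t := by
      intro h hh
      by_contra hc
      exact hn ⟨h + 1, by omega⟩ ⟨S, not_le.1 hc⟩
    -- add up the links from scale `0` to scale `h`
    have bi : ∀ h ≤ H, |∑ i, sgn (σ i) * F (rep h S) i| ≤ (h + 1) * t := by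
      intro h
      induction h with
      | zero => intro _; simpa using b0
      | succ h ih =>
        intro hh
        have e : ∑ i, sgn (σ i) * F (rep (h + 1) S) i
            = ∑ i, sgn (σ i) * (F (rep (h + 1) S) i - F (rep h S) i)
              + ∑ i, sgn (σ i) * F (rep h S) i := by
          rw [← Finset.sum_add_distrib]
          exact Finset.sum_congr rfl fun i _ => by ring
        rw [e]
        refine (abs_add_le _ _).trans ?_
        have h1 := bs h hh
        have h2 := ih (by omega)
        push_cast
        linarith
    -- the rest of the chain is bounded trivially, with all signs equal
    have hlast : |∑ i, sgn (σ i) * (F S i - F (rep H S) i)| ≤ u := by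
      refine (Finset.abs_sum_le_sum_abs _ _).trans (le_trans (le_of_eq ?_)
        (hl1 S (rep H S) (hrep1 _ _).symm))
      refine Finset.sum_congr rfl fun i _ => ?_
      rw [abs_mul]
      unfold sgn
      split_ifs <;> simp
    have e : ∑ i, sgn (σ i) * F S i
        = ∑ i, sgn (σ i) * (F S i - F (rep H S) i) + ∑ i, sgn (σ i) * F (rep H S) i := by
      rw [← Finset.sum_add_distrib]
      exact Finset.sum_congr rfl fun i _ => by ring
    rw [e] at hS
    have h1 := abs_add_le (∑ i, sgn (σ i) * (F S i - F (rep H S) i))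
      (∑ i, sgn (σ i) * F (rep H S) i)
    have h2 := bi H le_rfl
    linarith
  refine (wProb_mono (fun σ => pw_nonneg hpos σ) hall).trans
    ((wProb_iUnion_le (fun σ => pw_nonneg hpos σ) _).trans ?_)
  calc ∑ h : Fin (H + 1), wProb (pw fun _ : Bool => (1 / 2 : ℝ)) (B h)
      ≤ ∑ _h : Fin (H + 1), 2 * Real.exp (-Λ) := by
        refine Finset.sum_le_sum fun h _ => ?_
        obtain ⟨h, hh⟩ := h
        cases h with
        | zero => exact hB0
        | succ h => exact hBs h (by omega)
    _ = _ := by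
      rw [Finset.sum_const, Finset.card_univ, Fintype.card_fin, nsmul_eq_mul]
      push_cast
      ring

/-! ### Sparse sign codes for vectors -/

section SignCode

variable {E : Type*} [NormedAddCommGroup E] [InnerProductSpace ℝ E]

/-- The vector encoded by a list of signed indices: `η` times the sum of the signed members
of the family `x`; `none` stands for no vector at all. -/
noncomputable def codeVec {I : Type*} (x : I → E) (η : ℝ) {n : ℕ}
    (c : Fin n → Option (I × Bool)) : E :=
  ∑ t, (c t).elim 0 fun p => (η * sgn p.2) • x p.1

theorem codeVec_snoc {I : Type*} (x : I → E) (η : ℝ) {n : ℕ}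
    (c : Fin n → Option (I × Bool)) (y : Option (I × Bool)) :
    codeVec x η (Fin.snoc c y : Fin (n + 1) → Option (I × Bool))
      = codeVec x η c + y.elim 0 fun p => (η * sgn p.2) • x p.1 := by
  simp [codeVec, Fin.sum_univ_castSucc]

/-- A vector of the unit ball is known up to `η` in the directions `x i` from a code of length
`1 / η ^ 2`: as long as the error in some direction exceeds `η`, adding `± η x i` to the encoded
vector decreases the squared distance by at least `η ^ 2`. -/
theorem exists_code_unit {I : Type*} (x : I → E) (hx : ∀ i, ‖x i‖ ≤ 1) {η : ℝ}
    (hη : 0 < η) {n : ℕ} (hn : 1 ≤ n * η ^ 2) {u : E} (hu : ‖u‖ ≤ 1) :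
    ∃ c : Fin n → Option (I × Bool), ∀ i, |inner ℝ (x i) (u - codeVec x η c)| ≤ η := by
  have key : ∀ N : ℕ, ∃ c : Fin N → Option (I × Bool),
      (∀ i, |inner ℝ (x i) (u - codeVec x η c)| ≤ η) ∨
        ‖u - codeVec x η c‖ ^ 2 ≤ 1 - N * η ^ 2 := by
    intro N
    induction N with
    | zero =>
      refine ⟨fun _ => none, Or.inr ?_⟩
      have : ‖u‖ ^ 2 ≤ 1 := pow_le_one₀ (norm_nonneg _) hu
      simpa [codeVec] using this
    | succ N ih =>
      obtain ⟨c, hc⟩ := ih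
      by_cases h : ∀ i, |inner ℝ (x i) (u - codeVec x η c)| ≤ η
      · refine ⟨Fin.snoc c none, Or.inl ?_⟩
        rw [codeVec_snoc]
        simpa using h
      · have hc := hc.resolve_left h
        push Not at h
        obtain ⟨i, hi⟩ := h
        set r := u - codeVec x η c with hr
        have main : ∀ b : Bool, η < sgn b * inner ℝ (x i) r →
            ‖u - codeVec x η (Fin.snoc c (some (i, b)) : Fin (N + 1) → Option (I × Bool))‖ ^ 2
              ≤ 1 - (N + 1 : ℕ) * η ^ 2 := by
          intro b hb
          rw [codeVec_snoc, ← sub_sub, ← hr]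
          simp only [Option.elim_some]
          rw [norm_sub_sq_real, real_inner_smul_right, norm_smul, mul_pow, real_inner_comm]
          have h1 : ‖η * sgn b‖ ^ 2 = η ^ 2 := by
            rw [Real.norm_eq_abs, sq_abs]
            cases b <;> simp [sgn]
          have h2 : ‖x i‖ ^ 2 ≤ 1 := pow_le_one₀ (norm_nonneg _) (hx i)
          rw [h1]
          push_cast
          have h3 := mul_lt_mul_of_pos_left hb hη
          have h4 := mul_le_mul_of_nonneg_left h2 (sq_nonneg η)
          nlinarith
        rcases lt_abs.1 hi with h | h
        · exact ⟨_, Or.inr (main true (by simpa [sgn] using h))⟩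
        · exact ⟨_, Or.inr (main false (by simpa [sgn] using h))⟩
  obtain ⟨c, hc | hc⟩ := key n
  · exact ⟨c, hc⟩
  · refine ⟨c, fun i => ?_⟩
    have h0 : ‖u - codeVec x η c‖ ^ 2 ≤ 0 := hc.trans (by linarith)
    have h1 : u - codeVec x η c = 0 := by
      rw [← norm_eq_zero]
      exact pow_eq_zero_iff (two_ne_zero) |>.1 (le_antisymm h0 (sq_nonneg _))
    rw [h1, inner_zero_right, abs_zero]
    exact hη.le

/-- The same for a vector of length at most `R`, with error relative to `R`. -/
theorem exists_code {I : Type*} (x : I → E) (hx : ∀ i, ‖x i‖ ≤ 1) {η : ℝ}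
    (hη : 0 < η) {n : ℕ} (hn : 1 ≤ n * η ^ 2) {u : E} {R : ℝ} (hu : ‖u‖ ≤ R) :
    ∃ c : Fin n → Option (I × Bool),
      ∀ i, |inner ℝ (x i) u - R * inner ℝ (x i) (codeVec x η c)| ≤ η * R := by
  rcases (norm_nonneg u |>.trans hu).eq_or_lt with h | h
  · have : u = 0 := norm_eq_zero.1 (le_antisymm (by rwa [← h] at hu) (norm_nonneg _))
    exact ⟨fun _ => none, fun i => by simp [this, ← h]⟩
  · have hu' : ‖R⁻¹ • u‖ ≤ 1 := by
      rw [norm_smul, norm_inv, Real.norm_of_nonneg h.le, inv_mul_le_iff₀ h, mul_one]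
      exact hu
    obtain ⟨c, hc⟩ := exists_code_unit x hx hη hn hu'
    refine ⟨c, fun i => ?_⟩
    have h1 := mul_le_mul_of_nonneg_left (hc i) h.le
    have h2 : inner ℝ (x i) u - R * inner ℝ (x i) (codeVec x η c)
        = R * inner ℝ (x i) (R⁻¹ • u - codeVec x η c) := by
      rw [inner_sub_right, real_inner_smul_right]
      field_simp
    rw [h2, abs_mul, abs_of_pos h]
    linarith

/-- The code of a single center: the index of a nearest reference point, a length scale, a sign
code for the direction from the reference point, and a rounded squared length. -/
abbrev CenterCode (J I K : Type) (n : ℕ) : Type :=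
  J × Option K × (Fin n → Option ((I ⊕ J) × Bool)) × Fin (n + 1)

theorem abs_inner_le_of_unit {y v : E} {c : ℝ} (h : |inner ℝ (‖y‖⁻¹ • y) v| ≤ c) :
    |inner ℝ y v| ≤ c * ‖y‖ := by
  rcases eq_or_ne y 0 with rfl | hy
  · simp
  · have hp : 0 < ‖y‖ := norm_pos_iff.2 hy
    rw [real_inner_smul_left, abs_mul, abs_inv, abs_norm, inv_mul_le_iff₀ hp] at h
    linarith

/-- Centers can be encoded such that two centers with the same code, one of which lies within a
length `lam κ` of a reference point `a j`, have nearly the same squared distance to `a j` and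
nearly the same inner products with the vectors `x q`. -/
theorem exists_centerCode {J I K : Type} [Finite J] [Nonempty J] [Finite K] (a : J → E)
    (x : I → E) (lam : K → ℝ) {η : ℝ} (hη : 0 < η) (hη1 : η ≤ 1) {n : ℕ}
    (hn : 1 ≤ n * η ^ 2) :
    ∃ cc : E → CenterCode J I K n, ∀ s s', cc s = cc s' → ∀ κ j, ‖s - a j‖ ≤ lam κ →
      |‖s - a j‖ ^ 2 - ‖s' - a j‖ ^ 2| ≤ 9 * η * lam κ ^ 2 ∧
        ∀ q, |inner ℝ (x q) (s - s')| ≤ 2 * η * ‖x q‖ * lam κ := by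
  classical
  -- inner products with `a j0 - a j` are coded as well: they relate the distances from `s` to
  -- `a j0` and to the other reference points `a j`
  let fam : J → I ⊕ J → E := fun j0 =>
    Sum.elim (fun q => ‖x q‖⁻¹ • x q) fun j => ‖a j0 - a j‖⁻¹ • (a j0 - a j)
  have unit_le : ∀ y : E, ‖‖y‖⁻¹ • y‖ ≤ 1 := by
    intro y
    rw [norm_smul, norm_inv, norm_norm]
    exact inv_mul_le_one
  have hfam : ∀ j0 i, ‖fam j0 i‖ ≤ 1 := by
    rintro j0 (q | j) <;> exact unit_le _
  -- the length scale is the least one that reaches from the nearest reference point to `s`; there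
  -- may be none, but then nothing is claimed about `s`
  have spec : ∀ s : E, ∃ z : CenterCode J I K n, (∀ j, ‖s - a z.1‖ ≤ ‖s - a j‖) ∧
      (z.2.1 = none → ∀ κ, lam κ < ‖s - a z.1‖) ∧
      ∀ κ0, z.2.1 = some κ0 → ‖s - a z.1‖ ≤ lam κ0 ∧
        (∀ κ, ‖s - a z.1‖ ≤ lam κ → lam κ0 ≤ lam κ) ∧
        (∀ i, |inner ℝ (fam z.1 i) (s - a z.1)
          - lam κ0 * inner ℝ (fam z.1 i) (codeVec (fam z.1) η z.2.2.1)| ≤ η * lam κ0) ∧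
        (z.2.2.2 : ℕ) = ⌊‖s - a z.1‖ ^ 2 / (η * lam κ0 ^ 2)⌋₊ := by
    intro s
    obtain ⟨j0, hj0⟩ := Finite.exists_min fun j => ‖s - a j‖
    by_cases hex : ∃ κ, ‖s - a j0‖ ≤ lam κ
    · have : Nonempty {κ // ‖s - a j0‖ ≤ lam κ} := ⟨⟨_, hex.choose_spec⟩⟩
      obtain ⟨⟨κ0, h0⟩, hmin⟩ := Finite.exists_min fun κ : {κ // ‖s - a j0‖ ≤ lam κ} => lam κ
      obtain ⟨c, hc⟩ := exists_code (fam j0) (hfam j0) hη hn h0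
      have hfl : ⌊‖s - a j0‖ ^ 2 / (η * lam κ0 ^ 2)⌋₊ < n + 1 := by
        rw [Nat.lt_succ_iff]
        refine Nat.floor_le_of_le ?_
        have hlam : 0 ≤ lam κ0 := (norm_nonneg _).trans h0
        rcases hlam.eq_or_lt with h | h
        · simp [← h]
        · rw [div_le_iff₀ (by positivity)]
          have h1 : ‖s - a j0‖ ^ 2 ≤ lam κ0 ^ 2 := by gcongr
          have h2 : 1 ≤ n * η := by
            have : (n : ℝ) * η ^ 2 ≤ n * η := by
              gcongr
              nlinarith
            linarith
          have h3 := mul_le_mul_of_nonneg_right h2 (sq_nonneg (lam κ0))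
          linarith
      refine ⟨(j0, some κ0, c, ⟨_, hfl⟩), hj0, by simp, ?_⟩
      rintro κ rfl'
      obtain rfl : κ0 = κ := by simpa using rfl'
      exact ⟨h0, fun κ hκ => hmin ⟨κ, hκ⟩, hc, rfl⟩
    · push Not at hex
      exact ⟨(j0, none, fun _ => none, 0), hj0, fun _ => hex, by simp⟩
  choose cc hcc using spec
  refine ⟨cc, fun s s' e κ j hκ => ?_⟩
  obtain ⟨hs1, hs2, hs3⟩ := hcc s
  obtain ⟨-, -, hs3'⟩ := hcc s'
  rw [← e] at hs3'
  set z := cc s with hz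
  have hne : z.2.1 ≠ none := fun h => absurd ((hs1 j).trans hκ) (not_le.2 (hs2 h κ))
  obtain ⟨κ0, hκ0⟩ := Option.ne_none_iff_exists'.1 hne
  obtain ⟨h1, hmin, hin, hfl⟩ := hs3 κ0 hκ0
  obtain ⟨h1', -, hin', hfl'⟩ := hs3' κ0 hκ0
  have hle : lam κ0 ≤ lam κ := hmin κ ((hs1 j).trans hκ)
  have hl0 : 0 ≤ lam κ0 := (norm_nonneg _).trans h1
  have hl1 : 0 ≤ lam κ := hl0.trans hle
  have hdir : ∀ i, |inner ℝ (fam z.1 i) (s - s')| ≤ 2 * η * lam κ0 := by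
    intro i
    have a1 := abs_le.1 (hin i)
    have a2 := abs_le.1 (hin' i)
    have a3 : inner ℝ (fam z.1 i) (s - s')
        = inner ℝ (fam z.1 i) (s - a z.1) - inner ℝ (fam z.1 i) (s' - a z.1) := by
      rw [← inner_sub_right, sub_sub_sub_cancel_right]
    rw [a3, abs_le]
    constructor <;> linarith [a1.1, a1.2, a2.1, a2.2]
  have hsq : |‖s - a z.1‖ ^ 2 - ‖s' - a z.1‖ ^ 2| ≤ η * lam κ0 ^ 2 := by
    rcases hl0.eq_or_lt with h | h
    · rw [← h] at h1 h1'
      have b1 : ‖s - a z.1‖ = 0 := le_antisymm h1 (norm_nonneg _)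
      have b2 : ‖s' - a z.1‖ = 0 := le_antisymm h1' (norm_nonneg _)
      simp [b1, b2, ← h]
    · have hp : 0 < η * lam κ0 ^ 2 := by positivity
      have c1 := Nat.floor_le (show 0 ≤ ‖s - a z.1‖ ^ 2 / (η * lam κ0 ^ 2) by positivity)
      have c2 := Nat.lt_floor_add_one (‖s - a z.1‖ ^ 2 / (η * lam κ0 ^ 2))
      have c3 := Nat.floor_le (show 0 ≤ ‖s' - a z.1‖ ^ 2 / (η * lam κ0 ^ 2) by positivity)
      have c4 := Nat.lt_floor_add_one (‖s' - a z.1‖ ^ 2 / (η * lam κ0 ^ 2))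
      rw [← hfl, le_div_iff₀ hp] at c1
      rw [← hfl, div_lt_iff₀ hp] at c2
      rw [← hfl', le_div_iff₀ hp] at c3
      rw [← hfl', div_lt_iff₀ hp] at c4
      rw [abs_le]
      constructor <;> linarith
  refine ⟨?_, fun q => ?_⟩
  · have d1 : |inner ℝ (a z.1 - a j) (s - s')| ≤ 2 * η * lam κ0 * ‖a z.1 - a j‖ :=
      abs_inner_le_of_unit (hdir (Sum.inr j))
    have d2 : ‖a z.1 - a j‖ ≤ 2 * lam κ := by
      have : a z.1 - a j = (s - a j) - (s - a z.1) := by abel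
      rw [this]
      refine (norm_sub_le _ _).trans ?_
      linarith
    have d3 : |inner ℝ (a z.1 - a j) (s - s')| ≤ 4 * η * lam κ ^ 2 := by
      refine d1.trans ?_
      calc 2 * η * lam κ0 * ‖a z.1 - a j‖ ≤ 2 * η * lam κ * (2 * lam κ) := by gcongr
        _ = _ := by ring
    have d4 : η * lam κ0 ^ 2 ≤ η * lam κ ^ 2 := by gcongr
    have d5 : ∀ y : E, ‖y - a j‖ ^ 2 = ‖y - a z.1‖ ^ 2
        + 2 * inner ℝ (a z.1 - a j) (y - a z.1) + ‖a z.1 - a j‖ ^ 2 := by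
      intro y
      have : y - a j = (y - a z.1) + (a z.1 - a j) := by abel
      rw [this, norm_add_sq_real, real_inner_comm]
    have d6 : inner ℝ (a z.1 - a j) (s - a z.1) - inner ℝ (a z.1 - a j) (s' - a z.1)
        = inner ℝ (a z.1 - a j) (s - s') := by
      rw [← inner_sub_right, sub_sub_sub_cancel_right]
    rw [d5 s, d5 s']
    have e1 := abs_le.1 hsq
    have e2 := abs_le.1 d3
    rw [abs_le]
    constructor <;> linarith [e1.1, e1.2, e2.1, e2.2]
  · have d1 : |inner ℝ (x q) (s - s')| ≤ 2 * η * lam κ0 * ‖x q‖ :=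
      abs_inner_le_of_unit (hdir (Sum.inl q))
    refine d1.trans ?_
    calc 2 * η * lam κ0 * ‖x q‖ ≤ 2 * η * lam κ * ‖x q‖ := by gcongr
      _ = _ := by ring

end SignCode

/-! ### Nearest centers -/

section Near

variable {d k : ℕ} [Nonempty (Fin k)]

/-- The index of a center nearest to `p`. -/
noncomputable def near (S : Fin k → Pt d) (p : Pt d) : Fin k :=
  (Finite.exists_min fun i => ‖p - S i‖).choose

theorem norm_sub_near_le (S : Fin k → Pt d) (p : Pt d) (i : Fin k) :
    ‖p - S (near S p)‖ ≤ ‖p - S i‖ :=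
  (Finite.exists_min fun i => ‖p - S i‖).choose_spec i

/-- The distance of a point to the nearest center. -/
noncomputable def ctrDist (S : Fin k → Pt d) (p : Pt d) : ℝ := ‖p - S (near S p)‖

theorem ctrDist_nonneg (S : Fin k → Pt d) (p : Pt d) : 0 ≤ ctrDist S p := norm_nonneg _

theorem ctrDist_le (S : Fin k → Pt d) (p : Pt d) (i : Fin k) : ctrDist S p ≤ ‖p - S i‖ :=
  norm_sub_near_le S p i

omit [Nonempty (Fin k)] in
theorem ptCost_le (p : Pt d) (S : Fin k → Pt d) (i : Fin k) : ptCost p S ≤ ‖p - S i‖ ^ 2 :=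
  ciInf_le ⟨0, by rintro _ ⟨i, rfl⟩; exact sq_nonneg _⟩ i

theorem ptCost_eq (p : Pt d) (S : Fin k → Pt d) : ptCost p S = ctrDist S p ^ 2 :=
  le_antisymm (ptCost_le p S _) (le_ciInf fun i =>
    pow_le_pow_left₀ (norm_nonneg _) (norm_sub_near_le S p i) 2)

/-- The distance to the nearest center is `1`-Lipschitz. -/
theorem ctrDist_le_add (S : Fin k → Pt d) (p q : Pt d) :
    ctrDist S p ≤ ‖p - q‖ + ctrDist S q := by
  refine (ctrDist_le S p (near S q)).trans ?_
  have : p - S (near S q) = (p - q) + (q - S (near S q)) := by abel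
  rw [this]
  exact norm_add_le _ _

theorem norm_near_sub_le (S : Fin k → Pt d) (q a : Pt d) :
    ‖S (near S q) - a‖ ≤ 2 * ‖q - a‖ + ctrDist S a := by
  have h1 : S (near S q) - a = (q - a) - (q - S (near S q)) := by abel
  rw [h1]
  refine (norm_sub_le _ _).trans ?_
  have := ctrDist_le_add S q a
  unfold ctrDist at this
  unfold ctrDist
  linarith

theorem norm_near_self_sub (S : Fin k → Pt d) (a : Pt d) :
    ‖S (near S a) - a‖ = ctrDist S a := norm_sub_rev _ _

omit [Nonempty (Fin k)] in
theorem norm_sub_sq_expand (q a s : Pt d) :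
    ‖q - s‖ ^ 2 = ‖q - a‖ ^ 2 - 2 * inner ℝ (q - a) (s - a) + ‖s - a‖ ^ 2 := by
  have : q - s = (q - a) - (s - a) := by abel
  rw [this, norm_sub_sq_real]

/-- The excess of the cost of a point over the cost of its reference center `a` is small. -/
theorem abs_ptCost_sub_le (S : Fin k → Pt d) (q a : Pt d) :
    |ptCost q S - ptCost a S| ≤ ‖q - a‖ ^ 2 + 2 * ‖q - a‖ * ctrDist S a := by
  have h1 := ctrDist_le_add S q a
  have h2 := ctrDist_le_add S a q
  rw [norm_sub_rev a q] at h2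
  have h3 := ctrDist_nonneg S a
  have h4 := ctrDist_nonneg S q
  have h5 := norm_nonneg (q - a)
  rw [ptCost_eq, ptCost_eq, abs_le]
  constructor
  · rcases le_total (ctrDist S a) (‖q - a‖) with h | h <;> nlinarith
  · nlinarith

/-! ### Solutions with the same code have nearly the same cost function -/

/-- Closeness of a solution `S'` to `S` as seen from a reference center `a` with length unit `b`
and one of its points `q`: every center of `S` within distance `4‖q - a‖`, or within distance
`2 U b`, of `a` has a counterpart with nearly the same distance to `a` and nearly the same inner
product with `q - a`. -/
structure ScaleClose (η b U : ℝ) (q a : Pt d) (S S' : Fin k → Pt d) : Prop where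
  far : ∀ i, ‖S i - a‖ ≤ 4 * ‖q - a‖ →
    |‖S i - a‖ ^ 2 - ‖S' i - a‖ ^ 2| ≤ 9 * η * (4 * ‖q - a‖) ^ 2 ∧
      |inner ℝ (q - a) (S i - S' i)| ≤ 2 * η * ‖q - a‖ * (4 * ‖q - a‖)
  mid : ∀ i, ‖S i - a‖ ≤ 2 * U * b →
    |‖S i - a‖ ^ 2 - ‖S' i - a‖ ^ 2| ≤ 9 * η * (b + 2 * ‖S i - a‖) ^ 2 ∧
      |inner ℝ (q - a) (S i - S' i)| ≤ 2 * η * ‖q - a‖ * (b + 2 * ‖S i - a‖)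
  dist : ctrDist S a ≤ U * b

variable {η b U : ℝ} {q a : Pt d} {S S' : Fin k → Pt d}

theorem ptCost_le_of_near {B₁ B₂ : ℝ}
    (h1 : |‖S (near S q) - a‖ ^ 2 - ‖S' (near S q) - a‖ ^ 2| ≤ B₁)
    (h2 : |inner ℝ (q - a) (S (near S q) - S' (near S q))| ≤ B₂) :
    ptCost q S' ≤ ptCost q S + B₁ + 2 * B₂ := by
  have h3 := ptCost_le q S' (near S q)
  rw [norm_sub_sq_expand q a] at h3
  rw [ptCost_eq q S, ctrDist, norm_sub_sq_expand q a]
  have h4 : inner ℝ (q - a) (S (near S q) - S' (near S q))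
      = inner ℝ (q - a) (S (near S q) - a) - inner ℝ (q - a) (S' (near S q) - a) := by
    rw [← inner_sub_right, sub_sub_sub_cancel_right]
  rw [h4] at h2
  linarith [(abs_le.1 h1).1, (abs_le.1 h2).2]

theorem ScaleClose.ptCost_ref_le (hb : 0 ≤ b) (hU : 0 ≤ U) (h : ScaleClose η b U q a S S') :
    ptCost a S' ≤ ptCost a S + 9 * η * (b + 2 * ctrDist S a) ^ 2 := by
  have h1 : ‖S (near S a) - a‖ ≤ 2 * U * b := by
    rw [norm_near_self_sub]
    have := h.dist
    have := mul_nonneg hU hb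
    linarith
  have h2 := (h.mid _ h1).1
  rw [norm_near_self_sub] at h2
  have h3 := ptCost_le a S' (near S a)
  rw [norm_sub_rev] at h3
  rw [ptCost_eq a S]
  linarith [(abs_le.1 h2).1]

theorem ScaleClose.ctrDist_le (hη1 : η ≤ 1) (hb : 0 ≤ b) (hU : 0 ≤ U)
    (h : ScaleClose η b U q a S S') : ctrDist S' a ≤ 7 * ctrDist S a + 3 * b := by
  have h1 := h.ptCost_ref_le hb hU
  rw [ptCost_eq, ptCost_eq] at h1
  have h0 := ctrDist_nonneg S a
  have h2 : η * (b + 2 * ctrDist S a) ^ 2 ≤ 1 * (b + 2 * ctrDist S a) ^ 2 := by gcongr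
  refine abs_le_of_sq_le_sq' ?_ (by positivity) |>.2
  nlinarith [mul_nonneg h0 hb]

theorem ScaleClose.ptCost_le_coarse (hη : 0 ≤ η) (hb : 0 ≤ b)
    (h : ScaleClose η b U q a S S') :
    ptCost q S' ≤ ptCost q S + 13 * η * (8 * ‖q - a‖ + 2 * ctrDist S a + b) ^ 2 := by
  have h0 := ctrDist_nonneg S a
  have h1 := norm_near_sub_le S q a
  have hr := norm_nonneg (q - a)
  set B := 8 * ‖q - a‖ + 2 * ctrDist S a + b with hB
  have key : ∀ l, 0 ≤ l → l ≤ B →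
      (|‖S (near S q) - a‖ ^ 2 - ‖S' (near S q) - a‖ ^ 2| ≤ 9 * η * l ^ 2 ∧
        |inner ℝ (q - a) (S (near S q) - S' (near S q))| ≤ 2 * η * ‖q - a‖ * l) →
      ptCost q S' ≤ ptCost q S + 13 * η * B ^ 2 := by
    intro l hl hlB ⟨h2, h3⟩
    have h4 := ptCost_le_of_near h2 h3
    have h5 : 9 * η * l ^ 2 ≤ 9 * η * B ^ 2 := by gcongr
    have h6 : 2 * η * ‖q - a‖ * l ≤ 2 * η * B * B := by
      gcongr
      linarith
    linarith
  by_cases hc : ‖S (near S q) - a‖ ≤ 4 * ‖q - a‖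
  · exact key _ (by positivity) (by linarith) (h.far _ hc)
  · have h2 : ‖S (near S q) - a‖ ≤ 2 * U * b := by
      have := h.dist
      push Not at hc
      linarith
    exact key _ (by positivity) (by linarith) (h.mid _ h2)

theorem ScaleClose.abs_sub_le_of_le (hη : 0 ≤ η) (hη1 : η ≤ 1) (hb : 0 ≤ b) (hU : 0 ≤ U)
    (h : ScaleClose η b U q a S S') (h' : ScaleClose η b U q a S' S)
    (hD : ctrDist S a ≤ 4 * ‖q - a‖) :
    |(ptCost q S - ptCost a S) - (ptCost q S' - ptCost a S')|
      ≤ 2 ^ 18 * η * (‖q - a‖ ^ 2 + b ^ 2) := by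
  have hD' := h.ctrDist_le hη1 hb hU
  have h0 := ctrDist_nonneg S a
  have h0' := ctrDist_nonneg S' a
  have hr := norm_nonneg (q - a)
  set B := 64 * ‖q - a‖ + 7 * b with hB
  have c1 : 13 * η * (8 * ‖q - a‖ + 2 * ctrDist S a + b) ^ 2 ≤ 13 * η * B ^ 2 := by
    gcongr; linarith
  have c2 : 13 * η * (8 * ‖q - a‖ + 2 * ctrDist S' a + b) ^ 2 ≤ 13 * η * B ^ 2 := by
    gcongr; linarith
  have c3 : 9 * η * (b + 2 * ctrDist S a) ^ 2 ≤ 9 * η * B ^ 2 := by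
    gcongr; linarith
  have c4 : 9 * η * (b + 2 * ctrDist S' a) ^ 2 ≤ 9 * η * B ^ 2 := by
    gcongr; linarith
  have d1 := h.ptCost_le_coarse hη hb
  have d2 := h'.ptCost_le_coarse hη hb
  have d3 := h.ptCost_ref_le hb hU
  have d4 := h'.ptCost_ref_le hb hU
  have hB2 : B ^ 2 ≤ 2 * 64 ^ 2 * (‖q - a‖ ^ 2 + b ^ 2) := by
    nlinarith [sq_nonneg (64 * ‖q - a‖ - 7 * b), sq_nonneg b]
  have hB3 := mul_le_mul_of_nonneg_left hB2 hη
  have hpos : 0 ≤ η * (‖q - a‖ ^ 2 + b ^ 2) := by positivity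
  rw [abs_le]
  constructor <;> nlinarith

theorem ScaleClose.ptCost_le_recorded (hη : 0 ≤ η)
    (h : ScaleClose η b U q a S S')
    (hrec : ∀ i, ‖S i - a‖ ≤ 2 * U * b → |‖S i - a‖ ^ 2 - ‖S' i - a‖ ^ 2| ≤ η * b ^ 2)
    (hq : 2 * ‖q - a‖ ≤ ctrDist S a) :
    ptCost q S' ≤ ptCost q S + η * b ^ 2 + 4 * η * ‖q - a‖ * (b + 4 * ctrDist S a) := by
  have h1 := norm_near_sub_le S q a
  have h2 : ‖S (near S q) - a‖ ≤ 2 * U * b := by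
    have := h.dist
    linarith
  have h3 := ptCost_le_of_near (hrec _ h2) (h.mid _ h2).2
  have hr := norm_nonneg (q - a)
  have h4 : 2 * η * ‖q - a‖ * (b + 2 * ‖S (near S q) - a‖)
      ≤ 2 * η * ‖q - a‖ * (b + 4 * ctrDist S a) :=
    mul_le_mul_of_nonneg_left (by linarith) (by positivity)
  linarith

/-- If all centers but the nearest one are far from `a`, the cost of a point close to `a` is
realized by the center nearest to `a`. -/
theorem ptCost_eq_of_isolated (hgood : ∀ i, i ≠ near S a → 4 * ctrDist S a ≤ ‖S i - a‖)
    (hq : 2 * ‖q - a‖ ≤ ctrDist S a) : ptCost q S = ‖q - S (near S a)‖ ^ 2 := by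
  refine le_antisymm (ptCost_le q S _) ?_
  rw [ptCost_eq, ctrDist]
  by_cases h : near S q = near S a
  · rw [h]
  · have h1 := hgood _ h
    have h2 := norm_near_sub_le S q a
    have h3 := ctrDist_nonneg S a
    have h4 := norm_nonneg (q - a)
    have h5 : ctrDist S a = 0 := by linarith
    have h6 : q - a = 0 := norm_eq_zero.1 (by linarith)
    have h7 : q = a := sub_eq_zero.1 h6
    exact absurd (by rw [h7]) h

/-- Two solutions with the same code have nearly the same cost function on a cluster with
reference center `a`, relative to the cost of `a` itself. The error is proportional to
`‖q - a‖` although the distances of the centers to `a` are themselves only known up to a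
relative error: for `q` close to `a`, either all the distances are recorded to high precision, or
a single center matters, whose distance to `a` cancels. -/
theorem abs_excess_sub_le (hη : 0 ≤ η) (hη1 : η ≤ 1) (hb : 0 ≤ b) (hU : 0 ≤ U)
    (h : ScaleClose η b U q a S S') (h' : ScaleClose η b U q a S' S)
    (hnear : near S a = near S' a)
    (hcase : ((∀ i, ‖S i - a‖ ≤ 2 * U * b → |‖S i - a‖ ^ 2 - ‖S' i - a‖ ^ 2| ≤ η * b ^ 2) ∧
        ∀ i, ‖S' i - a‖ ≤ 2 * U * b → |‖S' i - a‖ ^ 2 - ‖S i - a‖ ^ 2| ≤ η * b ^ 2) ∨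
      ((∀ i, i ≠ near S a → 4 * ctrDist S a ≤ ‖S i - a‖) ∧
        ∀ i, i ≠ near S' a → 4 * ctrDist S' a ≤ ‖S' i - a‖)) :
    |(ptCost q S - ptCost a S) - (ptCost q S' - ptCost a S')|
      ≤ 2 ^ 18 * η * (‖q - a‖ ^ 2 + ‖q - a‖ * ctrDist S a + b ^ 2) := by
  have h0 := ctrDist_nonneg S a
  have h0' := ctrDist_nonneg S' a
  have hr := norm_nonneg (q - a)
  have hrD : 0 ≤ η * (‖q - a‖ * ctrDist S a) := by positivity
  have hrr : 0 ≤ η * ‖q - a‖ ^ 2 := by positivity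
  have hbb : 0 ≤ η * b ^ 2 := by positivity
  have hrb : η * (‖q - a‖ * b) ≤ η * ‖q - a‖ ^ 2 + η * b ^ 2 := by
    rw [← mul_add]
    gcongr
    nlinarith [sq_nonneg (‖q - a‖ - b), sq_nonneg (‖q - a‖), sq_nonneg b]
  -- if `q` is not much closer to `a` than the centers are, errors of order `η * ‖q - a‖ ^ 2` are
  -- allowed
  by_cases hD : ctrDist S a ≤ 4 * ‖q - a‖
  · refine (h.abs_sub_le_of_le hη hη1 hb hU h' hD).trans ?_
    linarith
  by_cases hD' : ctrDist S' a ≤ 4 * ‖q - a‖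
  · rw [abs_sub_comm]
    refine (h'.abs_sub_le_of_le hη hη1 hb hU h hD').trans ?_
    linarith
  push Not at hD hD'
  have h7 := h.ctrDist_le hη1 hb hU
  rcases hcase with ⟨hrec, hrec'⟩ | ⟨hgood, hgood'⟩
  · have d1 := h.ptCost_le_recorded hη hrec (by linarith)
    have d2 := h'.ptCost_le_recorded hη hrec' (by linarith)
    have hUb := mul_nonneg hU hb
    have hn1 : ‖S (near S a) - a‖ ≤ 2 * U * b := by
      rw [norm_near_self_sub]; linarith [h.dist]
    have hn2 : ‖S' (near S' a) - a‖ ≤ 2 * U * b := by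
      rw [norm_near_self_sub]; linarith [h'.dist]
    have d3 : ptCost a S' ≤ ptCost a S + η * b ^ 2 := by
      have e1 := hrec _ hn1
      have e2 := ptCost_le a S' (near S a)
      rw [norm_sub_rev] at e2
      rw [ptCost_eq a S, ← norm_near_self_sub]
      linarith [(abs_le.1 e1).1]
    have d4 : ptCost a S ≤ ptCost a S' + η * b ^ 2 := by
      have e1 := hrec' _ hn2
      have e2 := ptCost_le a S (near S' a)
      rw [norm_sub_rev] at e2
      rw [ptCost_eq a S', ← norm_near_self_sub]
      linarith [(abs_le.1 e1).1]
    have e1 : 4 * η * ‖q - a‖ * (b + 4 * ctrDist S' a)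
        ≤ 4 * η * ‖q - a‖ * (b + 4 * (7 * ctrDist S a + 3 * b)) := by gcongr
    rw [abs_le]
    constructor <;> nlinarith
  · -- one center serves both `q` and `a`, and its squared distance to `a` cancels
    have e1 := ptCost_eq_of_isolated hgood (by linarith : 2 * ‖q - a‖ ≤ _)
    have e2 := ptCost_eq_of_isolated hgood' (by linarith : 2 * ‖q - a‖ ≤ _)
    have hn1 : ‖S (near S a) - a‖ ≤ 2 * U * b := by
      have := mul_nonneg hU hb
      rw [norm_near_self_sub]; linarith [h.dist]
    have h3 := (h.mid _ hn1).2
    rw [norm_near_self_sub] at h3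
    have e0 : inner ℝ (q - a) (S (near S a) - S' (near S a))
        = inner ℝ (q - a) (S (near S a) - a) - inner ℝ (q - a) (S' (near S a) - a) := by
      rw [← inner_sub_right, sub_sub_sub_cancel_right]
    have e3 : (ptCost q S - ptCost a S) - (ptCost q S' - ptCost a S')
        = -(2 * inner ℝ (q - a) (S (near S a) - S' (near S a))) := by
      rw [e1, e2, ptCost_eq a S, ptCost_eq a S', ctrDist, ctrDist, ← hnear,
        norm_sub_sq_expand q a (S (near S a)), norm_sub_sq_expand q a (S' (near S a)),
        norm_sub_rev a (S (near S a)), norm_sub_rev a (S' (near S a)), e0]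
      ring
    rw [e3, abs_neg, abs_mul, abs_two]
    nlinarith

end Near

/-! ### Stability and merging of centers -/

/-- A choice of representatives of the fibers of `τ` that minimize `D` on their fiber. -/
theorem exists_min_representative {N M : Type*} (s : Finset N) (τ : N → M) (D : N → ℝ) :
    ∃ r : N → N, (∀ i ∈ s, r i ∈ s ∧ τ (r i) = τ i ∧ D (r i) ≤ D i) ∧
      ∀ i ∈ s, ∀ j ∈ s, τ i = τ j → r i = r j := by
  classical
  have h : ∀ y ∈ s.image τ, ∃ i ∈ s, τ i = y ∧ ∀ j ∈ s, τ j = y → D i ≤ D j := by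
    intro y hy
    obtain ⟨i0, hi0, rfl⟩ := Finset.mem_image.1 hy
    obtain ⟨i, hi, hmin⟩ := Finset.exists_min_image (s.filter fun j => τ j = τ i0) D
      ⟨i0, by simp [hi0]⟩
    rw [Finset.mem_filter] at hi
    exact ⟨i, hi.1, hi.2, fun j hj e => hmin j (by simp [hj, e])⟩
  rcases s.eq_empty_or_nonempty with rfl | ⟨i0, hi0⟩
  · exact ⟨id, by simp, by simp⟩
  have : Nonempty N := ⟨i0⟩
  choose! ρ h1 h2 h3 using h
  refine ⟨fun i => ρ (τ i), fun i hi => ?_, fun i _ j _ e => by simp only [e]⟩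
  have hm := Finset.mem_image_of_mem τ hi
  exact ⟨h1 _ hm, h2 _ hm, h3 _ hm i hi rfl⟩

/-- Among the vertices `τ j` with an out-edge to `σ j ≠ τ j`, at least a third can be removed
such that all their out-edges lead to vertices that are kept. -/
theorem exists_independent_third {N M : Type*} (J : Finset N) (τ σ : N → M)
    (hτ : Set.InjOn τ J) (hσ : ∀ j ∈ J, σ j ≠ τ j) :
    ∃ X ⊆ J, J.card ≤ 3 * X.card ∧ ∀ i ∈ X, ∀ j ∈ X, σ i ≠ τ j := by
  classical
  obtain ⟨ind, hind⟩ : ∃ ind : Finset N → Prop, ∀ X, ind X ↔ ∀ i ∈ X, ∀ j ∈ X, σ i ≠ τ j :=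
    ⟨_, fun _ => Iff.rfl⟩
  obtain ⟨X, hX, hmax⟩ := Finset.exists_max_image (J.powerset.filter ind) Finset.card
    ⟨∅, by simp [hind]⟩
  rw [Finset.mem_filter, Finset.mem_powerset, hind] at hX
  obtain ⟨hXJ, hXi⟩ := hX
  refine ⟨X, hXJ, ?_, hXi⟩
  set Y := (J \ X).filter fun v => ∃ j ∈ X, σ v = τ j with hY
  set Z := J.filter fun v => ∃ i ∈ X, τ v = σ i with hZ
  have hYc : Y.card ≤ X.card := by
    apply hmax
    rw [Finset.mem_filter, Finset.mem_powerset, hind]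
    refine ⟨fun v hv => (Finset.mem_sdiff.1 (Finset.mem_filter.1 hv).1).1, fun i hi j hj e => ?_⟩
    obtain ⟨-, j', hj', e'⟩ := Finset.mem_filter.1 hi
    have hj2 := Finset.mem_sdiff.1 (Finset.mem_filter.1 hj).1
    exact hj2.2 ((hτ (hXJ hj') hj2.1 (e'.symm.trans e)) ▸ hj')
  have hZc : Z.card ≤ X.card := by
    have h1 : (Z.image τ).card = Z.card :=
      Finset.card_image_of_injOn (hτ.mono fun v hv => (Finset.mem_filter.1 hv).1)
    rw [← h1]
    refine (Finset.card_le_card (t := X.image σ) fun y hy => ?_).trans Finset.card_image_le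
    obtain ⟨v, hv, rfl⟩ := Finset.mem_image.1 hy
    obtain ⟨-, i, hi, e⟩ := Finset.mem_filter.1 hv
    rw [e]
    exact Finset.mem_image_of_mem σ hi
  -- by maximality, a vertex outside of `X` has an edge into `X` or receives one from `X`
  have hcover : J ⊆ X ∪ (Y ∪ Z) := by
    intro v hv
    by_contra hn
    simp only [Finset.mem_union, not_or] at hn
    obtain ⟨hvX, hvY, hvZ⟩ := hn
    have h1 := hmax (insert v X) (by
      rw [Finset.mem_filter, Finset.mem_powerset, hind]
      refine ⟨Finset.insert_subset hv hXJ, fun i hi j hj e => ?_⟩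
      rw [Finset.mem_insert] at hi hj
      rcases hi with rfl | hi
      · rcases hj with rfl | hj
        · exact hσ _ hv e
        · exact hvY (Finset.mem_filter.2 ⟨Finset.mem_sdiff.2 ⟨hv, hvX⟩, j, hj, e⟩)
      · rcases hj with rfl | hj
        · exact hvZ (Finset.mem_filter.2 ⟨hv, i, hi, e.symm⟩)
        · exact hXi i hi j hj e)
    rw [Finset.card_insert_of_notMem hvX] at h1
    omega
  have h1 := Finset.card_le_card hcover
  have h2 := Finset.card_union_le X (Y ∪ Z)
  have h3 := Finset.card_union_le Y Z
  omega

section Opt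

variable {d k : ℕ} {P : Finset (Pt d)}

/-- The optimal cost as a real number. -/
noncomputable def opt (P : Finset (Pt d)) (k : ℕ) : ℝ := (optCost P k).toReal

theorem opt_nonneg : 0 ≤ opt P k := ENNReal.toReal_nonneg

theorem optCost_ne_top (hk : 1 ≤ k) : optCost P k ≠ ⊤ := by
  rw [optCost_eq P hk]
  exact ne_top_of_le_ne_top ENNReal.ofReal_ne_top (iInf_le _ fun _ => 0)

theorem opt_le_cost (hk : 1 ≤ k) (S : Fin k → Pt d) : opt P k ≤ cost P S := by
  refine ENNReal.toReal_le_of_le_ofReal (cost_nonneg P S) ?_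
  rw [optCost_eq P hk]
  exact iInf_le _ S

theorem IsApprox.cost_le {γ : ℝ} (hγ : 0 ≤ γ) (hk : 1 ≤ k) {A : Fin k → Pt d}
    (h : IsApprox γ P A) : cost P A ≤ γ * opt P k := by
  unfold IsApprox at h
  rw [← ENNReal.ofReal_toReal (optCost_ne_top (P := P) hk), ← ENNReal.ofReal_mul hγ] at h
  exact (ENNReal.ofReal_le_ofReal_iff (mul_nonneg hγ ENNReal.toReal_nonneg)).1 h

theorem exists_cost_lt (hk : 1 ≤ k) {x : ℝ} (hx : opt P k < x) :
    ∃ S : Fin k → Pt d, cost P S < x := by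
  have h1 : optCost P k < ENNReal.ofReal x := by
    rw [← ENNReal.ofReal_toReal (optCost_ne_top (P := P) hk)]
    exact (ENNReal.ofReal_lt_ofReal_iff (opt_nonneg.trans_lt hx)).2 hx
  rw [optCost_eq P hk] at h1
  obtain ⟨S, hS⟩ := iInf_lt_iff.1 h1
  exact ⟨S, (ENNReal.ofReal_lt_ofReal_iff (opt_nonneg.trans_lt hx)).1 hS⟩

/-- Stability bounds from below the cost of every assignment to at most `k - 1` centers. -/
theorem IsStable.le_sum {β : ℝ} (hβ : 0 < β) (hk : 1 ≤ k) (h : IsStable β k P)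
    (T : Finset (Pt d)) (hT0 : T.Nonempty) (hT : T.card < k) (g : Pt d → Pt d)
    (hg : ∀ p ∈ P, g p ∈ T) : (1 + β) * opt P k ≤ ∑ p ∈ P, ‖p - g p‖ ^ 2 := by
  classical
  have hk1 : 1 ≤ k - 1 := by
    have := hT0.card_pos
    omega
  have : Nonempty T := ⟨⟨_, hT0.choose_spec⟩⟩
  obtain ⟨e⟩ : Nonempty (T ↪ Fin (k - 1)) :=
    Function.Embedding.nonempty_of_card_le (by simp; omega)
  set f : Fin (k - 1) → Pt d := fun i => (Function.invFun e i : T) with hf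
  have h1 : cost P f ≤ ∑ p ∈ P, ‖p - g p‖ ^ 2 := by
    refine Finset.sum_le_sum fun p hp => ?_
    have h2 := ptCost_le p f (e ⟨g p, hg p hp⟩)
    simp only [hf, Function.leftInverse_invFun e.injective _] at h2
    exact h2
  refine le_trans ?_ h1
  unfold IsStable at h
  rw [optCost_eq P hk1, ← ENNReal.ofReal_toReal (optCost_ne_top (P := P) hk),
    ← ENNReal.ofReal_mul (by linarith)] at h
  exact (ENNReal.ofReal_le_ofReal_iff (cost_nonneg P f)).1 (h.trans (iInf_le _ f))

theorem exists_centroid (Q : Finset (Pt d)) : ∃ z : Pt d, ∀ y,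
    ∑ p ∈ Q, ‖p - y‖ ^ 2 = ∑ p ∈ Q, ‖p - z‖ ^ 2 + Q.card * ‖z - y‖ ^ 2 := by
  rcases Q.eq_empty_or_nonempty with rfl | hQ
  · exact ⟨0, by simp⟩
  have hc : (Q.card : ℝ) ≠ 0 := by exact_mod_cast hQ.card_pos.ne'
  refine ⟨(Q.card : ℝ)⁻¹ • ∑ p ∈ Q, p, fun y => ?_⟩
  set z := (Q.card : ℝ)⁻¹ • ∑ p ∈ Q, p with hz
  have h0 : ∑ p ∈ Q, (p - z) = 0 := by
    rw [Finset.sum_sub_distrib, Finset.sum_const, hz, ← Nat.cast_smul_eq_nsmul ℝ, smul_smul,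
      mul_inv_cancel₀ hc, one_smul, sub_self]
  have h1 : ∀ p ∈ Q, ‖p - y‖ ^ 2 = ‖p - z‖ ^ 2 + 2 * inner ℝ (p - z) (z - y) + ‖z - y‖ ^ 2 := by
    intro p _
    have : p - y = (p - z) + (z - y) := by abel
    rw [this, norm_add_sq_real]
  rw [Finset.sum_congr rfl h1, Finset.sum_add_distrib, Finset.sum_add_distrib, ← Finset.mul_sum,
    ← sum_inner, h0, inner_zero_left, Finset.sum_const, nsmul_eq_mul]
  ring

theorem sq_norm_sub_le_two (x y z : Pt d) :
    ‖x - z‖ ^ 2 ≤ 2 * ‖x - y‖ ^ 2 + 2 * ‖y - z‖ ^ 2 := by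
  have h : ‖x - z‖ ≤ ‖x - y‖ + ‖y - z‖ := by
    have := norm_add_le (x - y) (y - z)
    rwa [sub_add_sub_cancel] at this
  have h1 : ‖x - z‖ ^ 2 ≤ (‖x - y‖ + ‖y - z‖) ^ 2 := by gcongr
  nlinarith [sq_nonneg (‖x - y‖ - ‖y - z‖)]

/-- In a stable instance, saving `e` centers costs about `e` times as much as saving one: a set
`T` of `k - e` centers captures many pairs of centers of a near-optimal solution, and merging the
cheapest such pair saves one center. -/
theorem IsStable.saved_centers_le {β : ℝ} (hβ : 0 < β) (hk : 1 ≤ k) (h : IsStable β k P)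
    (ho : 0 < opt P k) (T : Finset (Pt d)) (hT0 : T.Nonempty) {e : ℕ} (hT : T.card + e ≤ k)
    (g : Pt d → Pt d) (hg : ∀ p ∈ P, g p ∈ T) :
    e * β * opt P k ≤ 32 * ∑ p ∈ P, ‖p - g p‖ ^ 2 := by
  classical
  rcases Nat.eq_zero_or_pos e with rfl | he
  · simp only [Nat.cast_zero, zero_mul]
    positivity
  have hne : Nonempty (Fin k) := ⟨⟨0, hk⟩⟩
  set M := ∑ p ∈ P, ‖p - g p‖ ^ 2 with hM
  have hM1 : (1 + β) * opt P k ≤ M := h.le_sum hβ hk T hT0 (by omega) g hg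
  obtain ⟨S0, hS0⟩ := exists_cost_lt (P := P) (x := (1 + β / 2) * opt P k) hk (by nlinarith)
  set ℓ : Pt d → Fin k := fun p => near S0 p with hℓ
  set Q : Fin k → Finset (Pt d) := fun i => P.filter fun p => ℓ p = i with hQ
  -- centroids, so that moving the center of a part `Q i` to `y` costs exactly
  -- `|Q i| * ‖z i - y‖ ^ 2`
  choose z hz using fun i => exists_centroid (Q i)
  have fib : ∀ f : Pt d → ℝ, ∑ p ∈ P, f p = ∑ i, ∑ p ∈ Q i, f p := fun f =>
    (Finset.sum_fiberwise P ℓ f).symm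
  set cO := ∑ i, ∑ p ∈ Q i, ‖p - z i‖ ^ 2 with hcO
  have hcO1 : cO ≤ cost P S0 := by
    rw [cost, fib]
    refine Finset.sum_le_sum fun i _ => ?_
    have h1 := hz i (S0 i)
    have h2 : ∑ p ∈ Q i, ptCost p S0 = ∑ p ∈ Q i, ‖p - S0 i‖ ^ 2 := by
      refine Finset.sum_congr rfl fun p hp => ?_
      rw [ptCost_eq, ctrDist, show near S0 p = i from (Finset.mem_filter.1 hp).2]
    rw [h2, h1]
    have : (0 : ℝ) ≤ (Q i).card * ‖z i - S0 i‖ ^ 2 :=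
      mul_nonneg (Nat.cast_nonneg _) (sq_nonneg _)
    linarith
  have hτ : ∀ i, ∃ t ∈ T, ∀ t' ∈ T, ‖z i - t‖ ≤ ‖z i - t'‖ := fun i =>
    Finset.exists_min_image T (fun t => ‖z i - t‖) hT0
  choose τ hτT hτmin using hτ
  have hPne : P.Nonempty := by
    rw [Finset.nonempty_iff_ne_empty]
    rintro rfl
    have : opt (∅ : Finset (Pt d)) k ≤ cost ∅ S0 := opt_le_cost hk S0
    simp only [cost, Finset.sum_empty] at this
    linarith
  -- all parts of the near-optimal solution are needed
  have hall : ∀ i, (Q i).Nonempty := by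
    by_contra hn
    push Not at hn
    obtain ⟨i0, hi0⟩ := hn
    have h1 := h.le_sum hβ hk ((P.image ℓ).image z) ((hPne.image _).image _)
      (by
        refine (Finset.card_image_le).trans_lt ?_
        have : P.image ℓ ⊆ Finset.univ.erase i0 := by
          intro i hi
          obtain ⟨p, hp, rfl⟩ := Finset.mem_image.1 hi
          rw [Finset.mem_erase]
          refine ⟨fun e => ?_, Finset.mem_univ _⟩
          have : p ∈ Q i0 := Finset.mem_filter.2 ⟨hp, e⟩
          rw [hi0] at this
          simp at this
        have h2 := Finset.card_le_card this
        rw [Finset.card_erase_of_mem (Finset.mem_univ _), Finset.card_univ, Fintype.card_fin] at h2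
        omega)
      (fun p => z (ℓ p)) (fun p hp => Finset.mem_image_of_mem _ (Finset.mem_image_of_mem _ hp))
    rw [fib] at h1
    have h2 : ∑ i, ∑ p ∈ Q i, ‖p - z (ℓ p)‖ ^ 2 = cO := by
      refine Finset.sum_congr rfl fun i _ => Finset.sum_congr rfl fun p hp => ?_
      rw [show ℓ p = i from (Finset.mem_filter.1 hp).2]
    rw [h2] at h1
    nlinarith
  obtain ⟨r, hr1, hr2⟩ := exists_min_representative Finset.univ τ fun i => ‖z i - τ i‖
  set X := Finset.univ.filter fun i => r i ≠ i with hX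
  -- the parts that share their nearest point of `T` with another part at least as close to it
  have hXc : e ≤ X.card := by
    have h1 := Finset.card_filter_add_card_filter_not (s := (Finset.univ : Finset (Fin k)))
      (fun i => r i = i)
    have h2 : (Finset.univ.filter fun i => r i = i).card ≤ T.card := by
      refine Finset.card_le_card_of_injOn τ (fun i _ => hτT i) fun i hi j hj e => ?_
      have := hr2 i (Finset.mem_univ _) j (Finset.mem_univ _) e
      simp only [Finset.coe_filter, Finset.mem_univ, true_and, Set.mem_ofPred_eq] at hi hj
      rw [← hi, ← hj, this]
    rw [Finset.card_univ, Fintype.card_fin] at h1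
    simp only [hX, ne_eq]
    omega
  -- moving such a part to the centroid of that other part saves a center
  have hmerge : ∀ i ∈ X, β / 8 * opt P k ≤ (Q i).card * ‖z i - τ i‖ ^ 2 := by
    intro i hi
    have hi' : r i ≠ i := (Finset.mem_filter.1 hi).2
    set g' : Pt d → Pt d := fun p => if ℓ p = i then z (r i) else z (ℓ p) with hg'
    have h1 := h.le_sum hβ hk ((Finset.univ.erase i).image z)
      ⟨z (r i), Finset.mem_image_of_mem _ (by simp [hi'])⟩
      (by
        refine (Finset.card_image_le).trans_lt ?_
        rw [Finset.card_erase_of_mem (Finset.mem_univ _), Finset.card_univ, Fintype.card_fin]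
        omega) g'
      (fun p _ => by
        simp only [hg']
        split_ifs with hp
        · exact Finset.mem_image_of_mem _ (by simp [hi'])
        · exact Finset.mem_image_of_mem _ (by simp [hp]))
    have h2 : ∑ p ∈ P, ‖p - g' p‖ ^ 2 = cO + (Q i).card * ‖z i - z (r i)‖ ^ 2 := by
      rw [fib, hcO, ← Finset.add_sum_erase _ _ (Finset.mem_univ i),
        ← Finset.add_sum_erase _ (fun i => ∑ p ∈ Q i, ‖p - z i‖ ^ 2) (Finset.mem_univ i)]
      have h3 : ∑ p ∈ Q i, ‖p - g' p‖ ^ 2 = ∑ p ∈ Q i, ‖p - z (r i)‖ ^ 2 := by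
        refine Finset.sum_congr rfl fun p hp => ?_
        simp [hg', show ℓ p = i from (Finset.mem_filter.1 hp).2]
      have h4 : ∑ x ∈ Finset.univ.erase i, ∑ p ∈ Q x, ‖p - g' p‖ ^ 2
          = ∑ x ∈ Finset.univ.erase i, ∑ p ∈ Q x, ‖p - z x‖ ^ 2 := by
        refine Finset.sum_congr rfl fun x hx => Finset.sum_congr rfl fun p hp => ?_
        have hx' : x ≠ i := (Finset.mem_erase.1 hx).1
        simp [hg', show ℓ p = x from (Finset.mem_filter.1 hp).2, hx']
      rw [h3, h4, hz i (z (r i))]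
      ring
    rw [h2] at h1
    obtain ⟨-, hri, hri'⟩ := hr1 i (Finset.mem_univ _)
    have h5 : ‖z i - z (r i)‖ ^ 2 ≤ 4 * ‖z i - τ i‖ ^ 2 := by
      have h6 := sq_norm_sub_le_two (z i) (τ i) (z (r i))
      rw [norm_sub_rev (τ i), ← hri] at h6
      have h7 : ‖z (r i) - τ (r i)‖ ^ 2 ≤ ‖z i - τ i‖ ^ 2 := by gcongr
      rw [hri] at h6 h7
      linarith
    have h8 : ((Q i).card : ℝ) * ‖z i - z (r i)‖ ^ 2 ≤ (Q i).card * (4 * ‖z i - τ i‖ ^ 2) :=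
      mul_le_mul_of_nonneg_left h5 (Nat.cast_nonneg _)
    nlinarith
  have hsum : ∑ i, ((Q i).card : ℝ) * ‖z i - τ i‖ ^ 2 ≤ 2 * cO + 2 * M := by
    rw [hM, fib, hcO, Finset.mul_sum, Finset.mul_sum, ← Finset.sum_add_distrib]
    refine Finset.sum_le_sum fun i _ => ?_
    rw [Finset.mul_sum, Finset.mul_sum, ← Finset.sum_add_distrib, ← nsmul_eq_mul,
      ← Finset.sum_const]
    refine Finset.sum_le_sum fun p hp => ?_
    have h1 := hτmin i (g p) (hg p (Finset.mem_filter.1 hp).1)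
    have h2 : ‖z i - τ i‖ ^ 2 ≤ ‖z i - g p‖ ^ 2 := by gcongr
    have h3 := sq_norm_sub_le_two (z i) p (g p)
    rw [norm_sub_rev (z i) p] at h3
    linarith
  have h1 : X.card * (β / 8 * opt P k) ≤ 2 * cO + 2 * M := by
    rw [← nsmul_eq_mul, ← Finset.sum_const]
    refine (Finset.sum_le_sum hmerge).trans (le_trans ?_ hsum)
    exact Finset.sum_le_sum_of_subset_of_nonneg (Finset.subset_univ _) fun i _ _ =>
      mul_nonneg (Nat.cast_nonneg _) (sq_nonneg _)
  have h2 : (e : ℝ) ≤ X.card := by exact_mod_cast hXc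
  have h3 : (e : ℝ) * (β / 8 * opt P k) ≤ X.card * (β / 8 * opt P k) := by gcongr
  nlinarith

/-- The clusters (of a solution `A` with assignment `c`) that see two centers of `S` at
comparable distances. -/
noncomputable def ambiguous [Nonempty (Fin k)] (P : Finset (Pt d)) (A : Fin k → Pt d)
    (c : Pt d → Fin k) (S : Fin k → Pt d) : Finset (Fin k) :=
  open Classical in (P.image c).filter fun j =>
    ∃ i, i ≠ near S (A j) ∧ ‖S i - A j‖ < 4 * ctrDist S (A j)

/-- In a stable instance, few clusters see two centers of `S` at comparable distances, relative to
the cost of `A` and `S`. Clusters sharing a nearest center with another one could be merged in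
`A`, and an ambiguous cluster alone at its nearest center allows to drop that center from `S`. -/
theorem IsStable.card_ambiguous_le [Nonempty (Fin k)] {β : ℝ} (hβ : 0 < β) (hk : 1 ≤ k)
    (h : IsStable β k P) (ho : 0 < opt P k) (hP : P.Nonempty) (A : Fin k → Pt d)
    (c : Pt d → Fin k) (S : Fin k → Pt d) :
    (ambiguous P A c S).card * β * opt P k
      ≤ 8000 * (∑ p ∈ P, ‖p - A (c p)‖ ^ 2 + ∑ p ∈ P, ctrDist S (A (c p)) ^ 2) := by
  classical
  set Φ := ∑ p ∈ P, ‖p - A (c p)‖ ^ 2 with hΦ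
  set W := ∑ p ∈ P, ctrDist S (A (c p)) ^ 2 with hW
  have hΦ0 : 0 ≤ Φ := Finset.sum_nonneg fun _ _ => sq_nonneg _
  have hW0 : 0 ≤ W := Finset.sum_nonneg fun _ _ => sq_nonneg _
  set τ : Fin k → Fin k := fun j => near S (A j) with hτ
  set D : Fin k → ℝ := fun j => ctrDist S (A j) with hD
  have hD0 : ∀ j, 0 ≤ D j := fun j => ctrDist_nonneg _ _
  set NE := P.image c with hNE
  have hmem : ∀ p ∈ P, c p ∈ NE := fun p hp => Finset.mem_image_of_mem c hp
  obtain ⟨r, hr1, hr2⟩ := exists_min_representative NE τ D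
  have hrr : ∀ j ∈ NE, r (r j) = r j := fun j hj =>
    hr2 _ (hr1 j hj).1 _ hj (hr1 j hj).2.1
  have hAD : ∀ j, ‖A j - S (τ j)‖ = D j := fun j => rfl
  have hAr : ∀ j ∈ NE, ‖A j - A (r j)‖ ≤ 2 * D j := by
    intro j hj
    obtain ⟨-, h1, h2⟩ := hr1 j hj
    have h3 := norm_sub_le_norm_sub_add_norm_sub (A j) (S (τ j)) (A (r j))
    have h4 := hAD (r j)
    rw [h1, norm_sub_rev] at h4
    rw [h4, hAD] at h3
    linarith
  -- the cost of an assignment that moves each point by its cost and a multiple of `D`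
  have hcost : ∀ (g : Pt d → Pt d) (K : ℝ), (∀ p ∈ P, ‖A (c p) - g p‖ ≤ K * D (c p)) →
      ∑ p ∈ P, ‖p - g p‖ ^ 2 ≤ 2 * Φ + 2 * K ^ 2 * W := by
    intro g K hg
    rw [hΦ, hW, Finset.mul_sum, Finset.mul_sum, ← Finset.sum_add_distrib]
    refine Finset.sum_le_sum fun p hp => ?_
    have h1 := sq_norm_sub_le_two p (A (c p)) (g p)
    have h2 : ‖A (c p) - g p‖ ^ 2 ≤ (K * D (c p)) ^ 2 := by
      have := hg p hp
      gcongr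
    rw [mul_pow] at h2
    simp only [hD] at h2
    linarith
  set R := NE.filter fun j => r j = j with hR
  set E1 := NE.filter fun j => ¬ r j = j with hE1
  have hcardRE : R.card + E1.card = NE.card :=
    Finset.card_filter_add_card_filter_not (s := NE) (fun j => r j = j)
  have hNEk : NE.card ≤ k := by
    simpa using Finset.card_le_univ NE
  have hrR : ∀ j ∈ NE, r j ∈ R := fun j hj =>
    Finset.mem_filter.2 ⟨(hr1 j hj).1, hrr j hj⟩
  -- among the clusters with the same nearest center of `S`, keep only the reference center closest
  -- to it
  have b1 : E1.card * β * opt P k ≤ 32 * (2 * Φ + 8 * W) := by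
    have h1 := h.saved_centers_le hβ hk ho (R.image A)
      (by
        obtain ⟨p, hp⟩ := hP
        exact ⟨_, Finset.mem_image_of_mem A (hrR _ (hmem p hp))⟩) (e := E1.card)
      (by
        have := Finset.card_image_le (s := R) (f := A)
        omega)
      (fun p => A (r (c p))) (fun p hp => Finset.mem_image_of_mem A (hrR _ (hmem p hp)))
    have h2 := hcost (fun p => A (r (c p))) 2 fun p hp => hAr _ (hmem p hp)
    linarith
  set J := (ambiguous P A c S).filter fun j => r j = j with hJ
  have hJNE : ∀ j ∈ J, j ∈ NE := fun j hj => (Finset.mem_filter.1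
    (Finset.mem_filter.1 hj).1).1
  have hJr : ∀ j ∈ J, r j = j := fun j hj => (Finset.mem_filter.1 hj).2
  have hσ : ∀ j ∈ J, ∃ i, i ≠ τ j ∧ ‖S i - A j‖ < 4 * D j := fun j hj =>
    (Finset.mem_filter.1 (Finset.mem_filter.1 hj).1).2
  choose! σ hσ1 hσ2 using hσ
  have hτinj : Set.InjOn τ J := by
    intro i hi j hj e
    have := hr2 i (hJNE i hi) j (hJNE j hj) e
    rwa [hJr i hi, hJr j hj] at this
  obtain ⟨X, hXJ, hX3, hXi⟩ := exists_independent_third J τ σ hτinj hσ1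
  -- the remaining ambiguous clusters have different nearest centers; those of a third of them can
  -- be dropped at once, since the second centers of these clusters are all kept
  have b2 : X.card * β * opt P k ≤ 32 * (2 * Φ + 72 * W) := by
    set g : Pt d → Pt d := fun p => if r (c p) ∈ X then S (σ (r (c p))) else S (τ (c p)) with hg
    have hcardX : (X.image τ).card = X.card :=
      Finset.card_image_of_injOn (hτinj.mono fun x hx => hXJ hx)
    have hgT : ∀ p ∈ P, g p ∈ (Finset.univ \ X.image τ).image S := by
      intro p hp
      simp only [hg]
      split_ifs with hx
      · refine Finset.mem_image_of_mem S (Finset.mem_sdiff.2 ⟨Finset.mem_univ _, fun hm => ?_⟩)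
        obtain ⟨j, hj, e⟩ := Finset.mem_image.1 hm
        exact hXi _ hx j hj e.symm
      · refine Finset.mem_image_of_mem S (Finset.mem_sdiff.2 ⟨Finset.mem_univ _, fun hm => ?_⟩)
        obtain ⟨j, hj, e⟩ := Finset.mem_image.1 hm
        have h1 := hr2 j (hJNE j (hXJ hj)) _ (hmem p hp) e
        rw [hJr j (hXJ hj)] at h1
        exact hx (h1 ▸ hj)
    have h1 := h.saved_centers_le hβ hk ho ((Finset.univ \ X.image τ).image S)
      (by
        obtain ⟨p, hp⟩ := hP
        exact ⟨_, hgT p hp⟩) (e := X.card)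
      (by
        have h2 := Finset.card_image_le (s := Finset.univ \ X.image τ) (f := S)
        have h3 := Finset.card_sdiff_add_card_eq_card (Finset.subset_univ (X.image τ))
        rw [Finset.card_univ, Fintype.card_fin] at h3
        omega) g hgT
    have h2 := hcost g 6 fun p hp => by
      have hm := hmem p hp
      have hDp := hD0 (c p)
      simp only [hg]
      split_ifs with hx
      · have h3 := norm_sub_le_norm_sub_add_norm_sub (A (c p)) (A (r (c p))) (S (σ (r (c p))))
        have h4 := hσ2 _ (hXJ hx)
        rw [norm_sub_rev] at h4
        have h5 := (hr1 _ hm).2.2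
        have h6 := hAr _ hm
        linarith
      · rw [hAD]
        linarith
    linarith
  have hcard : (ambiguous P A c S).card ≤ E1.card + 3 * X.card := by
    have h1 : J.card + ((ambiguous P A c S).filter fun j => ¬ r j = j).card
        = (ambiguous P A c S).card := Finset.card_filter_add_card_filter_not _
    have h2 : ((ambiguous P A c S).filter fun j => ¬ r j = j).card ≤ E1.card := by
      refine Finset.card_le_card fun j hj => ?_
      obtain ⟨h3, h4⟩ := Finset.mem_filter.1 hj
      exact Finset.mem_filter.2 ⟨(Finset.mem_filter.1 h3).1, h4⟩
    omega
  have hcard' : ((ambiguous P A c S).card : ℝ) ≤ E1.card + 3 * X.card := by exact_mod_cast hcard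
  have h1 : (ambiguous P A c S).card * (β * opt P k)
      ≤ (E1.card + 3 * X.card) * (β * opt P k) := by gcongr
  linarith

end Opt

/-! ### Codes for solutions -/

theorem exists_enum {α : Type*} [Nonempty α] (s : Finset α) {t : ℕ} (h : s.card ≤ t) :
    ∃ e : Fin t → α, ∀ j ∈ s, ∃ x, e x = j := by
  classical
  refine ⟨fun x => if hx : (x : ℕ) < s.card then (s.equivFin.symm ⟨x, hx⟩ : α) else
    Classical.arbitrary α, fun j hj => ⟨⟨s.equivFin ⟨j, hj⟩, (Fin.is_lt _).trans_le h⟩, ?_⟩⟩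
  simp

/-- The code of a solution at scale `h`: a code for each center, the nearest center to each
reference center, a list of `t` clusters, and rounded squared distances of their reference centers
to all centers. -/
abbrev SolCode (k t N₀ : ℕ) (I K : Type) (h : ℕ) : Type :=
  (Fin k → CenterCode (Fin k) I K (4 ^ h)) × (Fin k → Fin k) × (Fin t → Fin k) ×
    (Fin t → Fin k → Fin (N₀ * 2 ^ h + 1))

theorem card_solCode_le {k t N₀ h Q : ℕ} {I K : Type} [Fintype I] [Fintype K] (hk : 1 ≤ k)
    (hQk : k ≤ Q) (hQK : Fintype.card K + 1 ≤ Q) (hQI : 2 * (Fintype.card I + k) + 1 ≤ Q)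
    (hQh : 4 ^ h + 1 ≤ Q) (hQN : N₀ * 2 ^ h + 1 ≤ Q) :
    Fintype.card (SolCode k t N₀ I K h) ≤ Q ^ ((5 * k + 2 * k * t) * 4 ^ h) := by
  have hc : Fintype.card (SolCode k t N₀ I K h)
      = (k * ((Fintype.card K + 1) * (((Fintype.card I + k) * 2 + 1) ^ 4 ^ h * (4 ^ h + 1)))) ^ k
        * (k ^ k * (k ^ t * ((N₀ * 2 ^ h + 1) ^ k) ^ t)) := by
    simp [SolCode, CenterCode]
  rw [hc]
  have hQ1 : 1 ≤ Q := hk.trans hQk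
  have h4 : 1 ≤ 4 ^ h := Nat.one_le_pow _ _ (by norm_num)
  calc _ ≤ (Q * (Q * (Q ^ 4 ^ h * Q))) ^ k * (Q ^ k * (Q ^ t * (Q ^ k) ^ t)) := by
        have : (Fintype.card I + k) * 2 + 1 ≤ Q := by omega
        gcongr
    _ = Q ^ ((3 + 4 ^ h) * k + k + t + k * t) := by ring
    _ ≤ _ := by
        refine Nat.pow_le_pow_right hQ1 ?_
        have e1 : t ≤ k * t := Nat.le_mul_of_pos_left t hk
        have e2 : k ≤ k * 4 ^ h := Nat.le_mul_of_pos_right k h4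
        have e3 : k * t ≤ k * t * 4 ^ h := Nat.le_mul_of_pos_right _ h4
        nlinarith

/-- The length scales used in the codes: multiples of the distances of the sampled points to
their reference centers, and dyadic multiples of the length units `b j`. -/
noncomputable def scales {k : ℕ} {I : Type} (ρ : I → ℝ) (b : Fin k → ℝ) (L : ℕ) :
    I ⊕ (Fin k × Fin (L + 1)) → ℝ :=
  Sum.elim (fun q => 4 * ρ q) fun z => 2 ^ (z.2 : ℕ) * b z.1

theorem exists_scale {k : ℕ} {I : Type} (ρ : I → ℝ) {b : Fin k → ℝ} {L : ℕ} {j : Fin k}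
    (hb : 0 < b j) {U r : ℝ} (hU : 4 * U ≤ 2 ^ L) (hr : r ≤ 2 * U * b j) :
    ∃ κ, r ≤ scales ρ b L κ ∧ scales ρ b L κ ≤ b j + 2 * max r 0 := by
  rcases le_total r (b j) with h | h
  · refine ⟨Sum.inr (j, 0), ?_, ?_⟩
    · simpa [scales] using h
    · simp [scales]
  · have hr0 : 0 < r := hb.trans_le h
    obtain ⟨n, hn1, hn2⟩ := exists_nat_pow_near (x := r / b j) (y := 2)
      ((one_le_div hb).2 h) (by norm_num)
    rw [le_div_iff₀ hb] at hn1
    rw [div_lt_iff₀ hb] at hn2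
    have hnL : n + 1 < L + 1 := by
      have h1 : (2 : ℝ) ^ (n + 1) ≤ 2 ^ L := by
        refine le_trans ?_ hU
        rw [← mul_le_mul_iff_left₀ hb, pow_succ]
        linarith
      have := (pow_le_pow_iff_right₀ (by norm_num : (1 : ℝ) < 2)).1 h1
      omega
    refine ⟨Sum.inr (j, ⟨n + 1, hnL⟩), hn2.le, ?_⟩
    simp only [scales, Sum.elim_inr, pow_succ]
    rw [max_eq_left hr0.le]
    linarith

theorem abs_sub_le_of_floor_eq {v v' x : ℝ} {N : ℕ} (hx : 0 < x) (hv0 : 0 ≤ v) (hv0' : 0 ≤ v')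
    (hv : v < N * x) (h : min N ⌊v / x⌋₊ = min N ⌊v' / x⌋₊) : |v - v'| ≤ x := by
  have h1 : ⌊v / x⌋₊ < N := by
    rw [Nat.floor_lt (by positivity), div_lt_iff₀ hx]
    exact hv
  rw [min_eq_right h1.le] at h
  have h2 : ⌊v' / x⌋₊ = ⌊v / x⌋₊ := by
    rcases min_choice N ⌊v' / x⌋₊ with e | e <;> omega
  have c1 := Nat.floor_le (show 0 ≤ v / x by positivity)
  have c2 := Nat.lt_floor_add_one (v / x)
  have c3 := Nat.floor_le (show 0 ≤ v' / x by positivity)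
  have c4 := Nat.lt_floor_add_one (v' / x)
  rw [le_div_iff₀ hx] at c1
  rw [div_lt_iff₀ hx] at c2
  rw [h2, le_div_iff₀ hx] at c3
  rw [h2, div_lt_iff₀ hx] at c4
  rw [abs_le]
  constructor <;> linarith

section Sig

variable {d k : ℕ} [Nonempty (Fin k)]

/-- Solutions that are not far from any cluster, relative to the units `b j`, and have few
ambiguous clusters can be encoded such that solutions with the same code at scale `h` have cost
functions that agree on the sample up to a relative error of order `2⁻ʰ`. -/
theorem exists_solCode {P : Finset (Pt d)} (A : Fin k → Pt d) (c : Pt d → Fin k) {I : Type}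
    [Finite I] (y : I → Pt d) (hy : ∀ q, y q ∈ P) {b : Fin k → ℝ} (hb : ∀ j, 0 < b j) {U : ℝ}
    (hU : 0 ≤ U) {L N₀ t : ℕ} (hL : 4 * U ≤ 2 ^ L) (hN₀ : 4 * U ^ 2 + 1 ≤ N₀) (h : ℕ) :
    ∃ sig : {S : Fin k → Pt d // (∀ j ∈ P.image c, ctrDist S (A j) ≤ U * b j) ∧
          (ambiguous P A c S).card ≤ t} → SolCode k t N₀ I (I ⊕ (Fin k × Fin (L + 1))) h,
      ∀ S S', sig S = sig S' → ∀ q,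
        |(ptCost (y q) S.1 - ptCost (A (c (y q))) S.1)
            - (ptCost (y q) S'.1 - ptCost (A (c (y q))) S'.1)|
          ≤ 2 ^ 18 * (1 / 2) ^ h * (‖y q - A (c (y q))‖ ^ 2
            + ‖y q - A (c (y q))‖ * ctrDist S.1 (A (c (y q))) + b (c (y q)) ^ 2) := by
  classical
  set η : ℝ := (1 / 2) ^ h with hη
  have hη0 : 0 < η := by positivity
  have hη1 : η ≤ 1 := pow_le_one₀ (by norm_num) (by norm_num)
  have hn : (1 : ℝ) ≤ (4 ^ h : ℕ) * η ^ 2 := by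
    rw [hη, ← pow_mul, mul_comm h 2, pow_mul]
    push_cast
    rw [← mul_pow]
    norm_num
  obtain ⟨cc, hcc⟩ := exists_centerCode A (fun q => y q - A (c (y q)))
    (scales (fun q => ‖y q - A (c (y q))‖) b L) hη0 hη1 hn
  have henum : ∀ S : {S : Fin k → Pt d // (∀ j ∈ P.image c, ctrDist S (A j) ≤ U * b j) ∧
      (ambiguous P A c S).card ≤ t}, ∃ e : Fin t → Fin k, ∀ j ∈ ambiguous P A c S.1, ∃ x, e x = j :=
    fun S => exists_enum _ S.2.2
  choose en hen using henum
  refine ⟨fun S => (fun i => cc (S.1 i), fun j => near S.1 (A j), en S,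
    fun x i => ⟨min (N₀ * 2 ^ h) ⌊‖S.1 i - A (en S x)‖ ^ 2 / (η * b (en S x) ^ 2)⌋₊,
      Nat.lt_succ_of_le (min_le_left _ _)⟩), fun S S' e q => ?_⟩
  simp only [Prod.mk.injEq] at e
  obtain ⟨e1, e2, e3, e4⟩ := e
  have hj : c (y q) ∈ P.image c := Finset.mem_image_of_mem c (hy q)
  set j := c (y q) with hjdef
  have hbj := hb j
  -- the consequences of equal center codes, in both directions
  have hclose : ∀ T T' : {S : Fin k → Pt d // (∀ j ∈ P.image c, ctrDist S (A j) ≤ U * b j) ∧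
      (ambiguous P A c S).card ≤ t}, (∀ i, cc (T.1 i) = cc (T'.1 i)) →
      ScaleClose η (b j) U (y q) (A j) T.1 T'.1 := by
    intro T T' hT
    refine ⟨fun i hi => ?_, fun i hi => ?_, T.2.1 j hj⟩
    · have h1 := hcc _ _ (hT i) (Sum.inl q) j hi
      exact ⟨h1.1, h1.2 q⟩
    · obtain ⟨κ, hκ1, hκ2⟩ := exists_scale (fun q => ‖y q - A (c (y q))‖) hbj hL hi
      rw [max_eq_left (norm_nonneg _)] at hκ2
      have h1 := hcc _ _ (hT i) κ j hκ1
      have h0 : 0 ≤ scales (fun q => ‖y q - A (c (y q))‖) b L κ := (norm_nonneg _).trans hκ1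
      refine ⟨h1.1.trans ?_, (h1.2 q).trans ?_⟩
      · gcongr
      · exact mul_le_mul_of_nonneg_left hκ2 (by positivity)
  refine abs_excess_sub_le hη0.le hη1 hbj.le hU (hclose S S' (congrFun e1))
    (hclose S' S fun i => (congrFun e1 i).symm) (congrFun e2 j) ?_
  have hN : ∀ T : Fin k → Pt d, ∀ i, ‖T i - A j‖ ≤ 2 * U * b j →
      ‖T i - A j‖ ^ 2 < (N₀ * 2 ^ h : ℕ) * (η * b j ^ 2) := by
    intro T i hi
    have h1 : ‖T i - A j‖ ^ 2 ≤ (2 * U * b j) ^ 2 := by gcongr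
    have h2 : ((N₀ * 2 ^ h : ℕ) : ℝ) * (η * b j ^ 2) = N₀ * b j ^ 2 := by
      push_cast
      rw [hη, show ((N₀ : ℝ) * 2 ^ h) * ((1 / 2) ^ h * b j ^ 2)
        = N₀ * b j ^ 2 * (2 ^ h * (1 / 2) ^ h) by ring, ← mul_pow]
      norm_num
    rw [h2]
    have h3 : 0 < b j ^ 2 := by positivity
    nlinarith
  by_cases hex : ∃ x, en S x = j
  · left
    obtain ⟨x, hx⟩ := hex
    have hx' : en S' x = j := by rw [← e3, hx]
    have hfl : ∀ i, min (N₀ * 2 ^ h) ⌊‖S.1 i - A j‖ ^ 2 / (η * b j ^ 2)⌋₊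
        = min (N₀ * 2 ^ h) ⌊‖S'.1 i - A j‖ ^ 2 / (η * b j ^ 2)⌋₊ := by
      intro i
      have := congrArg Fin.val (congrFun (congrFun e4 x) i)
      simpa only [hx, hx'] using this
    exact ⟨fun i hi => abs_sub_le_of_floor_eq (by positivity) (sq_nonneg _) (sq_nonneg _)
        (hN _ i hi) (hfl i),
      fun i hi => abs_sub_le_of_floor_eq (by positivity) (sq_nonneg _) (sq_nonneg _)
        (hN _ i hi) (hfl i).symm⟩
  · right
    have key : ∀ T : {S : Fin k → Pt d // (∀ j ∈ P.image c, ctrDist S (A j) ≤ U * b j) ∧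
        (ambiguous P A c S).card ≤ t}, en T = en S →
        ∀ i, i ≠ near T.1 (A j) → 4 * ctrDist T.1 (A j) ≤ ‖T.1 i - A j‖ := by
      intro T hT i hi
      by_contra hlt
      push Not at hlt
      obtain ⟨x, hx⟩ := hen T j (Finset.mem_filter.2 ⟨hj, i, hi, hlt⟩)
      exact hex ⟨x, by rw [← hT, hx]⟩
    exact ⟨key S rfl, key S' e3.symm⟩

end Sig

/-! ### Uniform deviations for a fixed pair of samples -/

section Fixed

variable {d k : ℕ}

/-- The number of points of a cluster, or `1` for an empty cluster. -/
noncomputable def clSize (P : Finset (Pt d)) (c : Pt d → Fin k) (j : Fin k) : ℝ :=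
  max 1 (cluster P c j).card

/-- The length unit of a cluster: moving all its points by this length changes the cost by
`Φ / k ^ 2`. -/
noncomputable def unitLen (P : Finset (Pt d)) (c : Pt d → Fin k) (Φ : ℝ) (j : Fin k) : ℝ :=
  Real.sqrt (Φ / clSize P c j) / k

theorem clSize_pos (P : Finset (Pt d)) (c : Pt d → Fin k) (j : Fin k) : 0 < clSize P c j :=
  zero_lt_one.trans_le (le_max_left _ _)

theorem clSize_eq {P : Finset (Pt d)} {c : Pt d → Fin k} {j : Fin k} (hj : j ∈ P.image c) :
    clSize P c j = (cluster P c j).card := by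
  obtain ⟨p, hp, rfl⟩ := Finset.mem_image.1 hj
  refine max_eq_right ?_
  exact Nat.one_le_cast.2 (Finset.card_pos.2 ⟨p, Finset.mem_filter.2 ⟨hp, rfl⟩⟩)

theorem unitLen_pos (P : Finset (Pt d)) (c : Pt d → Fin k) {Φ : ℝ} (hΦ : 0 < Φ) (j : Fin k) :
    0 < unitLen P c Φ j := by
  have hk : (0 : ℝ) < k := by exact_mod_cast j.pos
  have := clSize_pos P c j
  unfold unitLen
  positivity

theorem clSize_mul_unitLen_sq (P : Finset (Pt d)) (c : Pt d → Fin k) {Φ : ℝ} (hΦ : 0 < Φ)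
    (j : Fin k) : clSize P c j * unitLen P c Φ j ^ 2 = Φ / k ^ 2 := by
  have := clSize_pos P c j
  unfold unitLen
  rw [div_pow, Real.sq_sqrt (by positivity)]
  field_simp

theorem sum_cluster_const (P : Finset (Pt d)) (c : Pt d → Fin k) (h : Fin k → ℝ) :
    ∑ j ∈ P.image c, clSize P c j * h j = ∑ p ∈ P, h (c p) := by
  rw [← Finset.sum_fiberwise_of_maps_to (g := c) (fun p hp => Finset.mem_image_of_mem c hp)]
  refine Finset.sum_congr rfl fun j hj => ?_
  rw [clSize_eq hj, ← nsmul_eq_mul, ← Finset.sum_const]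
  refine Finset.sum_congr rfl fun p hp => ?_
  rw [(Finset.mem_filter.1 hp).2]

/-- The properties of a finite family of weighted points of `P` that make chaining work: the
weights of the sensitivity scores, and total weight and cost comparable with those of `P`. -/
structure Balanced {I : Type} [Fintype I] (P : Finset (Pt d)) (A : Fin k → Pt d)
    (c : Pt d → Fin k) (Φ m : ℝ) (y : I → Pt d) (w : Pt d → ℝ) : Prop where
  mem : ∀ i, y i ∈ P
  nonneg : ∀ p ∈ P, 0 ≤ w p
  weight_cost : ∀ p ∈ P, w p * ‖p - A (c p)‖ ^ 2 ≤ 4 * Φ / m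
  weight_size : ∀ p ∈ P, w p ≤ 4 * k * clSize P c (c p) / m
  size : ∀ j, ∑ i, (if c (y i) = j then w (y i) else 0) ≤ 4 * clSize P c j
  total : ∑ i, w (y i) * ‖y i - A (c (y i))‖ ^ 2 ≤ 200 * Φ

variable {P : Finset (Pt d)} {A : Fin k → Pt d} {c : Pt d → Fin k} {Φ m M : ℝ}
  {I : Type} [Fintype I] {y : I → Pt d} {w : Pt d → ℝ}

theorem Balanced.sum_le (hB : Balanced P A c Φ m y w) (h : Fin k → ℝ) (hh : ∀ j, 0 ≤ h j) :
    ∑ i, w (y i) * h (c (y i)) ≤ 4 * ∑ p ∈ P, h (c p) := by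
  rw [← sum_cluster_const, Finset.mul_sum]
  calc ∑ i, w (y i) * h (c (y i))
      = ∑ i, ∑ j ∈ P.image c, (if c (y i) = j then w (y i) else 0) * h j := by
        refine Finset.sum_congr rfl fun i _ => ?_
        rw [Finset.sum_eq_single_of_mem (c (y i)) (Finset.mem_image_of_mem c (hB.mem i))]
        · simp
        · intro j _ hj
          simp [hj.symm]
    _ = ∑ j ∈ P.image c, (∑ i, if c (y i) = j then w (y i) else 0) * h j := by
        rw [Finset.sum_comm]
        exact Finset.sum_congr rfl fun j _ => (Finset.sum_mul _ _ _).symm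
    _ ≤ _ := Finset.sum_le_sum fun j _ => by
        have := mul_le_mul_of_nonneg_right (hB.size j) (hh j)
        linarith

variable [Nonempty (Fin k)]

/-- The scale of the excess cost of a point `p` over the cost of its reference center. -/
noncomputable def envelope (P : Finset (Pt d)) (A : Fin k → Pt d) (c : Pt d → Fin k) (Φ : ℝ)
    (S : Fin k → Pt d) (p : Pt d) : ℝ :=
  ‖p - A (c p)‖ ^ 2 + ‖p - A (c p)‖ * ctrDist S (A (c p)) + unitLen P c Φ (c p) ^ 2

theorem Balanced.sum_weight_le (hB : Balanced P A c Φ m y w) (hΦ : 0 < Φ) (hM : Φ ≤ M)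
    {S : Fin k → Pt d} (hS : ∑ p ∈ P, ctrDist S (A (c p)) ^ 2 ≤ 2 * M) :
    ∑ i, w (y i) * (‖y i - A (c (y i))‖ ^ 2 + ctrDist S (A (c (y i))) ^ 2
      + unitLen P c Φ (c (y i)) ^ 2) ≤ 212 * M := by
  have hk : 1 ≤ k := Fin.pos (Classical.arbitrary (Fin k))
  have hk' : (1 : ℝ) ≤ k := by exact_mod_cast hk
  simp_rw [mul_add]
  rw [Finset.sum_add_distrib, Finset.sum_add_distrib]
  have h1 := hB.total
  have h2 := hB.sum_le (fun j => ctrDist S (A j) ^ 2) fun j => sq_nonneg _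
  have h3 := hB.sum_le (fun j => unitLen P c Φ j ^ 2) fun j => sq_nonneg _
  rw [← sum_cluster_const P c fun j => unitLen P c Φ j ^ 2] at h3
  simp only [clSize_mul_unitLen_sq P c hΦ, Finset.sum_const, nsmul_eq_mul] at h3
  have h4 : ((P.image c).card : ℝ) ≤ k := by
    exact_mod_cast (Finset.card_le_univ (P.image c)).trans_eq (Fintype.card_fin k)
  have h5 : ((P.image c).card : ℝ) * (Φ / k ^ 2) ≤ Φ := by
    calc ((P.image c).card : ℝ) * (Φ / k ^ 2) ≤ k * (Φ / k ^ 2) := by gcongr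
      _ = Φ / k := by field_simp
      _ ≤ Φ := div_le_self hΦ.le hk'
  linarith

theorem Balanced.sum_weight_envelope_le (hB : Balanced P A c Φ m y w) (hΦ : 0 < Φ) (hM : Φ ≤ M)
    {S : Fin k → Pt d} (hS : ∑ p ∈ P, ctrDist S (A (c p)) ^ 2 ≤ 2 * M) :
    ∑ i, w (y i) * envelope P A c Φ S (y i) ≤ 424 * M := by
  have h := hB.sum_weight_le hΦ hM hS
  calc _ ≤ ∑ i, 2 * (w (y i) * (‖y i - A (c (y i))‖ ^ 2 + ctrDist S (A (c (y i))) ^ 2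
      + unitLen P c Φ (c (y i)) ^ 2)) := by
        refine Finset.sum_le_sum fun i _ => ?_
        rw [mul_left_comm]
        refine mul_le_mul_of_nonneg_left ?_ (hB.nonneg _ (hB.mem i))
        unfold envelope
        nlinarith [sq_nonneg (‖y i - A (c (y i))‖ - ctrDist S (A (c (y i)))),
          sq_nonneg (unitLen P c Φ (c (y i))), sq_nonneg (ctrDist S (A (c (y i)))),
          sq_nonneg (‖y i - A (c (y i))‖)]
    _ ≤ _ := by
        rw [← Finset.mul_sum]
        linarith

theorem Balanced.sum_weight_envelope_sq_le (hB : Balanced P A c Φ m y w) (hm : 0 < m)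
    (hΦ : 0 < Φ) (hM : Φ ≤ M) {S : Fin k → Pt d}
    (hS : ∑ p ∈ P, ctrDist S (A (c p)) ^ 2 ≤ 2 * M) :
    ∑ i, (w (y i) * envelope P A c Φ S (y i)) ^ 2 ≤ 2544 * Φ * M / m := by
  have hk : 1 ≤ k := Fin.pos (Classical.arbitrary (Fin k))
  have hk' : (1 : ℝ) ≤ k := by exact_mod_cast hk
  have h := hB.sum_weight_le hΦ hM hS
  calc _ ≤ ∑ i, 12 * Φ / m * (w (y i) * (‖y i - A (c (y i))‖ ^ 2
      + ctrDist S (A (c (y i))) ^ 2 + unitLen P c Φ (c (y i)) ^ 2)) := by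
        refine Finset.sum_le_sum fun i _ => ?_
        have hw := hB.nonneg _ (hB.mem i)
        have h1 := hB.weight_cost _ (hB.mem i)
        have h2 := hB.weight_size _ (hB.mem i)
        have h3 := clSize_mul_unitLen_sq P c hΦ (c (y i))
        unfold envelope
        set ρ := ‖y i - A (c (y i))‖
        set D := ctrDist S (A (c (y i)))
        set b := unitLen P c Φ (c (y i))
        set v := w (y i)
        have h4 : v * b ^ 2 ≤ 4 * Φ / m := by
          calc v * b ^ 2 ≤ 4 * k * clSize P c (c (y i)) / m * b ^ 2 := by gcongr
            _ = 4 * k * (clSize P c (c (y i)) * b ^ 2) / m := by ring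
            _ = 4 * (Φ / k) / m := by rw [h3]; field_simp
            _ ≤ _ := by
              gcongr
              exact div_le_self hΦ.le hk'
        have e1 : (v * (ρ ^ 2 + ρ * D + b ^ 2)) ^ 2
            ≤ 3 * (v * ρ ^ 2 * (v * (ρ ^ 2 + D ^ 2)) + v * b ^ 2 * (v * b ^ 2)) := by
          nlinarith [sq_nonneg (v * (ρ ^ 2 - ρ * D)), sq_nonneg (v * (ρ ^ 2 - b ^ 2)),
            sq_nonneg (v * (ρ * D - b ^ 2))]
        have e2 : v * ρ ^ 2 * (v * (ρ ^ 2 + D ^ 2)) ≤ 4 * Φ / m * (v * (ρ ^ 2 + D ^ 2)) := by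
          gcongr
        have e3 : v * b ^ 2 * (v * b ^ 2) ≤ 4 * Φ / m * (v * b ^ 2) := by
          gcongr
        calc _ ≤ _ := e1
          _ ≤ 3 * (4 * Φ / m * (v * (ρ ^ 2 + D ^ 2)) + 4 * Φ / m * (v * b ^ 2)) := by gcongr
          _ = _ := by ring
    _ ≤ _ := by
        rw [← Finset.mul_sum]
        calc _ ≤ 12 * Φ / m * (212 * M) := by gcongr
          _ = _ := by ring

/-- The excess of the weighted cost of a point over the weighted cost of its reference center. -/
noncomputable def excess (A : Fin k → Pt d) (c : Pt d → Fin k) (w : Pt d → ℝ)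
    (S : Fin k → Pt d) (p : Pt d) : ℝ :=
  w p * (ptCost p S - ptCost (A (c p)) S)

theorem abs_excess_le {p : Pt d} (hw : 0 ≤ w p) (S : Fin k → Pt d) :
    |excess A c w S p| ≤ 2 * (w p * envelope P A c Φ S p) := by
  unfold excess
  rw [abs_mul, abs_of_nonneg hw]
  have h1 := abs_ptCost_sub_le S p (A (c p))
  have h2 : |ptCost p S - ptCost (A (c p)) S| ≤ 2 * envelope P A c Φ S p := by
    refine h1.trans ?_
    unfold envelope
    nlinarith [sq_nonneg (unitLen P c Φ (c p)), sq_nonneg (‖p - A (c p)‖)]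
  have := mul_le_mul_of_nonneg_left h2 hw
  linarith

end Fixed

/-- For a fixed balanced pair of samples, the signed excess costs of all solutions of cost about
`M` with few ambiguous clusters are small for most choices of signs. -/
theorem Balanced.wProb_signed_excess_le {d k : ℕ} [Nonempty (Fin k)] {P : Finset (Pt d)}
    {A : Fin k → Pt d} {c : Pt d → Fin k} {Φ M : ℝ} {m : ℕ} (hm : 0 < m) {w : Pt d → ℝ}
    (q q' : Fin m → Pt d) (hB : Balanced P A c Φ m (Sum.elim q q') w) (hΦ : 0 < Φ)
    (hM : Φ ≤ M) {t L N₀ H Q : ℕ} {U η Λ : ℝ} (hU : 0 ≤ U)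
    (hUM : k ^ 2 * (2 * M) ≤ U ^ 2 * Φ) (hL : 4 * U ≤ 2 ^ L)
    (hN₀ : 4 * U ^ 2 + 1 ≤ N₀) (hη : 0 < η) (hH : 2 ^ 30 ≤ η * 2 ^ H)
    (hQ1 : 2 * m + k * (L + 1) + 1 ≤ Q) (hQ2 : 2 * (2 * m + k) + 1 ≤ Q) (hQ3 : 4 ^ H + 1 ≤ Q)
    (hQ4 : N₀ * 2 ^ H + 1 ≤ Q) (hΛ0 : 0 ≤ Λ)
    (hΛ : 2 * ((5 * k + 2 * k * t) * Real.log Q) + Λ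
      ≤ (η * M / (8 * (H + 1))) ^ 2 / (20 * (2 ^ 49 * Φ * M / m))) :
    wProb (pw fun _ : Bool => (1 / 2 : ℝ)) {σ : Fin m → Bool | ∃ S : Fin k → Pt d,
      (∑ p ∈ P, ctrDist S (A (c p)) ^ 2 ≤ 2 * M ∧ (ambiguous P A c S).card ≤ t) ∧
        η * M / 4 < |∑ i, sgn (σ i) * (excess A c w S (q i) - excess A c w S (q' i))|}
      ≤ 2 * (H + 1) * Real.exp (-Λ) := by
  classical
  have hk : 1 ≤ k := Fin.pos (Classical.arbitrary (Fin k))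
  have hM0 : 0 < M := hΦ.trans_le hM
  have hm' : (0 : ℝ) < m := by exact_mod_cast hm
  -- the cost bounds the distance of `S` to each nonempty cluster in terms of its length unit
  have hUb : ∀ S : Fin k → Pt d, ∑ p ∈ P, ctrDist S (A (c p)) ^ 2 ≤ 2 * M →
      ∀ j ∈ P.image c, ctrDist S (A j) ≤ U * unitLen P c Φ j := by
    intro S hS j hj
    have hb := unitLen_pos P c hΦ j
    have hk' : (0 : ℝ) < k := by exact_mod_cast hk
    have hn := clSize_pos P c j
    have h1 : clSize P c j * ctrDist S (A j) ^ 2 ≤ 2 * M := by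
      rw [← sum_cluster_const P c fun j => ctrDist S (A j) ^ 2] at hS
      exact (Finset.single_le_sum (f := fun j => clSize P c j * ctrDist S (A j) ^ 2)
        (fun j _ => mul_nonneg (clSize_pos P c j).le (sq_nonneg _)) hj).trans hS
    have h2 := clSize_mul_unitLen_sq P c hΦ j
    refine abs_le_of_sq_le_sq' ?_ (by positivity) |>.2
    rw [← mul_le_mul_iff_right₀ hn]
    calc clSize P c j * ctrDist S (A j) ^ 2 ≤ 2 * M := h1
      _ ≤ U ^ 2 * (Φ / k ^ 2) := by
        rw [mul_div_assoc', le_div_iff₀ (by positivity)]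
        linarith
      _ = _ := by rw [← h2]; ring
  let K : Type := (Fin m ⊕ Fin m) ⊕ (Fin k × Fin (L + 1))
  have hsig := fun h => exists_solCode (P := P) A c (Sum.elim q q') hB.mem
    (unitLen_pos P c hΦ) hU hL hN₀ (t := t) h
  choose sig hsig using hsig
  let 𝒮 : Type := {S : Fin k → Pt d // ∑ p ∈ P, ctrDist S (A (c p)) ^ 2 ≤ 2 * M ∧
    (ambiguous P A c S).card ≤ t}
  let ι : 𝒮 → {S : Fin k → Pt d // (∀ j ∈ P.image c, ctrDist S (A j) ≤ U * unitLen P c Φ j) ∧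
    (ambiguous P A c S).card ≤ t} := fun S => ⟨S.1, hUb S.1 S.2.1, S.2.2⟩
  let F : 𝒮 → Fin m → ℝ := fun S i => excess A c w S.1 (q i) - excess A c w S.1 (q' i)
  have henv2 : ∀ S : 𝒮, ∑ i, (w (q i) * envelope P A c Φ S.1 (q i)) ^ 2
      + ∑ i, (w (q' i) * envelope P A c Φ S.1 (q' i)) ^ 2 ≤ 2544 * Φ * M / m := by
    intro S
    have h := hB.sum_weight_envelope_sq_le hm' hΦ hM S.2.1
    rwa [Fintype.sum_sum_type] at h
  have henv1 : ∀ S : 𝒮, ∑ i, w (q i) * envelope P A c Φ S.1 (q i)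
      + ∑ i, w (q' i) * envelope P A c Φ S.1 (q' i) ≤ 424 * M := by
    intro S
    have h := hB.sum_weight_envelope_le hΦ hM S.2.1
    rwa [Fintype.sum_sum_type] at h
  have hmq : ∀ i, q i ∈ P := fun i => hB.mem (Sum.inl i)
  have hmq' : ∀ i, q' i ∈ P := fun i => hB.mem (Sum.inr i)
  -- a pointwise bound by the envelope gives bounds of sums of squares
  have hsq : ∀ (S : 𝒮) (x x' : Fin m → ℝ) (B : ℝ), 0 ≤ B →
      (∀ i, |x i| ≤ B * (w (q i) * envelope P A c Φ S.1 (q i))) →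
      (∀ i, |x' i| ≤ B * (w (q' i) * envelope P A c Φ S.1 (q' i))) →
      ∑ i, (x i - x' i) ^ 2 ≤ 2 * B ^ 2 * (2544 * Φ * M / m) := by
    intro S x x' B hB0 hx hx'
    calc ∑ i, (x i - x' i) ^ 2
        ≤ ∑ i, (2 * B ^ 2 * (w (q i) * envelope P A c Φ S.1 (q i)) ^ 2
          + 2 * B ^ 2 * (w (q' i) * envelope P A c Φ S.1 (q' i)) ^ 2) := by
          refine Finset.sum_le_sum fun i _ => ?_
          have h1 := pow_le_pow_left₀ (abs_nonneg _) (hx i) 2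
          have h2 := pow_le_pow_left₀ (abs_nonneg _) (hx' i) 2
          rw [sq_abs, mul_pow] at h1 h2
          nlinarith [sq_nonneg (x i + x' i)]
      _ ≤ _ := by
          rw [Finset.sum_add_distrib, ← Finset.mul_sum, ← Finset.mul_sum, ← mul_add]
          exact mul_le_mul_of_nonneg_left (henv2 S) (by positivity)
  have hdiff : ∀ h (S S' : 𝒮), sig h (ι S) = sig h (ι S') → ∀ p, ∀ i : Fin m ⊕ Fin m,
      p = Sum.elim q q' i → |excess A c w S.1 p - excess A c w S'.1 p|
        ≤ 2 ^ 18 * (1 / 2) ^ h * (w p * envelope P A c Φ S.1 p) := by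
    rintro h S S' e p i rfl
    have h1 := hsig h (ι S) (ι S') e i
    have hw := hB.nonneg _ (hB.mem i)
    unfold excess
    rw [← mul_sub, abs_mul, abs_of_nonneg hw, mul_left_comm]
    exact mul_le_mul_of_nonneg_left h1 hw
  have hQpos : 1 ≤ Q := by omega
  have hv : (0 : ℝ) < 2 ^ 49 * Φ * M / m := by positivity
  have main := wProb_chaining_le F H (fun h => SolCode k t N₀ (Fin m ⊕ Fin m) K h)
    (fun h S => sig h (ι S)) (v := 2 ^ 49 * Φ * M / m) (u := 2 ^ 27 * (1 / 2) ^ H * M)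
    (θ := (5 * k + 2 * k * t) * Real.log Q) (t := η * M / (8 * (H + 1))) (Λ := Λ) hv
    (by positivity) (by have := Real.log_natCast_nonneg Q; positivity)
    (by
      intro h hh
      have h1 := card_solCode_le (k := k) (t := t) (N₀ := N₀) (h := h) (Q := Q)
        (I := Fin m ⊕ Fin m) (K := K) hk (by omega)
        (by
          simp only [K, Fintype.card_sum, Fintype.card_prod, Fintype.card_fin]
          omega)
        (by
          simp only [Fintype.card_sum, Fintype.card_fin]
          omega)
        ((Nat.succ_le_succ (Nat.pow_le_pow_right (by norm_num) hh)).trans hQ3)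
        ((Nat.succ_le_succ (Nat.mul_le_mul_left _ (Nat.pow_le_pow_right (by norm_num) hh))).trans
          hQ4)
      calc (Fintype.card (SolCode k t N₀ (Fin m ⊕ Fin m) K h) : ℝ)
          ≤ (Q : ℝ) ^ ((5 * k + 2 * k * t) * 4 ^ h) := by exact_mod_cast h1
        _ = Real.exp (Real.log Q) ^ ((5 * k + 2 * k * t) * 4 ^ h) := by
          rw [Real.exp_log (by exact_mod_cast hQpos)]
        _ = _ := by
          rw [← Real.exp_nat_mul]
          congr 1
          push_cast
          ring)
    (by
      intro S
      refine (hsq S (fun i => excess A c w S.1 (q i)) (fun i => excess A c w S.1 (q' i)) 2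
        (by norm_num) (fun i => abs_excess_le (hB.nonneg _ (hmq i)) S.1)
        (fun i => abs_excess_le (hB.nonneg _ (hmq' i)) S.1)).trans ?_
      rw [mul_div_assoc', mul_assoc (2 ^ 49), mul_assoc 2544, ← mul_assoc (2 * 2 ^ 2)]
      gcongr
      norm_num)
    (by
      intro h _ S S' e
      have h1 := hsq S (fun i => excess A c w S.1 (q i) - excess A c w S'.1 (q i))
        (fun i => excess A c w S.1 (q' i) - excess A c w S'.1 (q' i)) (2 ^ 18 * (1 / 2) ^ h)
        (by positivity) (fun i => hdiff h S S' e _ (Sum.inl i) rfl)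
        (fun i => hdiff h S S' e _ (Sum.inr i) rfl)
      calc _ = ∑ i, ((excess A c w S.1 (q i) - excess A c w S'.1 (q i))
            - (excess A c w S.1 (q' i) - excess A c w S'.1 (q' i))) ^ 2 :=
            Finset.sum_congr rfl fun i _ => by simp only [F]; ring
        _ ≤ _ := h1
        _ = 2 ^ 37 * 2544 * (Φ * M / m) * (((1 / 2) ^ h) ^ 2) := by ring
        _ = 2 ^ 37 * 2544 * (Φ * M / m) / 4 ^ h := by
          rw [← pow_mul, mul_comm h 2, pow_mul, div_eq_mul_inv _ ((4 : ℝ) ^ h), ← inv_pow]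
          norm_num
        _ ≤ 2 ^ 49 * (Φ * M / m) / 4 ^ h := by
          gcongr
          norm_num
        _ = _ := by ring)
    (by
      intro S S' e
      calc ∑ i, |F S i - F S' i|
          ≤ ∑ i, (2 ^ 18 * (1 / 2) ^ H * (w (q i) * envelope P A c Φ S.1 (q i))
            + 2 ^ 18 * (1 / 2) ^ H * (w (q' i) * envelope P A c Φ S.1 (q' i))) := by
            refine Finset.sum_le_sum fun i _ => ?_
            have h1 := hdiff H S S' e _ (Sum.inl i) rfl
            have h2 := hdiff H S S' e _ (Sum.inr i) rfl
            simp only [Sum.elim_inl, Sum.elim_inr] at h1 h2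
            have h3 : F S i - F S' i = (excess A c w S.1 (q i) - excess A c w S'.1 (q i))
                - (excess A c w S.1 (q' i) - excess A c w S'.1 (q' i)) := by
              simp only [F]; ring
            rw [h3]
            exact (abs_sub _ _).trans (add_le_add h1 h2)
        _ ≤ 2 ^ 18 * (1 / 2) ^ H * (424 * M) := by
            rw [Finset.sum_add_distrib, ← Finset.mul_sum, ← Finset.mul_sum, ← mul_add]
            exact mul_le_mul_of_nonneg_left (henv1 S) (by positivity)
        _ ≤ _ := by
            have : (0 : ℝ) ≤ (1 / 2) ^ H * M := by positivity
            nlinarith)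
    hΛ hΛ0
  refine (wProb_mono (fun σ => pw_nonneg (fun _ => by norm_num) σ) ?_).trans main
  rintro σ ⟨S, hS, hσ⟩
  refine ⟨⟨S, hS⟩, lt_of_le_of_lt ?_ hσ⟩
  have h1 : ((H : ℝ) + 1) * (η * M / (8 * (H + 1))) = η * M / 8 := by field_simp
  have h2 : (2 : ℝ) ^ 27 * (1 / 2) ^ H * M ≤ η * M / 8 := by
    have h3 : (1 / 2 : ℝ) ^ H * 2 ^ H = 1 := by rw [← mul_pow]; norm_num
    have h4 : (0 : ℝ) ≤ (1 / 2) ^ H := by positivity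
    have h5 := mul_le_mul_of_nonneg_left hH h4
    have h6 : (1 / 2 : ℝ) ^ H * (η * 2 ^ H) = η := by rw [mul_left_comm, h3, mul_one]
    rw [h6] at h5
    nlinarith
  rw [h1]
  linarith

/-! ### Sensitivity Sampling -/

section Sampling

variable {d k : ℕ} {P : Finset (Pt d)} {A : Fin k → Pt d} {c : Pt d → Fin k}

/-- The law of the sample as a product of weights. -/
theorem sampleLaw_apply (hP : P.Nonempty) (m : ℕ) (s : Set (Fin m → P)) :
    sampleLaw P hP A c m s = ENNReal.ofReal (wProb (pw fun p : P => prob P A c p) s) := by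
  classical
  have hpos : ∀ p : P, 0 ≤ prob P A c p := fun p => prob_nonneg P A c p.2
  have h1 : ∀ q : Fin m → P, sampleLaw P hP A c m {q}
      = ENNReal.ofReal (pw (fun p : P => prob P A c p) q) := by
    intro q
    unfold sampleLaw pw
    rw [MeasureTheory.Measure.pi_singleton, ENNReal.ofReal_prod_of_nonneg fun i _ => hpos _]
    refine Finset.prod_congr rfl fun i _ => ?_
    rw [PMF.toMeasure_apply_singleton _ _ (measurableSet_singleton _)]
    rfl
  have h2 : s = ((Finset.univ.filter fun q => q ∈ s : Finset (Fin m → P)) : Set (Fin m → P)) := by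
    ext q; simp
  conv_lhs => rw [h2]
  rw [← MeasureTheory.sum_measure_singleton]
  simp_rw [h1]
  rw [← ENNReal.ofReal_sum_of_nonneg fun q _ => pw_nonneg hpos q]
  congr 1
  unfold wProb
  rw [Finset.sum_filter]
  refine Finset.sum_congr rfl fun q _ => ?_
  by_cases hq : q ∈ s <;> simp [hq]

theorem ptCost_eq_of_isNearest (hc : IsNearest P A c) {p : Pt d} (hp : p ∈ P) :
    ptCost p A = ‖p - A (c p)‖ ^ 2 := by
  have : Nonempty (Fin k) := ⟨c p⟩
  exact le_antisymm (ptCost_le p A _) (le_ciInf fun i =>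
    pow_le_pow_left₀ (norm_nonneg _) (hc p hp i) 2)

/-- The scores add up to at most `1`, whether or not there are empty or costless clusters. -/
theorem sum_score_le (hk : 1 ≤ k) : ∑ p ∈ P, score P A c p ≤ 1 := by
  have hk' : (0 : ℝ) < k := by exact_mod_cast hk
  have hP0 := cost_nonneg P A
  have fib : ∀ f : Pt d → ℝ, ∑ p ∈ P, f p = ∑ j, ∑ p ∈ cluster P c j, f p := fun f =>
    (Finset.sum_fiberwise P c f).symm
  have hP : cost P A = ∑ j, cost (cluster P c j) A := fib _
  have key : ∀ j, ∑ p ∈ cluster P c j, score P A c p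
      ≤ 1 / 4 * (2 / k + 2 * (cost (cluster P c j) A / cost P A)) := by
    intro j
    have e : ∀ p ∈ cluster P c j, score P A c p
        = 1 / 4 * (1 / (k * (cluster P c j).card) + ptCost p A / (k * cost (cluster P c j) A)
          + ptCost p A / cost P A
          + cost (cluster P c j) A / (cluster P c j).card / cost P A) := by
      intro p hp
      have : c p = j := (Finset.mem_filter.1 hp).2
      simp [score, avgCost, this]
    rw [Finset.sum_congr rfl e, ← Finset.mul_sum]
    simp only [Finset.sum_add_distrib, ← Finset.sum_div, Finset.sum_const, nsmul_eq_mul]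
    have h0 : ∑ p ∈ cluster P c j, ptCost p A = cost (cluster P c j) A := rfl
    have hj0 := cost_nonneg (cluster P c j) A
    rw [h0]
    have h1 : ((cluster P c j).card : ℝ) * 1 / (k * (cluster P c j).card) ≤ 1 / k := by
      rcases eq_or_ne ((cluster P c j).card : ℝ) 0 with h | h
      · rw [h, zero_mul, zero_div]; positivity
      · exact le_of_eq (by field_simp)
    have h2 : cost (cluster P c j) A / (k * cost (cluster P c j) A) ≤ 1 / k := by
      rcases eq_or_ne (cost (cluster P c j) A) 0 with h | h
      · rw [h, zero_div]; positivity
      · exact le_of_eq (by field_simp)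
    have h3 : ((cluster P c j).card : ℝ)
        * cost (cluster P c j) A / (cluster P c j).card / cost P A
        ≤ cost (cluster P c j) A / cost P A := by
      rcases eq_or_ne ((cluster P c j).card : ℝ) 0 with h | h
      · rw [h, zero_mul, zero_div, zero_div]; positivity
      · exact le_of_eq (by field_simp)
    have h4 : (2 : ℝ) / k = 1 / k + 1 / k := by ring
    rw [h4]
    linarith
  rw [fib]
  refine (Finset.sum_le_sum fun j _ => key j).trans ?_
  rw [← Finset.mul_sum, Finset.sum_add_distrib, ← Finset.mul_sum,
    ← Finset.sum_div Finset.univ (fun j => cost (cluster P c j) A), ← hP,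
    Finset.sum_const, Finset.card_univ, Fintype.card_fin, nsmul_eq_mul]
  have h5 : cost P A / cost P A ≤ 1 := div_self_le_one _
  have h6 : (k : ℝ) * (2 / k) = 2 := by field_simp
  rw [h6]
  linarith

theorem score_le_prob (hk : 1 ≤ k) {p : Pt d} (hp : p ∈ P) : score P A c p ≤ prob P A c p := by
  have h1 := score_pos P A c hp
  have h2 : 0 < ∑ p' ∈ P, score P A c p' :=
    Finset.sum_pos (fun _ h => score_pos P A c h) ⟨p, hp⟩
  unfold prob
  rw [le_div_iff₀ h2]
  exact mul_le_of_le_one_right h1.le (sum_score_le hk)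

theorem prob_pos (hk : 1 ≤ k) {p : Pt d} (hp : p ∈ P) : 0 < prob P A c p :=
  (score_pos P A c hp).trans_le (score_le_prob hk hp)

theorem prob_ge_size (hk : 1 ≤ k) {p : Pt d} (hp : p ∈ P) :
    1 / (4 * k * clSize P c (c p)) ≤ prob P A c p := by
  refine le_trans ?_ (score_le_prob hk hp)
  have h1 := ptCost_nonneg p A
  have h2 := cost_nonneg P A
  have h3 := cost_nonneg (cluster P c (c p)) A
  rw [clSize_eq (Finset.mem_image_of_mem c hp)]
  have h4 : 0 ≤ ptCost p A / (k * cost (cluster P c (c p)) A) + ptCost p A / cost P A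
    + avgCost P A c p / cost P A := by
    unfold avgCost
    positivity
  have h5 : (1 : ℝ) / (4 * k * (cluster P c (c p)).card)
      = 1 / 4 * (1 / (k * (cluster P c (c p)).card)) := by
    rw [mul_assoc, ← div_div]; ring
  rw [h5]
  unfold score
  linarith

theorem prob_ge_cost (hk : 1 ≤ k) {p : Pt d} (hp : p ∈ P) :
    ptCost p A / (4 * cost P A) ≤ prob P A c p := by
  refine le_trans ?_ (score_le_prob hk hp)
  have h1 := ptCost_nonneg p A
  have h2 := cost_nonneg P A
  have h3 := cost_nonneg (cluster P c (c p)) A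
  have h4 : 0 ≤ 1 / (k * ((cluster P c (c p)).card : ℝ))
    + ptCost p A / (k * cost (cluster P c (c p)) A) + avgCost P A c p / cost P A := by
    unfold avgCost
    positivity
  have h5 : ptCost p A / (4 * cost P A) = 1 / 4 * (ptCost p A / cost P A) := by
    rw [mul_comm, ← div_div]; ring
  rw [h5]
  unfold score
  linarith

theorem weight_nonneg (m : ℕ) {p : Pt d} (hp : p ∈ P) : 0 ≤ weight P A c m p := by
  have := prob_nonneg P A c hp
  unfold weight
  positivity

theorem prob_mul_weight (hk : 1 ≤ k) {m : ℕ} (hm : 0 < m) {p : Pt d} (hp : p ∈ P) :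
    m * (prob P A c p * weight P A c m p) = 1 := by
  have h1 := prob_pos (A := A) (c := c) hk hp
  have h2 : (0 : ℝ) < m := by exact_mod_cast hm
  unfold weight
  field_simp

/-- Weighting by the inverse probabilities makes the estimator unbiased. -/
theorem sum_prob_mul_weight_mul (hk : 1 ≤ k) {m : ℕ} (hm : 0 < m) (f : Pt d → ℝ) :
    m * ∑ p : P, prob P A c p * (weight P A c m p * f p) = ∑ p ∈ P, f p := by
  rw [Finset.mul_sum, ← Finset.sum_coe_sort P]
  refine Finset.sum_congr rfl fun p _ => ?_
  have := prob_mul_weight (A := A) (c := c) hk hm p.2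
  calc (m : ℝ) * (prob P A c p * (weight P A c m p * f p))
      = m * (prob P A c p * weight P A c m p) * f p := by ring
    _ = f p := by rw [this, one_mul]

theorem weight_le_size (hk : 1 ≤ k) {m : ℕ} (hm : 0 < m) {p : Pt d} (hp : p ∈ P) :
    weight P A c m p ≤ 4 * k * clSize P c (c p) / m := by
  have h1 := prob_pos (A := A) (c := c) hk hp
  have h2 : (0 : ℝ) < m := by exact_mod_cast hm
  have h3 : (0 : ℝ) < k := by exact_mod_cast hk
  have h4 := prob_ge_size (A := A) (c := c) hk hp
  have h5 := clSize_pos P c (c p)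
  rw [div_le_iff₀ (by positivity)] at h4
  unfold weight
  rw [div_le_div_iff₀ (by positivity) h2]
  nlinarith

theorem weight_mul_cost_le (hk : 1 ≤ k) (hc : IsNearest P A c) {m : ℕ} (hm : 0 < m) {p : Pt d}
    (hp : p ∈ P) : weight P A c m p * ‖p - A (c p)‖ ^ 2 ≤ 4 * cost P A / m := by
  have h1 := prob_pos (A := A) (c := c) hk hp
  have h2 : (0 : ℝ) < m := by exact_mod_cast hm
  have h4 := prob_ge_cost (A := A) (c := c) hk hp
  rw [← ptCost_eq_of_isNearest hc hp]
  have hle : ptCost p A ≤ cost P A :=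
    Finset.single_le_sum (f := fun p => ptCost p A) (fun p _ => ptCost_nonneg p A) hp
  have h0 := ptCost_nonneg p A
  rcases (cost_nonneg P A).eq_or_lt with h | h
  · have : ptCost p A = 0 := le_antisymm (hle.trans h.symm.le) h0
    rw [this, ← h]; simp
  · rw [div_le_iff₀ (by positivity)] at h4
    unfold weight
    rw [div_mul_eq_mul_div, one_mul, div_le_div_iff₀ (by positivity) h2]
    nlinarith

/-- The samples that estimate the size of every cluster up to a factor `1 ± η` and do not
overestimate the cost of `A` grossly. -/
def goodSamples (P : Finset (Pt d)) (A : Fin k → Pt d) (c : Pt d → Fin k) (m : ℕ) (η : ℝ) :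
    Set (Fin m → P) :=
  {q | (∀ j ∈ P.image c, |∑ i, (if c (q i) = j then weight P A c m (q i) else 0) - clSize P c j|
      ≤ η * clSize P c j) ∧
    ∑ i, weight P A c m (q i) * ‖(q i : Pt d) - A (c (q i))‖ ^ 2 ≤ 100 * cost P A}

/-- Chernoff bounds for the cluster sizes, and Markov's inequality for the cost of `A`. -/
theorem wProb_not_goodSamples_le (hk : 1 ≤ k) (hP : P.Nonempty) (hc : IsNearest P A c) {m : ℕ}
    (hm : 0 < m) {η : ℝ} (hη : 0 < η) (hη2 : η ≤ 2) :
    wProb (pw fun p : P => prob P A c p) (goodSamples P A c m η)ᶜ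
      ≤ 1 / 100 + 2 * k * Real.exp (-(η ^ 2 * m / (16 * k))) := by
  classical
  have hm' : (0 : ℝ) < m := by exact_mod_cast hm
  have hk' : (0 : ℝ) < k := by exact_mod_cast hk
  have hpos : ∀ p : P, 0 ≤ prob P A c p := fun p => prob_nonneg P A c p.2
  have hsum : ∑ p : P, prob P A c p = 1 := by
    rw [Finset.sum_coe_sort P fun p => prob P A c p]; exact sum_prob P A c hP
  let Bad : P.image c → Set (Fin m → P) := fun j => {q | η ≤ |∑ i, (fun x : P =>
    (if c x = j then weight P A c m x else 0) / clSize P c j) (q i) - 1|}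
  let Bad' : Set (Fin m → P) := {q | 100 * cost P A <
    ∑ i, weight P A c m (q i) * ‖(q i : Pt d) - A (c (q i))‖ ^ 2}
  have hsub : (goodSamples P A c m η)ᶜ ⊆ Bad' ∪ ⋃ j, Bad j := by
    intro q hq
    by_contra hn
    simp only [Set.mem_union, Set.mem_iUnion, not_or, not_exists] at hn
    obtain ⟨hn1, hn2⟩ := hn
    refine hq ⟨fun j hj => ?_, not_lt.1 hn1⟩
    have h1 := hn2 ⟨j, hj⟩
    simp only [Bad, Set.mem_ofPred_eq, not_le] at h1
    have h2 := clSize_pos P c j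
    rw [← Finset.sum_div, div_sub_one h2.ne', abs_div, abs_of_pos h2, div_lt_iff₀ h2] at h1
    exact h1.le
  have hBad : ∀ j, wProb (pw fun p : P => prob P A c p) (Bad j)
      ≤ 2 * Real.exp (-(η ^ 2 * m / (16 * k))) := by
    rintro ⟨j, hj⟩
    have hn := clSize_pos P c j
    have h1 := wProb_abs_sub_one_ge_le (m := m) hpos hsum (b := 4 * k / m) (e := η)
      (Y := fun x : P => (if c x = j then weight P A c m x else 0) / clSize P c j)
      (by positivity) hη hη2
      (fun x => div_nonneg (by split_ifs; exacts [weight_nonneg m x.2, le_rfl]) hn.le)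
      (fun x => by
        rw [div_le_iff₀ hn]
        split_ifs with hx
        · have := weight_le_size (A := A) (c := c) hk hm x.2
          rw [hx] at this
          exact this.trans_eq (by ring)
        · positivity)
      (by
        have h2 := sum_prob_mul_weight_mul (P := P) (A := A) (c := c) hk hm
          fun x => (if c x = j then 1 else 0) / clSize P c j
        have h3 : ∑ p ∈ P, ((if c p = j then 1 else 0) / clSize P c j : ℝ) = 1 := by
          rw [← Finset.sum_div, Finset.sum_boole, div_eq_one_iff_eq hn.ne', clSize_eq hj]
          rfl
        rw [h3] at h2
        rw [← h2]
        congr 1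
        refine Finset.sum_congr rfl fun x _ => ?_
        split_ifs <;> ring)
    have h4 : η ^ 2 / (4 * (4 * k / m)) = η ^ 2 * m / (16 * k) := by
      field_simp; ring
    rw [h4] at h1
    exact h1
  have hBad' : wProb (pw fun p : P => prob P A c p) Bad' ≤ 1 / 100 := by
    have hE : ∑ q : Fin m → P, pw (fun p : P => prob P A c p) q *
        ∑ i, weight P A c m (q i) * ‖(q i : Pt d) - A (c (q i))‖ ^ 2 = cost P A := by
      rw [sum_pw_mul_sum hsum fun x : P => weight P A c m x * ‖(x : Pt d) - A (c x)‖ ^ 2,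
        sum_prob_mul_weight_mul hk hm fun x => ‖x - A (c x)‖ ^ 2]
      exact Finset.sum_congr rfl fun p hp => (ptCost_eq_of_isNearest hc hp).symm
    have hF : ∀ q : Fin m → P,
        0 ≤ ∑ i, weight P A c m (q i) * ‖(q i : Pt d) - A (c (q i))‖ ^ 2 := fun q =>
      Finset.sum_nonneg fun i _ => mul_nonneg (weight_nonneg m (q i).2) (sq_nonneg _)
    rcases (cost_nonneg P A).eq_or_lt with h | h
    · have hempty : Bad' = ∅ := by
        rw [Set.eq_empty_iff_forall_notMem]
        intro q hq
        have hq' : 100 * cost P A < ∑ i, weight P A c m (q i) * ‖(q i : Pt d) - A (c (q i))‖ ^ 2 :=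
          hq
        have h0 : ∀ p ∈ P, ‖p - A (c p)‖ ^ 2 = 0 := by
          intro p hp
          rw [← ptCost_eq_of_isNearest hc hp]
          exact (Finset.sum_eq_zero_iff_of_nonneg fun p _ => ptCost_nonneg p A).1 h.symm p hp
        rw [Finset.sum_eq_zero fun i _ => by rw [h0 _ (q i).2, mul_zero], ← h] at hq'
        simp at hq'
      rw [hempty]
      unfold wProb
      simp
    · have h1 := mul_wProb_le (w := pw fun p : P => prob P A c p)
        (fun q : Fin m → P => pw_nonneg hpos q) hF (100 * cost P A)
      rw [hE] at h1
      have h2 : Bad' ⊆ {q | 100 * cost P A ≤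
          ∑ i, weight P A c m (q i) * ‖(q i : Pt d) - A (c (q i))‖ ^ 2} := by
        intro q hq
        have hq' : 100 * cost P A < ∑ i, weight P A c m (q i) * ‖(q i : Pt d) - A (c (q i))‖ ^ 2 :=
          hq
        exact hq'.le
      have h3 := wProb_mono (w := pw fun p : P => prob P A c p)
        (fun q : Fin m → P => pw_nonneg hpos q) h2
      nlinarith
  refine (wProb_mono (fun q => pw_nonneg hpos q) hsub).trans
    ((wProb_union_le (fun q => pw_nonneg hpos q) _ _).trans (add_le_add hBad' ?_))
  refine (wProb_iUnion_le (fun q => pw_nonneg hpos q) _).trans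
    ((Finset.sum_le_sum fun j _ => hBad j).trans ?_)
  rw [Finset.sum_const, nsmul_eq_mul, Finset.card_univ]
  have h4 : (Fintype.card (P.image c) : ℝ) ≤ k := by
    rw [Fintype.card_coe]
    exact_mod_cast (Finset.card_le_univ (P.image c)).trans_eq (Fintype.card_fin k)
  rw [mul_assoc, mul_left_comm]
  have h5 : 0 < Real.exp (-(η ^ 2 * m / (16 * k))) := Real.exp_pos _
  nlinarith

end Sampling

/-! ### From excess costs to coresets -/

section Core

variable {d k : ℕ} [Nonempty (Fin k)] {P : Finset (Pt d)} {A : Fin k → Pt d} {c : Pt d → Fin k}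
  {m : ℕ} {η : ℝ}

/-- The common scale of the costs of `A` and `S`. -/
noncomputable def totalCost (P : Finset (Pt d)) (A S : Fin k → Pt d) : ℝ := cost P A + cost P S

omit [Nonempty (Fin k)] in
theorem cost_eq_sum (hc : IsNearest P A c) : cost P A = ∑ p ∈ P, ‖p - A (c p)‖ ^ 2 :=
  Finset.sum_congr rfl fun _ hp => ptCost_eq_of_isNearest hc hp

theorem sum_ctrDist_sq_le (hc : IsNearest P A c) (S : Fin k → Pt d) :
    ∑ p ∈ P, ctrDist S (A (c p)) ^ 2 ≤ 2 * totalCost P A S := by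
  unfold totalCost
  rw [cost_eq_sum hc, cost, ← Finset.sum_add_distrib, Finset.mul_sum]
  refine Finset.sum_le_sum fun p _ => ?_
  have h1 := ctrDist_le_add S (A (c p)) p
  have h2 := ctrDist_nonneg S (A (c p))
  rw [norm_sub_rev] at h1
  rw [ptCost_eq]
  nlinarith [sq_nonneg (‖p - A (c p)‖ - ctrDist S p)]

omit [Nonempty (Fin k)] in
theorem abs_sum_sub_le_of_good {q : Fin m → P} (hq : q ∈ goodSamples P A c m η) (h : Fin k → ℝ)
    (hh : ∀ j, 0 ≤ h j) :
    |∑ i, weight P A c m (q i) * h (c (q i)) - ∑ p ∈ P, h (c p)| ≤ η * ∑ p ∈ P, h (c p) := by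
  have h1 : ∑ i, weight P A c m (q i) * h (c (q i))
      = ∑ j ∈ P.image c, (∑ i, if c (q i) = j then weight P A c m (q i) else 0) * h j := by
    calc _ = ∑ i, ∑ j ∈ P.image c, (if c (q i) = j then weight P A c m (q i) else 0) * h j := by
          refine Finset.sum_congr rfl fun i _ => ?_
          rw [Finset.sum_eq_single_of_mem (c (q i)) (Finset.mem_image_of_mem c (q i).2)]
          · simp
          · intro j _ hj
            simp [hj.symm]
      _ = _ := by
          rw [Finset.sum_comm]
          exact Finset.sum_congr rfl fun j _ => (Finset.sum_mul _ _ _).symm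
  rw [h1, ← sum_cluster_const, ← Finset.sum_sub_distrib, Finset.mul_sum]
  refine (Finset.abs_sum_le_sum_abs _ _).trans (Finset.sum_le_sum fun j hj => ?_)
  rw [← sub_mul, abs_mul, abs_of_nonneg (hh j), ← mul_assoc]
  exact mul_le_mul_of_nonneg_right (hq.1 j hj) (hh j)

/-- The sum of the excess costs of all points of `P`. -/
noncomputable def totalExcess (P : Finset (Pt d)) (A : Fin k → Pt d) (c : Pt d → Fin k)
    (S : Fin k → Pt d) : ℝ :=
  ∑ p ∈ P, (ptCost p S - ptCost (A (c p)) S)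

/-- On a good sample, an accurate estimate of the total excess is an accurate estimate of the cost:
the rest of the cost is constant on each cluster. -/
theorem abs_estimate_sub_cost_le (hc : IsNearest P A c) (hη : 0 ≤ η) {q : Fin m → P}
    (hq : q ∈ goodSamples P A c m η) (S : Fin k → Pt d)
    (hS : |∑ i, excess A c (weight P A c m) S (q i) - totalExcess P A c S|
      ≤ η * totalCost P A S) :
    |∑ i, weight P A c m (q i) * ptCost (q i) S - cost P S| ≤ 3 * η * totalCost P A S := by
  have h1 := abs_sum_sub_le_of_good hq (fun j => ctrDist S (A j) ^ 2) fun j => sq_nonneg _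
  have h2 := mul_le_mul_of_nonneg_left (sum_ctrDist_sq_le hc S) hη
  have h3 : ∑ i, weight P A c m (q i) * ptCost (q i) S - cost P S
      = (∑ i, excess A c (weight P A c m) S (q i) - totalExcess P A c S)
        + (∑ i, weight P A c m (q i) * ctrDist S (A (c (q i))) ^ 2
          - ∑ p ∈ P, ctrDist S (A (c p)) ^ 2) := by
    unfold excess totalExcess cost
    simp only [← ptCost_eq, mul_sub, Finset.sum_sub_distrib]
    ring
  rw [h3]
  refine (abs_add_le _ _).trans ?_
  linarith

theorem two_mul_le_div_add {x y θ : ℝ} (hθ : 0 < θ) : 2 * x * y ≤ x ^ 2 / θ + θ * y ^ 2 := by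
  have h : 0 ≤ (x - θ * y) ^ 2 / θ := by positivity
  have e : (x - θ * y) ^ 2 / θ = x ^ 2 / θ - 2 * x * y + θ * y ^ 2 := by
    field_simp
    ring
  linarith

/-- For solutions much more expensive than `A`, almost all the cost is the cost of the reference
centers, and the excess costs are negligible. -/
theorem abs_excess_sub_le_of_large (hc : IsNearest P A c) (hη : 0 < η) (hη1 : η ≤ 1)
    {q : Fin m → P} (hq : q ∈ goodSamples P A c m η) (S : Fin k → Pt d)
    (hS : 2 ^ 12 * cost P A ≤ η ^ 2 * totalCost P A S) :
    |∑ i, excess A c (weight P A c m) S (q i) - totalExcess P A c S| ≤ η * totalCost P A S := by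
  set Φ := cost P A with hΦ
  set V := totalCost P A S with hV
  -- `2 x y ≤ x ^ 2 / θ + θ * y ^ 2` balances the distances within the clusters against those to `S`
  set θ := η / 12 with hθ
  have hθ0 : 0 < θ := by positivity
  set W := ∑ p ∈ P, ctrDist S (A (c p)) ^ 2 with hW
  have hW2 : W ≤ 2 * V := sum_ctrDist_sq_le hc S
  have hΦ0 : 0 ≤ Φ := cost_nonneg P A
  have hV0 : 0 ≤ V := add_nonneg hΦ0 (cost_nonneg P S)
  have hpt : ∀ p, |ptCost p S - ptCost (A (c p)) S|
      ≤ (1 + 1 / θ) * ‖p - A (c p)‖ ^ 2 + θ * ctrDist S (A (c p)) ^ 2 := by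
    intro p
    have h1 := abs_ptCost_sub_le S p (A (c p))
    have h2 := two_mul_le_div_add (x := ‖p - A (c p)‖) (y := ctrDist S (A (c p))) hθ0
    have h3 : (1 + 1 / θ) * ‖p - A (c p)‖ ^ 2
        = ‖p - A (c p)‖ ^ 2 + ‖p - A (c p)‖ ^ 2 / θ := by ring
    linarith
  have h1 : |totalExcess P A c S| ≤ (1 + 1 / θ) * Φ + θ * W := by
    rw [hΦ, cost_eq_sum hc, hW, Finset.mul_sum, Finset.mul_sum, ← Finset.sum_add_distrib]
    exact (Finset.abs_sum_le_sum_abs _ _).trans (Finset.sum_le_sum fun p _ => hpt p)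
  have h2 : |∑ i, excess A c (weight P A c m) S (q i)|
      ≤ (1 + 1 / θ) * (100 * Φ) + θ * (2 * W) := by
    have h3 := hq.2
    have h4 := abs_sum_sub_le_of_good hq (fun j => ctrDist S (A j) ^ 2) fun j => sq_nonneg _
    have hW0 : 0 ≤ W := Finset.sum_nonneg fun p _ => sq_nonneg _
    have h5 : ∑ i, weight P A c m (q i) * ctrDist S (A (c (q i))) ^ 2 ≤ 2 * W := by
      have := (abs_le.1 h4).2
      nlinarith
    calc _ ≤ ∑ i, ((1 + 1 / θ) * (weight P A c m (q i) * ‖(q i : Pt d) - A (c (q i))‖ ^ 2)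
          + θ * (weight P A c m (q i) * ctrDist S (A (c (q i))) ^ 2)) := by
          refine (Finset.abs_sum_le_sum_abs _ _).trans (Finset.sum_le_sum fun i _ => ?_)
          have hw := weight_nonneg (A := A) (c := c) m (q i).2
          unfold excess
          rw [abs_mul, abs_of_nonneg hw]
          have := mul_le_mul_of_nonneg_left (hpt (q i)) hw
          linarith
      _ ≤ _ := by
          rw [Finset.sum_add_distrib, ← Finset.mul_sum, ← Finset.mul_sum]
          gcongr
  have h3 : (1 + 1 / θ) * Φ ≤ 13 * (Φ / η) := by
    have e : (1 + 1 / θ) * Φ = (η + 12) * (Φ / η) := by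
      rw [hθ]; field_simp
    rw [e]
    gcongr
    linarith
  have h4 : 2 ^ 12 * (Φ / η) ≤ η * V := by
    rw [mul_div_assoc', div_le_iff₀ hη]
    linarith
  have h5 : θ * W ≤ η * V / 6 := by
    calc θ * W ≤ θ * (2 * V) := by gcongr
      _ = _ := by rw [hθ]; ring
  refine (abs_sub _ _).trans ((add_le_add h2 h1).trans ?_)
  have h6 : 0 ≤ η * V := by positivity
  linarith

theorem swapEquiv_sum {Ω : Type*} (F : Ω → ℝ) (σ : Fin m → Bool) (z : (Fin m → Ω) × (Fin m → Ω)) :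
    ∑ i, F ((swapEquiv σ z).1 i) + ∑ i, F ((swapEquiv σ z).2 i)
      = ∑ i, F (z.1 i) + ∑ i, F (z.2 i) := by
  rw [← Finset.sum_add_distrib, ← Finset.sum_add_distrib]
  refine Finset.sum_congr rfl fun i _ => ?_
  rw [swapEquiv_fst, swapEquiv_snd]
  split_ifs
  · rfl
  · exact add_comm _ _

/-- A single sample estimates the excess cost of a fixed solution. -/
theorem half_le_wProb (hP : P.Nonempty) (hc : IsNearest P A c) (hm : 0 < m) (hη : 0 < η)
    (hη2 : η ≤ 2) (hm1 : 1152 ≤ η ^ 2 * m)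
    (hm2 : 2 * k * Real.exp (-(η ^ 2 * m / (16 * k))) ≤ 1 / 100) (hΦ : 0 < cost P A)
    (S : Fin k → Pt d) :
    1 / 2 ≤ wProb (pw fun p : P => prob P A c p) {q : Fin m → P | q ∈ goodSamples P A c m η ∧
      |∑ i, excess A c (weight P A c m) S (q i) - totalExcess P A c S|
        ≤ η * totalCost P A S / 2} := by
  have hk : 1 ≤ k := Fin.pos (Classical.arbitrary (Fin k))
  have hm' : (0 : ℝ) < m := by exact_mod_cast hm
  have hpos : ∀ p : P, 0 ≤ prob P A c p := fun p => prob_nonneg P A c p.2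
  have hsum : ∑ p : P, prob P A c p = 1 := by
    rw [Finset.sum_coe_sort P fun p => prob P A c p]; exact sum_prob P A c hP
  have hV : 0 < totalCost P A S := add_pos_of_pos_of_nonneg hΦ (cost_nonneg P S)
  have hΦV : cost P A ≤ totalCost P A S := le_add_of_nonneg_right (cost_nonneg P S)
  have h1 := wProb_not_goodSamples_le hk hP hc hm hη hη2
  have h2 := wProb_abs_sub_ge_le (m := m) hpos hsum
    (fun x : P => excess A c (weight P A c m) S x) (t := η * totalCost P A S / 2) (by positivity)
  have hmean : m * ∑ x : P, prob P A c x * excess A c (weight P A c m) S x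
      = totalExcess P A c S :=
    sum_prob_mul_weight_mul hk hm fun p => ptCost p S - ptCost (A (c p)) S
  have hvar : m * ∑ x : P, prob P A c x * excess A c (weight P A c m) S x ^ 2
      ≤ 72 * totalCost P A S ^ 2 / m := by
    have e1 : m * ∑ x : P, prob P A c x * excess A c (weight P A c m) S x ^ 2
        = ∑ p ∈ P, weight P A c m p * (ptCost p S - ptCost (A (c p)) S) ^ 2 := by
      rw [← sum_prob_mul_weight_mul (A := A) (c := c) hk hm]
      congr 1
      refine Finset.sum_congr rfl fun x _ => ?_
      unfold excess
      ring
    have e2 : ∀ p ∈ P, weight P A c m p * (ptCost p S - ptCost (A (c p)) S) ^ 2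
        ≤ 4 * cost P A / m * (2 * ‖p - A (c p)‖ ^ 2 + 8 * ctrDist S (A (c p)) ^ 2) := by
      intro p hp
      have hw := weight_nonneg (A := A) (c := c) m hp
      have h3 := weight_mul_cost_le (A := A) hk hc hm hp
      have h4 := pow_le_pow_left₀ (abs_nonneg _) (abs_ptCost_sub_le S p (A (c p))) 2
      rw [sq_abs] at h4
      calc _ ≤ weight P A c m p * (‖p - A (c p)‖ ^ 2
            + 2 * ‖p - A (c p)‖ * ctrDist S (A (c p))) ^ 2 := by gcongr
        _ = weight P A c m p * ‖p - A (c p)‖ ^ 2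
            * (‖p - A (c p)‖ + 2 * ctrDist S (A (c p))) ^ 2 := by ring
        _ ≤ 4 * cost P A / m * (‖p - A (c p)‖ + 2 * ctrDist S (A (c p))) ^ 2 := by gcongr
        _ ≤ _ := by
            gcongr
            nlinarith [sq_nonneg (‖p - A (c p)‖ - 2 * ctrDist S (A (c p)))]
    rw [e1]
    refine (Finset.sum_le_sum e2).trans ?_
    rw [← Finset.mul_sum, Finset.sum_add_distrib, ← Finset.mul_sum, ← Finset.mul_sum,
      ← cost_eq_sum hc]
    have h5 := sum_ctrDist_sq_le hc S
    calc _ ≤ 4 * totalCost P A S / m * (2 * totalCost P A S + 8 * (2 * totalCost P A S)) := by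
          gcongr
      _ = _ := by ring
  rw [hmean] at h2
  have h3 : wProb (pw fun p : P => prob P A c p) {q : Fin m → P | η * totalCost P A S / 2 ≤
      |∑ i, excess A c (weight P A c m) S (q i) - totalExcess P A c S|} ≤ 1 / 4 := by
    refine h2.trans ?_
    rw [div_le_iff₀ (by positivity)]
    refine hvar.trans ?_
    rw [div_le_iff₀ hm']
    have := mul_le_mul_of_nonneg_right hm1 (sq_nonneg (totalCost P A S))
    linarith
  have h4 := wProb_compl (w := pw fun p : P => prob P A c p) (sum_pw hsum)
    {q : Fin m → P | q ∈ goodSamples P A c m η ∧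
      |∑ i, excess A c (weight P A c m) S (q i) - totalExcess P A c S|
        ≤ η * totalCost P A S / 2}
  have h5 := wProb_mono (w := pw fun p : P => prob P A c p) (fun q => pw_nonneg hpos q)
    (s := {q : Fin m → P | q ∈ goodSamples P A c m η ∧
      |∑ i, excess A c (weight P A c m) S (q i) - totalExcess P A c S|
        ≤ η * totalCost P A S / 2}ᶜ)
    (t := (goodSamples P A c m η)ᶜ ∪ {q : Fin m → P | η * totalCost P A S / 2 ≤
      |∑ i, excess A c (weight P A c m) S (q i) - totalExcess P A c S|}) (by
      intro q hq
      by_contra hn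
      rw [Set.mem_union, not_or] at hn
      obtain ⟨hn1, hn2⟩ := hn
      exact hq ⟨not_not.1 hn1, (not_le.1 hn2).le⟩)
  have h6 := wProb_union_le (w := pw fun p : P => prob P A c p) (fun q => pw_nonneg hpos q)
    (goodSamples P A c m η)ᶜ {q : Fin m → P | η * totalCost P A S / 2 ≤
      |∑ i, excess A c (weight P A c m) S (q i) - totalExcess P A c S|}
  linarith

end Core

section Main

variable {d k : ℕ} [Nonempty (Fin k)] {P : Finset (Pt d)} {A : Fin k → Pt d} {c : Pt d → Fin k}
  {m : ℕ} {η : ℝ}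

/-- Two good samples together are balanced, and being balanced is not affected by exchanging
entries; this is the stable set of pairs for symmetrization. -/
def balancedPairs (P : Finset (Pt d)) (A : Fin k → Pt d) (c : Pt d → Fin k) (m : ℕ) :
    Set ((Fin m → P) × (Fin m → P)) :=
  {z | (∀ j, ∑ i, (if c (z.1 i) = j then weight P A c m (z.1 i) else 0)
      + ∑ i, (if c (z.2 i) = j then weight P A c m (z.2 i) else 0) ≤ 4 * clSize P c j) ∧
    ∑ i, weight P A c m (z.1 i) * ‖(z.1 i : Pt d) - A (c (z.1 i))‖ ^ 2
      + ∑ i, weight P A c m (z.2 i) * ‖(z.2 i : Pt d) - A (c (z.2 i))‖ ^ 2 ≤ 200 * cost P A}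

omit [Nonempty (Fin k)] in
theorem swapEquiv_mem_balancedPairs (σ : Fin m → Bool) {z : (Fin m → P) × (Fin m → P)}
    (hz : z ∈ balancedPairs P A c m) : swapEquiv σ z ∈ balancedPairs P A c m := by
  refine ⟨fun j => ?_, ?_⟩
  · rw [swapEquiv_sum (fun x : P => if c x = j then weight P A c m x else 0) σ z]
    exact hz.1 j
  · rw [swapEquiv_sum (fun x : P => weight P A c m x * ‖(x : Pt d) - A (c x)‖ ^ 2) σ z]
    exact hz.2

omit [Nonempty (Fin k)] in
theorem mem_balancedPairs (hη1 : η ≤ 1) {q q' : Fin m → P} (hq : q ∈ goodSamples P A c m η)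
    (hq' : q' ∈ goodSamples P A c m η) : (q, q') ∈ balancedPairs P A c m := by
  refine ⟨fun j => ?_, by linarith [hq.2, hq'.2]⟩
  have hn := clSize_pos P c j
  by_cases hj : j ∈ P.image c
  · have h1 := (abs_le.1 (hq.1 j hj)).2
    have h2 := (abs_le.1 (hq'.1 j hj)).2
    have h3 : η * clSize P c j ≤ 1 * clSize P c j := by gcongr
    change _ + _ ≤ _
    linarith
  · have h0 : ∀ x : P, c x ≠ j := fun x e => hj (e ▸ Finset.mem_image_of_mem c x.2)
    simp only [h0, if_false, Finset.sum_const_zero]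
    linarith

omit [Nonempty (Fin k)] in
theorem balanced_of_mem (hk : 1 ≤ k) (hc : IsNearest P A c) (hm : 0 < m)
    {z : (Fin m → P) × (Fin m → P)} (hz : z ∈ balancedPairs P A c m) :
    Balanced P A c (cost P A) m (Sum.elim (fun i => (z.1 i : Pt d)) fun i => (z.2 i : Pt d))
      (weight P A c m) where
  mem := by rintro (i | i); exacts [(z.1 i).2, (z.2 i).2]
  nonneg := fun p hp => weight_nonneg m hp
  weight_cost := fun p hp => weight_mul_cost_le hk hc hm hp
  weight_size := fun p hp => weight_le_size hk hm hp
  size := fun j => by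
    rw [Fintype.sum_sum_type]
    exact hz.1 j
  total := by
    rw [Fintype.sum_sum_type]
    exact hz.2

/-- The sample size needed for a uniform estimate, in terms of the number `B` of ambiguous
clusters per unit of cost and of the sizes of the codes. -/
theorem wProb_not_uniform_le (hP : P.Nonempty) (hc : IsNearest P A c) (hm : 0 < m) (hη : 0 < η)
    (hη1 : η ≤ 1) (hm1 : 1152 ≤ η ^ 2 * m)
    (hm2 : 2 * k * Real.exp (-(η ^ 2 * m / (16 * k))) ≤ 1 / 100) (hΦ : 0 < cost P A)
    {B Λ : ℝ} (hB0 : 0 ≤ B)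
    (hB : ∀ S : Fin k → Pt d, (ambiguous P A c S).card ≤ B * (totalCost P A S / cost P A))
    {H N L N₀ Q : ℕ} (hH : 2 ^ 30 ≤ η * 2 ^ H) (hN : 2 ^ 12 ≤ η ^ 2 * 2 ^ N)
    (hL : 4 * (k * 2 ^ 7 / η) ≤ 2 ^ L) (hN₀ : 4 * (k * 2 ^ 7 / η) ^ 2 + 1 ≤ N₀)
    (hQ1 : 2 * m + k * (L + 1) + 1 ≤ Q) (hQ2 : 2 * (2 * m + k) + 1 ≤ Q) (hQ3 : 4 ^ H + 1 ≤ Q)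
    (hQ4 : N₀ * 2 ^ H + 1 ≤ Q) (hΛ0 : 0 ≤ Λ)
    (hΛ : N * (2 * (H + 1) * Real.exp (-Λ)) ≤ 1 / 20)
    (hmain : (10 * k + 4 * k * B) * Real.log Q + Λ ≤ η ^ 2 * m / (2 ^ 60 * (H + 1) ^ 2)) :
    wProb (pw fun p : P => prob P A c p) {q : Fin m → P | ∃ S : Fin k → Pt d,
      3 * η * totalCost P A S < |∑ i, weight P A c m (q i) * ptCost (q i) S - cost P S|}
      ≤ 1 / 3 := by
  classical
  have hk : 1 ≤ k := Fin.pos (Classical.arbitrary (Fin k))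
  have hm' : (0 : ℝ) < m := by exact_mod_cast hm
  have hpos : ∀ p : P, 0 ≤ prob P A c p := fun p => prob_nonneg P A c p.2
  have hhpos : ∀ x : Bool, (0 : ℝ) ≤ (fun _ : Bool => (1 / 2 : ℝ)) x := fun _ => by norm_num
  have hsum : ∑ p : P, prob P A c p = 1 := by
    rw [Finset.sum_coe_sort P fun p => prob P A c p]; exact sum_prob P A c hP
  set Φ := cost P A with hΦdef
  set 𝒮 : Type := {S : Fin k → Pt d // η ^ 2 * totalCost P A S < 2 ^ 12 * Φ} with h𝒮
  have hΦV : ∀ S : Fin k → Pt d, Φ ≤ totalCost P A S := fun S =>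
    le_add_of_nonneg_right (cost_nonneg P S)
  -- solutions of cost about `M` for a fixed pair of samples
  have hlevel : ∀ z ∈ balancedPairs P A c m, ∀ κ < N,
      wProb (pw fun _ : Bool => (1 / 2 : ℝ)) {σ : Fin m → Bool | ∃ S : Fin k → Pt d,
        (∑ p ∈ P, ctrDist S (A (c p)) ^ 2 ≤ 2 * (2 ^ (κ + 1) * Φ) ∧
          (ambiguous P A c S).card ≤ ⌊B * 2 ^ (κ + 1)⌋₊) ∧
        2 ^ (κ + 1) ≤ 2 ^ 13 / η ^ 2 ∧
        η * (2 ^ (κ + 1) * Φ) / 4 < |∑ i, sgn (σ i) * (excess A c (weight P A c m) S (z.1 i)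
          - excess A c (weight P A c m) S (z.2 i))|}
        ≤ 2 * (H + 1) * Real.exp (-Λ) := by
    intro z hz κ _
    by_cases hκ : (2 : ℝ) ^ (κ + 1) ≤ 2 ^ 13 / η ^ 2
    · have h1 : (1 : ℝ) ≤ 2 ^ (κ + 1) := one_le_pow₀ (by norm_num)
      have hQ0 : 0 ≤ Real.log Q := Real.log_natCast_nonneg Q
      have hrhs : (η * (2 ^ (κ + 1) * Φ) / (8 * (H + 1))) ^ 2
          / (20 * (2 ^ 49 * Φ * (2 ^ (κ + 1) * Φ) / m))
          = 2 ^ (κ + 1) * (η ^ 2 * m / (1280 * 2 ^ 49 * (H + 1) ^ 2)) := by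
        field_simp
        norm_num
      have hmain' := (balanced_of_mem hk hc hm hz).wProb_signed_excess_le hm
        (fun i => (z.1 i : Pt d)) (fun i => (z.2 i : Pt d)) hΦ (M := 2 ^ (κ + 1) * Φ)
        (by nlinarith) (t := ⌊B * 2 ^ (κ + 1)⌋₊) (U := k * 2 ^ 7 / η) (Λ := Λ) (by positivity)
        (by
          rw [div_pow]
          rw [le_div_iff₀ (by positivity)] at hκ
          rw [div_mul_eq_mul_div, le_div_iff₀ (by positivity)]
          have h2 : 0 ≤ (k : ℝ) ^ 2 * Φ := by positivity
          have h3 := mul_le_mul_of_nonneg_left hκ h2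
          linarith) hL hN₀ hη hH hQ1 hQ2 hQ3 hQ4 hΛ0
        (by
          rw [hrhs]
          have ht : (⌊B * 2 ^ (κ + 1)⌋₊ : ℝ) ≤ B * 2 ^ (κ + 1) := Nat.floor_le (by positivity)
          have hk0 : (0 : ℝ) ≤ k := Nat.cast_nonneg k
          calc 2 * ((5 * k + 2 * k * (⌊B * 2 ^ (κ + 1)⌋₊ : ℝ)) * Real.log Q) + Λ
              ≤ 2 * ((5 * k * 2 ^ (κ + 1) + 2 * k * (B * 2 ^ (κ + 1))) * Real.log Q)
                + Λ * 2 ^ (κ + 1) := by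
                have h2 : 5 * (k : ℝ) ≤ 5 * k * 2 ^ (κ + 1) :=
                  le_mul_of_one_le_right (by positivity) h1
                have h3 : Λ ≤ Λ * 2 ^ (κ + 1) := le_mul_of_one_le_right hΛ0 h1
                gcongr
            _ = 2 ^ (κ + 1) * ((10 * k + 4 * k * B) * Real.log Q + Λ) := by ring
            _ ≤ 2 ^ (κ + 1) * (η ^ 2 * m / (2 ^ 60 * (H + 1) ^ 2)) := by gcongr
            _ ≤ _ := by
                gcongr
                norm_num)
      refine (wProb_mono (fun σ => pw_nonneg hhpos σ) ?_).trans hmain'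
      rintro σ ⟨S, hS, -, hσ⟩
      exact ⟨S, hS, hσ⟩
    · have hempty : {σ : Fin m → Bool | ∃ S : Fin k → Pt d,
          (∑ p ∈ P, ctrDist S (A (c p)) ^ 2 ≤ 2 * (2 ^ (κ + 1) * Φ) ∧
            (ambiguous P A c S).card ≤ ⌊B * 2 ^ (κ + 1)⌋₊) ∧
          2 ^ (κ + 1) ≤ 2 ^ 13 / η ^ 2 ∧
          η * (2 ^ (κ + 1) * Φ) / 4 < |∑ i, sgn (σ i) * (excess A c (weight P A c m) S (z.1 i)
            - excess A c (weight P A c m) S (z.2 i))|} = ∅ := by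
        rw [Set.eq_empty_iff_forall_notMem]
        rintro σ ⟨S, -, h, -⟩
        exact hκ h
      rw [hempty]
      unfold wProb
      simp only [Set.indicator_empty, mul_zero, Finset.sum_const_zero]
      positivity
  have hsym := wProb_deviation_le (m := m) hpos hsum
    (fun (S : 𝒮) (x : P) => excess A c (weight P A c m) S.1 x) (fun S => totalExcess P A c S.1)
    (fun S => η * totalCost P A S.1 / 2) (goodSamples P A c m η) (balancedPairs P A c m)
    (fun σ z hz => swapEquiv_mem_balancedPairs σ hz)
    (fun q hq q' hq' => mem_balancedPairs hη1 hq hq')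
    (fun S => half_le_wProb hP hc hm hη (by linarith) hm1 hm2 hΦ S.1)
    (δ := 1 / 20) (by norm_num)
    (by
      intro z hz
      refine le_trans ?_ hΛ
      have hcover : {σ : Fin m → Bool | ∃ S : 𝒮, η * totalCost P A S.1 / 2 <
          |∑ i, sgn (σ i) * (excess A c (weight P A c m) S.1 (z.1 i)
            - excess A c (weight P A c m) S.1 (z.2 i))|}
          ⊆ ⋃ κ : Fin N, {σ : Fin m → Bool | ∃ S : Fin k → Pt d,
            (∑ p ∈ P, ctrDist S (A (c p)) ^ 2 ≤ 2 * (2 ^ ((κ : ℕ) + 1) * Φ) ∧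
              (ambiguous P A c S).card ≤ ⌊B * 2 ^ ((κ : ℕ) + 1)⌋₊) ∧
            2 ^ ((κ : ℕ) + 1) ≤ 2 ^ 13 / η ^ 2 ∧
            η * (2 ^ ((κ : ℕ) + 1) * Φ) / 4 <
              |∑ i, sgn (σ i) * (excess A c (weight P A c m) S (z.1 i)
                - excess A c (weight P A c m) S (z.2 i))|} := by
        rintro σ ⟨⟨S, hS⟩, hσ⟩
        -- `2 ^ κ` is the dyadic order of magnitude of the cost
        obtain ⟨κ, hκ1, hκ2⟩ := exists_nat_pow_near (x := totalCost P A S / Φ) (y := 2)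
          ((one_le_div hΦ).2 (hΦV S)) (by norm_num)
        rw [le_div_iff₀ hΦ] at hκ1
        have hBS := hB S
        have hκ2' := hκ2
        rw [div_lt_iff₀ hΦ] at hκ2
        have h5 : η ^ 2 * 2 ^ κ < 2 ^ 12 := by
          have := mul_le_mul_of_nonneg_left hκ1 (sq_nonneg η)
          nlinarith
        have hκN : κ < N := by
          by_contra hn
          have h6 : (2 : ℝ) ^ N ≤ 2 ^ κ := pow_le_pow_right₀ (by norm_num) (not_lt.1 hn)
          have h7 := mul_le_mul_of_nonneg_left h6 (sq_nonneg η)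
          linarith
        refine Set.mem_iUnion.2 ⟨⟨κ, hκN⟩, S, ⟨?_, ?_⟩, ?_, ?_⟩
        · have := sum_ctrDist_sq_le hc S
          change _ ≤ 2 * (2 ^ (κ + 1) * Φ)
          linarith
        · refine Nat.le_floor (hBS.trans ?_)
          change _ ≤ B * 2 ^ (κ + 1)
          gcongr
        · change (2 : ℝ) ^ (κ + 1) ≤ _
          rw [le_div_iff₀ (by positivity), pow_succ]
          linarith
        · refine lt_of_le_of_lt ?_ hσ
          change η * (2 ^ (κ + 1) * Φ) / 4 ≤ η * totalCost P A S / 2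
          have := mul_le_mul_of_nonneg_left hκ1 hη.le
          rw [pow_succ]
          linarith
      refine (wProb_mono (fun σ => pw_nonneg hhpos σ) hcover).trans
        ((wProb_iUnion_le (fun σ => pw_nonneg hhpos σ) _).trans
          ((Finset.sum_le_sum fun (κ : Fin N) _ =>
            hlevel z hz κ.1 κ.2).trans (le_of_eq ?_)))
      rw [Finset.sum_const, Finset.card_univ, Fintype.card_fin, nsmul_eq_mul])
  have hgood := wProb_not_goodSamples_le hk hP hc hm hη (by linarith : η ≤ 2)
  refine (wProb_mono (t := (goodSamples P A c m η)ᶜ ∪ {q : Fin m → P | q ∈ goodSamples P A c m η ∧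
      ∃ S : 𝒮, 2 * (η * totalCost P A S.1 / 2) <
        |∑ i, excess A c (weight P A c m) S.1 (q i) - totalExcess P A c S.1|})
    (fun q => pw_nonneg hpos q) ?_).trans
    ((wProb_union_le (fun q => pw_nonneg hpos q) _ _).trans ?_)
  · rintro q ⟨S, hS⟩
    by_contra hn
    rw [Set.mem_union, not_or] at hn
    obtain ⟨hn1, hn2⟩ := hn
    have hq : q ∈ goodSamples P A c m η := not_not.1 hn1
    refine absurd (abs_estimate_sub_cost_le hc hη.le hq S ?_) (not_le.2 hS)
    rcases le_or_gt (2 ^ 12 * Φ) (η ^ 2 * totalCost P A S) with h | h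
    · exact abs_excess_sub_le_of_large hc hη hη1 hq S h
    · by_contra hgt
      refine hn2 ⟨hq, ⟨S, h⟩, ?_⟩
      rw [mul_div_cancel₀ _ (two_ne_zero)]
      exact not_le.1 hgt
  · linarith

end Main

/-! ### The sample size -/

section Numerics

theorem log_le_half {x : ℝ} (hx : 0 < x) : Real.log x ≤ x / 2 := by
  have h1 := Real.log_le_sub_one_of_pos (show 0 < x / 2 by positivity)
  rw [Real.log_div hx.ne' (by norm_num)] at h1
  have h2 := Real.log_two_lt_d9
  linarith

variable {k m T H : ℕ}

/-- The sizes of the alphabets of the codes, with `m` samples, scales up to `2 ^ (k * T)`, recorded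
squared distances up to `(k * T) ^ 2`, and accuracies down to `2 ^ (-H)`. -/
theorem code_size_bounds (hk : 1 ≤ k) (hm : 1 ≤ m) (hT : 1 ≤ T) (hH : 2 ^ H ≤ 2 * T) :
    2 * m + k * (k * T + 1) + 1 ≤ 10 * m * (k * T) ^ 3 ∧
      2 * (2 * m + k) + 1 ≤ 10 * m * (k * T) ^ 3 ∧
      4 ^ H + 1 ≤ 10 * m * (k * T) ^ 3 ∧ (k * T) ^ 2 * 2 ^ H + 1 ≤ 10 * m * (k * T) ^ 3 := by
  set u := k * T with hu
  have hku : k ≤ u := Nat.le_mul_of_pos_right k hT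
  have hTu : T ≤ u := Nat.le_mul_of_pos_left T hk
  have h1 : 1 ≤ u := hk.trans hku
  have h3 : u ≤ u ^ 3 := Nat.le_self_pow (by norm_num) u
  have h2 : u ^ 2 ≤ u ^ 3 := Nat.pow_le_pow_right h1 (by norm_num)
  have hm1 : m ≤ m * u ^ 3 := Nat.le_mul_of_pos_right m (h1.trans h3)
  have hm2 : u ^ 3 ≤ m * u ^ 3 := Nat.le_mul_of_pos_left _ hm
  have e1 : k * (u + 1) ≤ u ^ 2 + u := by nlinarith
  have e3 : 4 ^ H ≤ 4 * u ^ 2 := by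
    calc 4 ^ H = (2 ^ H) ^ 2 := by rw [← pow_mul, mul_comm, pow_mul]; norm_num
      _ ≤ (2 * u) ^ 2 := by gcongr; omega
      _ = _ := by ring
  have e4 : u ^ 2 * 2 ^ H ≤ 2 * u ^ 3 := by
    calc u ^ 2 * 2 ^ H ≤ u ^ 2 * (2 * u) := by gcongr; omega
      _ = _ := by ring
  rw [mul_assoc]
  refine ⟨?_, ?_, ?_, ?_⟩ <;> omega

theorem log_ge_twenty {u : ℝ} (hu : 2 ^ 30 ≤ u) : 20 ≤ Real.log u := by
  have h1 : Real.log (2 ^ 30) ≤ Real.log u := Real.log_le_log (by norm_num) hu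
  rw [Real.log_pow] at h1
  have h2 := Real.log_two_gt_d9
  push_cast at h1
  linarith

theorem scale_count_le (hT : 1 ≤ T) {u : ℝ} (hTu : T ≤ u) (hu : 2 ^ 30 ≤ u)
    (hH : 2 ^ H ≤ 2 * T) : (H : ℝ) + 1 ≤ 2 * Real.log u := by
  have hT' : (1 : ℝ) ≤ T := by exact_mod_cast hT
  have h1 : ((2 : ℝ)) ^ H ≤ 2 * u := by
    have : ((2 ^ H : ℕ) : ℝ) ≤ ((2 * T : ℕ) : ℝ) := by exact_mod_cast hH
    push_cast at this
    linarith
  have h2 := Real.log_le_log (by positivity) h1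
  rw [Real.log_pow, Real.log_mul (by norm_num) (by linarith)] at h2
  have h3 := log_ge_twenty hu
  have h4 := Real.log_two_gt_d9
  have h5 := Real.log_two_lt_d9
  have h6 : (0 : ℝ) ≤ H := Nat.cast_nonneg H
  nlinarith

/-- A number of size `30 Y log u`, with `Y` at most polynomial in `u`, dominates `Y` times its own
logarithm. -/
theorem mul_log_le {Y l x : ℝ} (hY : 0 < Y) (hl : 0 < l) (hlog : Real.log Y ≤ 8 * l)
    (hx : 30 * Y * l ≤ x) : Y * Real.log x + 7 * l * Y ≤ x := by
  have hYl : 0 < Y * l := mul_pos hY hl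
  have hx0 : 0 < x := by linarith
  have h1 := log_le_half (div_pos hx0 hY)
  rw [Real.log_div hx0.ne' hY.ne'] at h1
  have h2 : Real.log x ≤ x / Y / 2 + 8 * l := by linarith
  have h3 : Y * Real.log x ≤ x / 2 + 8 * (Y * l) := by
    calc Y * Real.log x ≤ Y * (x / Y / 2 + 8 * l) := mul_le_mul_of_nonneg_left h2 hY.le
      _ = _ := by field_simp
  linarith

/-- The quantity whose product with `30 log (k T)` is the required sample size. -/
noncomputable def sampleScale (γ η b : ℝ) (k : ℕ) (l : ℝ) : ℝ := 2 ^ 79 * γ * k * b * l ^ 2 / η ^ 2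

theorem le_sampleScale {γ η b l : ℝ} (hγ : 1 ≤ γ) (hη : 0 < η) (hb : 1 ≤ b) :
    2 ^ 79 * k * l ^ 2 ≤ η ^ 2 * sampleScale γ η b k l := by
  have e : η ^ 2 * sampleScale γ η b k l = 2 ^ 79 * k * l ^ 2 * (γ * b) := by
    unfold sampleScale
    field_simp
  have h : (0 : ℝ) ≤ 2 ^ 79 * k * l ^ 2 :=
    mul_nonneg (mul_nonneg (by norm_num) k.cast_nonneg) (sq_nonneg l)
  rw [e]
  exact le_mul_of_one_le_right h (one_le_mul_of_one_le_of_one_le hγ hb)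

theorem log_sampleScale_le {γ η b : ℝ} (hk : 1 ≤ k) (hT : 2 ^ 30 ≤ (T : ℝ)) (hγ : 1 ≤ γ)
    (hη : 0 < η) (hγT : γ ≤ T) (hηT : 1 / η ≤ T) (hb1 : 1 ≤ b) (hbk : b ≤ k) :
    Real.log (sampleScale γ η b k (Real.log (k * T))) ≤ 8 * Real.log (k * T) := by
  have hk' : (1 : ℝ) ≤ k := by exact_mod_cast hk
  have hTu : (T : ℝ) ≤ k * T := le_mul_of_one_le_left (by positivity) hk'
  have hu0 : (0 : ℝ) < k * T := by linarith
  have hl20 := log_ge_twenty (hT.trans hTu)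
  have hlu : Real.log (k * T) ≤ k * T :=
    (Real.log_le_sub_one_of_pos hu0).trans (by linarith)
  have h2 : 1 / η ^ 2 ≤ (T : ℝ) ^ 2 := by
    rw [← one_div_pow]
    exact pow_le_pow_left₀ (by positivity) hηT 2
  have h0 : (0 : ℝ) < sampleScale γ η b k (Real.log (k * T)) := by
    unfold sampleScale
    positivity
  have h1 : sampleScale γ η b k (Real.log (k * T)) ≤ ((k : ℝ) * T) ^ 8 := by
    unfold sampleScale
    generalize Real.log (k * T) = l at *
    calc (2 ^ 79 * γ * k * b * l ^ 2 / η ^ 2 : ℝ)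
        = 2 ^ 79 * (γ * k * b * (1 / η ^ 2)) * l ^ 2 := by ring
      _ ≤ 2 ^ 79 * ((T : ℝ) * k * k * T ^ 2) * (k * T) ^ 2 := by gcongr
      _ ≤ 2 ^ 79 * ((k : ℝ) * T) ^ 3 * (k * T) ^ 2 := by
          gcongr
          calc (T : ℝ) * k * k * T ^ 2 ≤ T * k * k * T ^ 2 * k :=
                le_mul_of_one_le_right (by positivity) hk'
            _ = (k * T) ^ 3 := by ring
      _ ≤ (2 ^ 30) ^ 3 * ((k : ℝ) * T) ^ 3 * (k * T) ^ 2 := by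
          rw [mul_assoc, mul_assoc]
          exact mul_le_mul_of_nonneg_right (by norm_num) (by positivity)
      _ ≤ ((k : ℝ) * T) ^ 3 * (k * T) ^ 3 * (k * T) ^ 2 := by
          rw [mul_assoc, mul_assoc (_ ^ 3)]
          exact mul_le_mul_of_nonneg_right (pow_le_pow_left₀ (by norm_num) (hT.trans hTu) 3)
            (by positivity)
      _ = _ := by ring
  have := Real.log_le_log h0 h1
  rwa [Real.log_pow] at this

/-- The number of codes is polynomial in the sample size and the resolution. -/
theorem log_code_bound_le (hm : 1 ≤ m) {u : ℝ} (hu : u = k * T) (hu30 : 2 ^ 30 ≤ u) :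
    Real.log ((10 * m * (k * T) ^ 3 : ℕ) : ℝ) ≤ Real.log m + 4 * Real.log u := by
  have hm0 : (0 : ℝ) < m := by exact_mod_cast hm
  have hu0 : 0 < u := by linarith
  have e : ((10 * m * (k * T) ^ 3 : ℕ) : ℝ) = 10 * m * u ^ 3 := by push_cast; rw [hu]
  rw [e, Real.log_mul (by positivity) (by positivity), Real.log_mul (by norm_num) hm0.ne',
    Real.log_pow]
  have : Real.log 10 ≤ Real.log u := Real.log_le_log (by norm_num) (by linarith)
  push_cast
  linarith

theorem log_scale_count_le (hH0 : 1 ≤ H) {u : ℝ} (hu : 2 ^ 30 ≤ u)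
    (hH : (H : ℝ) + 1 ≤ 2 * Real.log u) : Real.log (80 * H * (H + 1)) ≤ 3 * Real.log u := by
  have hu0 : 0 < u := by linarith
  have hH0' : (1 : ℝ) ≤ H := by exact_mod_cast hH0
  have hlu : Real.log u ≤ u := (Real.log_le_sub_one_of_pos hu0).trans (by linarith)
  have hH1 : (H : ℝ) + 1 ≤ 2 * u := by linarith
  have hH2 : (H : ℝ) ≤ 2 * u := by linarith
  have h1 : (80 * H * (H + 1) : ℝ) ≤ u ^ 3 := by
    calc (80 * H * (H + 1) : ℝ) ≤ 80 * (2 * u) * (2 * u) := by gcongr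
      _ = 320 * u ^ 2 := by ring
      _ ≤ u * u ^ 2 := mul_le_mul_of_nonneg_right (by linarith) (by positivity)
      _ = u ^ 3 := by ring
  have := Real.log_le_log (by positivity) h1
  rwa [Real.log_pow] at this

/-- The exponent of the chaining bound beats the logarithm of the number of codes. -/
theorem exponent_bound {γ η b k l x y z M h : ℝ} (hk : 1 ≤ k) (hγ : 1 ≤ γ) (hη : 0 < η)
    (hb : 1 ≤ b) (hl : 0 < l) (hh0 : 0 < h) (hh : h ≤ 2 * l) (hz : z ≤ 3 * l) (hy0 : 0 ≤ y)
    (hy : y ≤ x + 4 * l)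
    (hM : 2 ^ 79 * γ * k * b * l ^ 2 / η ^ 2 * x
      + 7 * l * (2 ^ 79 * γ * k * b * l ^ 2 / η ^ 2) ≤ M) :
    (10 * k + 4 * k * (24000 * γ * b)) * y + z ≤ η ^ 2 * M / (2 ^ 60 * h ^ 2) := by
  have hγb : 1 ≤ γ * b := one_le_mul_of_one_le_of_one_le hγ hb
  have hkγb : k ≤ k * (γ * b) := le_mul_of_one_le_right (by linarith) hγb
  have hcoef : 10 * k + 4 * k * (24000 * γ * b) ≤ 2 ^ 17 * γ * k * b := by
    have e : 2 ^ 17 * γ * k * b = 131072 * (k * (γ * b)) := by ring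
    have e' : 4 * k * (24000 * γ * b) = 96000 * (k * (γ * b)) := by ring
    rw [e, e']
    linarith
  have hz' : 3 * l ≤ 3 * l * (2 ^ 17 * γ * k * b) := by
    refine le_mul_of_one_le_right (by linarith) ?_
    linarith
  have hh2 : h ^ 2 ≤ (2 * l) ^ 2 := pow_le_pow_left₀ hh0.le hh 2
  have h1 : (10 * k + 4 * k * (24000 * γ * b)) * y + z
      ≤ 2 ^ 17 * γ * k * b * (x + 7 * l) := by
    have : (10 * k + 4 * k * (24000 * γ * b)) * y ≤ 2 ^ 17 * γ * k * b * (x + 4 * l) :=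
      mul_le_mul hcoef hy hy0 (by positivity)
    linarith
  have hx : 0 ≤ x + 7 * l := by linarith
  rw [le_div_iff₀ (by positivity)]
  calc _ ≤ 2 ^ 17 * γ * k * b * (x + 7 * l) * (2 ^ 60 * (2 * l) ^ 2) := by
        refine mul_le_mul h1 (mul_le_mul_of_nonneg_left hh2 (by positivity)) (by positivity)
          (by positivity)
    _ = η ^ 2 * (2 ^ 79 * γ * k * b * l ^ 2 / η ^ 2 * x
          + 7 * l * (2 ^ 79 * γ * k * b * l ^ 2 / η ^ 2)) := by field_simp
    _ ≤ η ^ 2 * M := mul_le_mul_of_nonneg_left hM (by positivity)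

theorem union_bound_le {u x : ℝ} (hku : k ≤ u) (hu : 2 ^ 30 ≤ u)
    (hx : 2 * Real.log u ≤ x) : 2 * k * Real.exp (-x) ≤ 1 / 100 := by
  have hu0 : 0 < u := by linarith
  have h2 : Real.exp (-x) ≤ 1 / u ^ 2 := by
    have h3 : Real.exp (-(2 * Real.log u)) = 1 / u ^ 2 := by
      rw [Real.exp_neg, two_mul, Real.exp_add, Real.exp_log hu0, one_div, pow_two]
    rw [← h3, Real.exp_le_exp]
    linarith
  calc 2 * k * Real.exp (-x) ≤ 2 * u * (1 / u ^ 2) := by gcongr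
    _ = 2 / u := by field_simp
    _ ≤ _ := by
        rw [div_le_div_iff₀ hu0 (by norm_num)]
        linarith

/-- The sample size dominates the logarithm of the number of codes, which itself depends on the
sample size, but only logarithmically. -/
theorem sample_size_suffices {γ η b : ℝ} (hk : 1 ≤ k) (hT : 1 ≤ T) (hγ : 1 ≤ γ) (hη : 0 < η)
    (hγη : γ * η ≤ 1) (hηT : 2 ^ 30 ≤ η * T) (hb1 : 1 ≤ b) (hbk : b ≤ k) (hH : 2 ^ H ≤ 2 * T)
    (hH0 : 1 ≤ H)
    (hm : 30 * (2 ^ 79 * γ * k * b * Real.log (k * T) ^ 2 / η ^ 2) * Real.log (k * T) ≤ m) :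
    (10 * k + 4 * k * (24000 * γ * b)) * Real.log ((10 * m * (k * T) ^ 3 : ℕ) : ℝ)
        + Real.log (80 * H * (H + 1)) ≤ η ^ 2 * m / (2 ^ 60 * (H + 1) ^ 2) ∧
      1152 ≤ η ^ 2 * m ∧ 2 * k * Real.exp (-(η ^ 2 * m / (16 * k))) ≤ 1 / 100 := by
  have hk' : (1 : ℝ) ≤ k := by exact_mod_cast hk
  have hT' : (1 : ℝ) ≤ T := by exact_mod_cast hT
  have hη1 : η ≤ 1 := (le_mul_of_one_le_left hη.le hγ).trans hγη
  have hT30 : (2 : ℝ) ^ 30 ≤ T := hηT.trans (mul_le_of_le_one_left (by positivity) hη1)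
  have hTu : (T : ℝ) ≤ k * T := le_mul_of_one_le_left (by positivity) hk'
  have hku : (k : ℝ) ≤ k * T := le_mul_of_one_le_right (by positivity) hT'
  have hu30 : (2 : ℝ) ^ 30 ≤ k * T := hT30.trans hTu
  have hl20 := log_ge_twenty hu30
  have hHl := scale_count_le hT hTu hu30 hH
  have hinv : 1 / η ≤ T := by rw [div_le_iff₀ hη, mul_comm]; linarith
  have hγT : γ ≤ T := ((le_div_iff₀ hη).2 hγη).trans hinv
  have hlogY := log_sampleScale_le hk hT30 hγ hη hγT hinv hb1 hbk
  have hΛ := log_scale_count_le hH0 hu30 hHl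
  have hY1 := le_sampleScale (k := k) (l := Real.log (k * T)) hγ hη hb1
  have hQ := log_code_bound_le (k := k) (T := T) (m := m) (u := k * T)
  have hexp := union_bound_le (x := η ^ 2 * m / (16 * k)) hku hu30
  generalize Real.log ((k : ℝ) * T) = l at *
  have hl2 : 1 ≤ l ^ 2 := one_le_pow₀ (by linarith)
  have hl0 : 0 < l := by linarith
  have hY0 : 0 < sampleScale γ η b k l := by
    unfold sampleScale
    positivity
  have hm0 : (0 : ℝ) < m := lt_of_lt_of_le (by positivity) hm
  have hlogm := mul_log_le hY0 hl0 hlogY hm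
  have hkl : (k : ℝ) ≤ k * l ^ 2 := le_mul_of_one_le_right (by positivity) hl2
  have hηm : 30 * (2 ^ 79 * k * l ^ 2) * l ≤ η ^ 2 * m := by
    calc 30 * (2 ^ 79 * k * l ^ 2) * l ≤ 30 * (η ^ 2 * sampleScale γ η b k l) * l := by gcongr
      _ = η ^ 2 * (30 * sampleScale γ η b k l * l) := by ring
      _ ≤ _ := mul_le_mul_of_nonneg_left hm (by positivity)
  have hkll : k * l ≤ k * l ^ 2 * l := mul_le_mul_of_nonneg_right hkl hl0.le
  have hηm' : 32 * (k * l) ≤ η ^ 2 * m := by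
    have h0 : 0 ≤ k * l := by positivity
    have e : 30 * (2 ^ 79 * k * l ^ 2) * l = 30 * 2 ^ 79 * (k * l ^ 2 * l) := by ring
    rw [e] at hηm
    linarith
  have hkl20 : 20 ≤ k * l := hl20.trans (le_mul_of_one_le_left hl0.le hk')
  refine ⟨?_, ?_, hexp ?_⟩
  · exact exponent_bound hk' hγ hη hb1 hl0 (by positivity) hHl hΛ
      (Real.log_natCast_nonneg _) (hQ (by exact_mod_cast hm0) rfl hu30) hlogm
  · have e : 30 * (2 ^ 79 * k * l ^ 2) * l = 30 * 2 ^ 79 * (k * l ^ 2 * l) := by ring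
    rw [e] at hηm
    linarith
  · rw [le_div_iff₀ (by positivity)]
    linarith

/-- The logarithm of the resolution, in terms of `log (2 k / ε)`. -/
theorem log_resolution_le {γ ε : ℝ} (hk : 1 ≤ k) (hγ : 1 ≤ γ) (hε : 0 < ε) (hε1 : ε < 1)
    (hT0 : 1 ≤ T) (hT : (T : ℝ) ≤ 2 ^ 31 * (3 * (1 + γ)) / ε) :
    Real.log (k * T) ≤ (1 + Real.log (2 ^ 33 * (1 + γ)) / Real.log 2) * Real.log (2 * k / ε) := by
  have hk' : (1 : ℝ) ≤ k := by exact_mod_cast hk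
  have hT' : (1 : ℝ) ≤ T := by exact_mod_cast hT0
  have h1 : (k : ℝ) * T ≤ 2 * k / ε * (2 ^ 33 * (1 + γ)) := by
    calc (k : ℝ) * T ≤ k * (2 ^ 31 * (3 * (1 + γ)) / ε) := by gcongr
      _ = k / ε * (1 + γ) * (2 ^ 31 * 3) := by ring
      _ ≤ k / ε * (1 + γ) * (2 ^ 33 * 2) :=
          mul_le_mul_of_nonneg_left (by norm_num) (by positivity)
      _ = _ := by ring
  have h2 := Real.log_le_log (by positivity) h1
  rw [Real.log_mul (show 2 * k / ε ≠ 0 by positivity) (show 2 ^ 33 * (1 + γ) ≠ 0 by positivity)]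
    at h2
  have h3 : Real.log 2 ≤ Real.log (2 * k / ε) := by
    refine Real.log_le_log (by norm_num) ?_
    rw [le_div_iff₀ hε]
    linarith
  have h4 : 0 < Real.log 2 := Real.log_pos (by norm_num)
  have h5 : 0 ≤ Real.log (2 ^ 33 * (1 + γ)) := Real.log_nonneg (by linarith)
  have h6 : Real.log (2 ^ 33 * (1 + γ))
      ≤ Real.log (2 ^ 33 * (1 + γ)) / Real.log 2 * Real.log (2 * k / ε) := by
    rw [div_mul_eq_mul_div, le_div_iff₀ h4]
    gcongr
  linarith

end Numerics

/-- The number of ambiguous clusters per unit of cost. -/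
theorem card_ambiguous_le_mul {d k : ℕ} [Nonempty (Fin k)] {P : Finset (Pt d)}
    {A : Fin k → Pt d} {c : Pt d → Fin k} {β γ : ℝ} (hk : 1 ≤ k) (hβ : 0 < β) (hγ : 1 ≤ γ)
    (hP : P.Nonempty) (hst : IsStable β k P) (hA : IsApprox γ P A) (hc : IsNearest P A c)
    (hΦ : 0 < cost P A) (S : Fin k → Pt d) :
    (ambiguous P A c S).card
      ≤ 24000 * γ * min (k : ℝ) (max 1 β⁻¹) * (totalCost P A S / cost P A) := by
  have hγ0 : 0 ≤ γ := by linarith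
  have happ := hA.cost_le hγ0 hk
  have ho : 0 < opt P k := by
    by_contra hn
    have : opt P k = 0 := le_antisymm (not_lt.1 hn) opt_nonneg
    rw [this] at happ
    linarith
  have hV : 1 ≤ totalCost P A S / cost P A :=
    (one_le_div hΦ).2 (le_add_of_nonneg_right (cost_nonneg P S))
  set v := totalCost P A S / cost P A with hv
  -- there are at most `k` clusters in any case, and this bound keeps the sample size polynomial in
  -- `k` and `1 / η` when `β` is small
  rcases le_total (k : ℝ) (max 1 β⁻¹) with h | h
  · rw [min_eq_left h]
    have h1 : ((ambiguous P A c S).card : ℝ) ≤ k := by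
      exact_mod_cast (Finset.card_le_univ _).trans_eq (Fintype.card_fin k)
    have h2 : (1 : ℝ) ≤ 24000 * γ * v := by nlinarith
    have h3 := mul_le_mul_of_nonneg_left h2 (Nat.cast_nonneg (α := ℝ) k)
    linarith
  · rw [min_eq_right h]
    have h1 := hst.card_ambiguous_le hβ hk ho hP A c S
    rw [← cost_eq_sum hc] at h1
    have h2 := sum_ctrDist_sq_le hc S
    have h3 : cost P A ≤ totalCost P A S := le_add_of_nonneg_right (cost_nonneg P S)
    have h4 : (ambiguous P A c S).card * β * cost P A ≤ γ * (24000 * totalCost P A S) := by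
      have h5 : (0 : ℝ) ≤ (ambiguous P A c S).card * β := by positivity
      have h6 := mul_le_mul_of_nonneg_left happ h5
      have h7 : (ambiguous P A c S).card * β * opt P k ≤ 24000 * totalCost P A S := by linarith
      have h8 := mul_le_mul_of_nonneg_left h7 hγ0
      linarith
    calc ((ambiguous P A c S).card : ℝ)
        = (ambiguous P A c S).card * β * cost P A * (β⁻¹ / cost P A) := by field_simp
      _ ≤ γ * (24000 * totalCost P A S) * (β⁻¹ / cost P A) := by gcongr
      _ = 24000 * γ * β⁻¹ * v := by rw [hv]; ring
      _ ≤ _ := by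
          gcongr
          exact le_max_right _ _

/-- The resolution `T` and the number `H` of scales used for the accuracy `η`. -/
theorem exists_resolution {η : ℝ} (hη : 0 < η) (hη1 : η ≤ 1) :
    ∃ T H : ℕ, 1 ≤ T ∧ 1 ≤ H ∧ 2 ^ 30 ≤ η * T ∧ (T : ℝ) ≤ 2 ^ 31 / η ∧ T ≤ 2 ^ H ∧
      2 ^ H ≤ 2 * T := by
  have h0 : 1 ≤ 2 ^ 30 / η := by
    rw [le_div_iff₀ hη]
    linarith
  have hT1 : 2 ^ 30 / η ≤ (⌈2 ^ 30 / η⌉₊ : ℝ) := Nat.le_ceil _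
  have hT3 : (⌈2 ^ 30 / η⌉₊ : ℝ) ≤ 2 ^ 30 / η + 1 := (Nat.ceil_lt_add_one (by positivity)).le
  generalize ⌈2 ^ 30 / η⌉₊ = T at *
  have hηT : 2 ^ 30 ≤ η * T := by
    rw [div_le_iff₀ hη] at hT1
    linarith
  have hT2 : 2 ≤ T := by
    have h1 : η * T ≤ T := mul_le_of_le_one_left (Nat.cast_nonneg T) hη1
    have : (2 : ℝ) ≤ T := by linarith
    exact_mod_cast this
  refine ⟨T, Nat.clog 2 T, by omega, Nat.clog_pos (by norm_num) hT2, hηT, ?_,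
    Nat.le_pow_clog (by norm_num) T, ?_⟩
  · have e : 2 ^ 31 / η = 2 * (2 ^ 30 / η) := by ring
    rw [e]
    linarith
  · have h1 := (Nat.pow_pred_clog_lt_self (b := 2) (by norm_num) hT2).le
    have h3 := Nat.clog_pos (b := 2) (by norm_num) hT2
    have h2 : 2 ^ Nat.clog 2 T = 2 * 2 ^ (Nat.clog 2 T - 1) := by
      rw [← pow_succ']
      congr 1
      omega
    rw [h2]
    exact Nat.mul_le_mul_left 2 h1

/-- The length scales of the codes reach four times the largest distance of a center of `A` to the
solutions considered, which is `k * 2 ^ 7 / η` in the length unit of its cluster. -/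
theorem resolution_le_pow {k T : ℕ} {η : ℝ} (hη : 0 < η) (hηT : 2 ^ 30 ≤ η * T) :
    4 * ((k : ℝ) * 2 ^ 7 / η) ≤ 2 ^ (k * T) := by
  have h1 : ((k * T : ℕ) : ℝ) ≤ 2 ^ (k * T) := by exact_mod_cast Nat.lt_two_pow_self.le
  refine le_trans ?_ h1
  rw [mul_div_assoc', div_le_iff₀ hη]
  push_cast
  calc 4 * ((k : ℝ) * 2 ^ 7) = k * 2 ^ 9 := by ring
    _ ≤ k * (η * T) := by gcongr; linarith
    _ = _ := by ring

/-- The range of the squared distances recorded for ambiguous clusters. -/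
theorem resolution_sq_le {k T : ℕ} {η : ℝ} (hk : 1 ≤ k) (hη : 0 < η)
    (hη1 : η ≤ 1) (hηT : 2 ^ 30 ≤ η * T) :
    4 * ((k : ℝ) * 2 ^ 7 / η) ^ 2 + 1 ≤ ((k : ℝ) * T) ^ 2 := by
  have h1 : (k : ℝ) * 2 ^ 7 / η ≤ (k * T) / 4 := by
    rw [div_le_iff₀ hη]
    have : (k : ℝ) * 2 ^ 30 ≤ k * (η * T) := mul_le_mul_of_nonneg_left hηT (Nat.cast_nonneg k)
    have e : (k : ℝ) * T / 4 * η = k * (η * T) / 4 := by ring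
    have h0 : (0 : ℝ) ≤ k := Nat.cast_nonneg k
    rw [e]
    linarith
  have h2 : ((k : ℝ) * 2 ^ 7 / η) ^ 2 ≤ (k * T / 4) ^ 2 := pow_le_pow_left₀ (by positivity) h1 2
  have h3 : (2 : ℝ) ≤ k * T := by
    have hk' : (1 : ℝ) ≤ k := by exact_mod_cast hk
    have h4 : η * T ≤ T := mul_le_of_le_one_left (Nat.cast_nonneg T) hη1
    have h5 : (T : ℝ) ≤ k * T := le_mul_of_one_le_left (Nat.cast_nonneg T) hk'
    linarith
  have h4 : (2 : ℝ) ^ 2 ≤ (k * T) ^ 2 := pow_le_pow_left₀ (by norm_num) h3 2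
  have e : ((k : ℝ) * T / 4) ^ 2 = (k * T) ^ 2 / 16 := by ring
  rw [e] at h2
  linarith

variable {d k : ℕ} {P : Finset (Pt d)} {A : Fin k → Pt d} {c : Pt d → Fin k}

/-- If all points coincide with their centers, only the sizes of the clusters have to be
estimated. -/
theorem wProb_not_uniform_le_of_cost_eq_zero {m : ℕ} {η : ℝ} (hk : 1 ≤ k) (hP : P.Nonempty)
    (hc : IsNearest P A c) (hm : 0 < m) (hη : 0 < η) (hη1 : η ≤ 1)
    (hm2 : 2 * k * Real.exp (-(η ^ 2 * m / (16 * k))) ≤ 1 / 100) (h : cost P A = 0) :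
    wProb (pw fun p : P => prob P A c p) {q : Fin m → P | ∃ S : Fin k → Pt d,
      3 * η * totalCost P A S < |∑ i, weight P A c m (q i) * ptCost (q i) S - cost P S|}
      ≤ 1 / 3 := by
  have : Nonempty (Fin k) := ⟨⟨0, hk⟩⟩
  have hpos : ∀ p : P, 0 ≤ prob P A c p := fun p => prob_nonneg P A c p.2
  have h0 : ∀ p ∈ P, p = A (c p) := by
    intro p hp
    have h1 := (Finset.sum_eq_zero_iff_of_nonneg fun p _ => ptCost_nonneg p A).1 h p hp
    rw [ptCost_eq_of_isNearest hc hp] at h1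
    exact sub_eq_zero.1 (norm_eq_zero.1 (pow_eq_zero_iff two_ne_zero |>.1 h1))
  have hsub : {q : Fin m → P | ∃ S : Fin k → Pt d, 3 * η * totalCost P A S <
      |∑ i, weight P A c m (q i) * ptCost (q i) S - cost P S|} ⊆ (goodSamples P A c m η)ᶜ := by
    rintro q ⟨S, hS⟩ hq
    refine absurd (abs_estimate_sub_cost_le hc hη.le hq S ?_) (not_le.2 hS)
    have h1 : ∀ p ∈ P, ptCost p S - ptCost (A (c p)) S = 0 := by
      intro p hp
      rw [← h0 p hp, sub_self]
    have h2 : totalExcess P A c S = 0 := Finset.sum_eq_zero h1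
    have h3 : ∑ i, excess A c (weight P A c m) S (q i) = 0 :=
      Finset.sum_eq_zero fun i _ => by
        unfold excess
        rw [h1 _ (q i).2, mul_zero]
    rw [h2, h3, sub_self, abs_zero]
    exact mul_nonneg hη.le (add_nonneg (cost_nonneg P A) (cost_nonneg P S))
  have h1 := wProb_mono (w := pw fun p : P => prob P A c p)
    (fun q : Fin m → P => pw_nonneg hpos q) hsub
  have h2 := wProb_not_goodSamples_le hk hP hc hm hη (by linarith : η ≤ 2)
  linarith

/-- With the required sample size, the estimate of `cost P S` is accurate relative to
`cost P A + cost P S`, for all `S` at once, with probability at least `2 / 3`. -/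
theorem wProb_not_uniform_le_of_sample_size {m T H : ℕ} {β γ η : ℝ} (hk : 1 ≤ k)
    (hP : P.Nonempty) (hβ : 0 < β) (hst : IsStable β k P) (hA : IsApprox γ P A)
    (hc : IsNearest P A c) (hγ : 1 ≤ γ) (hη : 0 < η) (hγη : γ * η ≤ 1) (hT1 : 1 ≤ T)
    (hH1 : 1 ≤ H) (hηT : 2 ^ 30 ≤ η * T) (hTH : T ≤ 2 ^ H) (hHT : 2 ^ H ≤ 2 * T)
    (hm : 30 * (2 ^ 79 * γ * k * min (k : ℝ) (max 1 β⁻¹) * Real.log (k * T) ^ 2 / η ^ 2)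
      * Real.log (k * T) ≤ m) :
    wProb (pw fun p : P => prob P A c p) {q : Fin m → P | ∃ S : Fin k → Pt d,
      3 * η * totalCost P A S < |∑ i, weight P A c m (q i) * ptCost (q i) S - cost P S|}
      ≤ 1 / 3 := by
  have : Nonempty (Fin k) := ⟨⟨0, hk⟩⟩
  have hk' : (1 : ℝ) ≤ k := by exact_mod_cast hk
  have hη1 : η ≤ 1 := (le_mul_of_one_le_left hη.le hγ).trans hγη
  have hb1 : 1 ≤ min (k : ℝ) (max 1 β⁻¹) := le_min hk' (le_max_left _ _)
  obtain ⟨hmain, hm1, hm2⟩ := sample_size_suffices hk hT1 hγ hη hγη hηT hb1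
    (min_le_left _ _) hHT hH1 hm
  have hmpos : 0 < m := by
    rcases Nat.eq_zero_or_pos m with h | h
    · rw [h] at hm1
      norm_num at hm1
    · exact h
  rcases (cost_nonneg P A).eq_or_lt with h | h
  · exact wProb_not_uniform_le_of_cost_eq_zero hk hP hc hmpos hη hη1 hm2 h.symm
  obtain ⟨q1, q2, q3, q4⟩ := code_size_bounds hk hmpos hT1 hHT
  have hH' : (1 : ℝ) ≤ H := by exact_mod_cast hH1
  have hηH : 2 ^ 30 ≤ η * 2 ^ H := by
    have hTH' : (T : ℝ) ≤ 2 ^ H := by exact_mod_cast hTH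
    exact hηT.trans (mul_le_mul_of_nonneg_left hTH' hη.le)
  refine wProb_not_uniform_le (B := 24000 * γ * min (k : ℝ) (max 1 β⁻¹))
    (Λ := Real.log (80 * H * (H + 1))) (H := H) (N := 2 * H) (L := k * T) (N₀ := (k * T) ^ 2)
    (Q := 10 * m * (k * T) ^ 3) hP hc hmpos hη hη1 hm1 hm2 h (by positivity)
    (card_ambiguous_le_mul hk hβ hγ hP hst hA hc h) hηH ?_ (resolution_le_pow hη hηT) ?_
    q1 q2 q3 q4 ?_ ?_ hmain
  · have h1 : (2 ^ 30 : ℝ) ^ 2 ≤ (η * 2 ^ H) ^ 2 := pow_le_pow_left₀ (by norm_num) hηH 2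
    rw [mul_comm 2 H, pow_mul, ← mul_pow]
    exact le_trans (by norm_num) h1
  · have := resolution_sq_le hk hη hη1 hηT
    exact_mod_cast this
  · refine Real.log_nonneg ?_
    have h1 : (1 : ℝ) ≤ H * (H + 1) := one_le_mul_of_one_le_of_one_le hH' (by linarith)
    linarith
  · rw [Real.exp_neg, Real.exp_log (by positivity)]
    push_cast
    refine le_of_eq ?_
    field_simp
    norm_num

/-- An error relative to `cost P A + cost P S` is one relative to `cost P S`, as `A` is an
approximate solution. -/
theorem isCoreset_of_abs_sub_le [Nonempty (Fin k)] {γ ε : ℝ} (hk : 1 ≤ k) (hγ : 1 ≤ γ)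
    (hε : 0 < ε) (hA : IsApprox γ P A) {m : ℕ} (q : Fin m → P)
    (h : ∀ S : Fin k → Pt d, |∑ i, weight P A c m (q i) * ptCost (q i) S - cost P S|
      ≤ 3 * (ε / (3 * (1 + γ))) * totalCost P A S) :
    IsCoreset k ε P (fun i => (q i : Pt d)) (fun i => weight P A c m (q i)) := by
  intro S
  have hγ0 : 0 ≤ γ := by linarith
  have h2 : totalCost P A S ≤ (1 + γ) * cost P S := by
    have h3 := hA.cost_le hγ0 hk
    have h4 := mul_le_mul_of_nonneg_left (opt_le_cost (P := P) hk S) hγ0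
    unfold totalCost
    linarith
  have h3 : 3 * (ε / (3 * (1 + γ))) * totalCost P A S ≤ ε * cost P S := by
    calc _ ≤ 3 * (ε / (3 * (1 + γ))) * ((1 + γ) * cost P S) := by gcongr
      _ = _ := by field_simp
  have h4 := abs_le.1 ((h S).trans h3)
  constructor <;> linarith [h4.1, h4.2]

end KMeans

open KMeans in
theorem theorem2 :
    ∃ a : ℕ, ∀ γ : ℝ, 1 ≤ γ → ∃ C : ℝ, 0 < C ∧
      ∀ (d k : ℕ) (P : Finset (KMeans.Pt d)) (hP : P.Nonempty) (β ε : ℝ)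
        (A : Fin k → KMeans.Pt d) (c : KMeans.Pt d → Fin k) (m : ℕ),
        1 ≤ k → 0 < β → 0 < ε → ε < 1 →
        KMeans.IsStable β k P →
        KMeans.IsApprox γ P A →
        KMeans.IsNearest P A c →
        C * (k / ε ^ 2) * max 1 β⁻¹ * Real.log (2 * k / ε) ^ a ≤ m →
        2 / 3 ≤ KMeans.sampleLaw P hP A c m
          {q | KMeans.IsCoreset k ε P (fun i => (q i : KMeans.Pt d))
            (fun i => KMeans.weight P A c m (q i))} := by
  -- two logarithmic factors come from the number of chaining scales, the third from the size of
  -- the alphabet of the codes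
  refine ⟨3, fun γ hγ => ?_⟩
  obtain ⟨R, hR⟩ : ∃ R, R = 1 + Real.log (2 ^ 33 * (1 + γ)) / Real.log 2 := ⟨_, rfl⟩
  have hR0 : 0 < R := by
    have h1 : 0 ≤ Real.log (2 ^ 33 * (1 + γ)) := Real.log_nonneg (by linarith)
    have h2 : 0 < Real.log 2 := Real.log_pos (by norm_num)
    rw [hR]
    positivity
  refine ⟨30 * 2 ^ 79 * γ * (3 * (1 + γ)) ^ 2 * R ^ 3, by positivity, ?_⟩
  intro d k P hP β ε A c m hk hβ hε hε1 hst hA hc hm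
  have : Nonempty (Fin k) := ⟨⟨0, hk⟩⟩
  have hk' : (1 : ℝ) ≤ k := by exact_mod_cast hk
  -- the accuracy relative to `cost P A + cost P S ≤ (1 + γ) cost P S`, up to the factor `3` in
  -- `abs_estimate_sub_cost_le`
  obtain ⟨η, hη⟩ : ∃ η, η = ε / (3 * (1 + γ)) := ⟨_, rfl⟩
  have hη0 : 0 < η := by rw [hη]; positivity
  have hγη : γ * η ≤ 1 := by
    have h1 : γ * ε ≤ γ := mul_le_of_le_one_right (by linarith) hε1.le
    rw [hη, mul_div_assoc', div_le_one (by positivity)]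
    linarith
  obtain ⟨T, H, hT1, hH1, hηT, hTle, hTH, hHT⟩ := exists_resolution hη0
    ((le_mul_of_one_le_left hη0.le hγ).trans hγη)
  have hTle' : (T : ℝ) ≤ 2 ^ 31 * (3 * (1 + γ)) / ε := by
    refine hTle.trans_eq ?_
    rw [hη]
    field_simp
  have hlR := log_resolution_le hk hγ hε hε1 hT1 hTle'
  rw [← hR] at hlR
  have hT' : (1 : ℝ) ≤ T := by exact_mod_cast hT1
  have hl0 : 0 ≤ Real.log (k * T) := Real.log_nonneg (one_le_mul_of_one_le_of_one_le hk' hT')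
  have hfail := wProb_not_uniform_le_of_sample_size (m := m) hk hP hβ hst hA hc hγ hη0 hγη hT1
    hH1 hηT hTH hHT (by
      refine le_trans ?_ hm
      have h1 := pow_le_pow_left₀ hl0 hlR 3
      generalize Real.log (k * T) = l at *
      have hb : min (k : ℝ) (max 1 β⁻¹) ≤ max 1 β⁻¹ := min_le_right _ _
      have hb0 : 0 ≤ min (k : ℝ) (max 1 β⁻¹) := by positivity
      generalize min (k : ℝ) (max 1 β⁻¹) = b at *
      calc 30 * (2 ^ 79 * γ * k * b * l ^ 2 / η ^ 2) * l
          = 30 * 2 ^ 79 * γ * k / η ^ 2 * (b * l ^ 3) := by ring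
        _ ≤ 30 * 2 ^ 79 * γ * k / η ^ 2 *
            (max 1 β⁻¹ * (R * Real.log (2 * k / ε)) ^ 3) :=
          mul_le_mul_of_nonneg_left (mul_le_mul hb h1 (by positivity) (by positivity))
            (by positivity)
        _ = _ := by rw [hη]; field_simp)
  have hpos : ∀ p : P, 0 ≤ prob P A c p := fun p => prob_nonneg P A c p.2
  have hsum : ∑ p : P, prob P A c p = 1 := by
    rw [Finset.sum_coe_sort P fun p => prob P A c p]; exact sum_prob P A c hP
  have h1 := wProb_compl (w := pw fun p : P => prob P A c p) (sum_pw (m := m) hsum)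
    {q : Fin m → P | ∃ S : Fin k → Pt d,
      3 * η * totalCost P A S < |∑ i, weight P A c m (q i) * ptCost (q i) S - cost P S|}
  have h2 := wProb_mono (w := pw fun p : P => prob P A c p)
    (s := {q : Fin m → P | ∃ S : Fin k → Pt d, 3 * η * totalCost P A S <
      |∑ i, weight P A c m (q i) * ptCost (q i) S - cost P S|}ᶜ)
    (t := {q : Fin m → P | IsCoreset k ε P (fun i => (q i : Pt d))
      (fun i => weight P A c m (q i))})
    (fun q : Fin m → P => pw_nonneg hpos q) (fun q hq =>
      isCoreset_of_abs_sub_le hk hγ hε hA q fun S => not_lt.1 fun hn => hq ⟨S, hη ▸ hn⟩)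
  rw [sampleLaw_apply hP m]
  have h3 : (2 / 3 : ℝ≥0∞) = ENNReal.ofReal (2 / 3) := by
    rw [ENNReal.ofReal_div_of_pos (by norm_num)]
    simp
  rw [h3]
  exact ENNReal.ofReal_le_ofReal (by linarith)
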